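/- **Setting.** Put a qubit on every bond of the square lattice $\mathbb{Z}^2$. For a set $\Lambda$ of bonds let $\mathfrak{A}(\Lambda)$ be the C*-algebra generated by the Pauli matrices at the bonds of $\Lambda$, and let $\mathfrak{A}$ be the quasi-local algebra (all bonds). Let $\omega_0$ be the ground state of the toric code, i.e. the state with $\omega_0(A_s)=\omega_0(B_p)=1$ for all star operators $A_s=\prod_{j\in \mathrm{star}(s)}\sigma^x_j$ and plaquette operators $B_p=\prod_{j\in\mathrm{plaq}(p)}\sigma^z_j$, with GNS representation $(\pi_0,\mathcal{H}_0)$. *Strings.* A path of type $Z$ is a path on the lattice, a path of type $X$ a path on the dual lattice (which passes through plaquettes and crosses bonds); a path extending to infinity is an infinite path that uses each bond only finitely often. For an infinite path $\gamma$, let $\Gamma_n$ be the product of $\sigma^z$ (type $Z$) or $\sigma^x$ (type $X$) over its first $n$ bonds; the string automorphism is $\rho_\gamma(A)=\lim_n \Gamma_nA\Gamma_n^*$ (norm limit). An endomorphism of $\mathfrak{A}$ is localized in $\Lambda$ if it is the identity on $\mathfrak{A}(\Lambda^c)$. *Cones.* A cone is the set of bonds that meet the closed region between two rays from a lattice point (the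 apex) enclosing an angle in $(0,\pi)$. Fix a cone $\Lambda_a$ and let $\mathfrak{A}^{\Lambda_a}$ be the norm closure of $\bigcup_{x\in\mathbb{Z}^2}\pi_0(\mathfrak{A}((\Lambda_a+x)^c))''$. A string automorphism $\rho$ has a unique extension $\rho^{\Lambda_a}$ to a $*$-endomorphism of $\mathfrak{A}^{\Lambda_a}$ that is weakly continuous on each $\pi_0(\mathfrak{A}((\Lambda_a+x)^c))''$. For disjoint cones write $\Lambda_1<\Lambda_2$ if there is an $x$ such that both are disjoint from $\Lambda_a+x$ and, for every $y$ with $\Lambda_a+y\subset\Lambda_a+x$, $\Lambda_1$ can be rotated counter-clockwise around its apex until it meets $\Lambda_a+y$, remaining disjoint from $\Lambda_2$ throughout. *Braiding.* Let $\rho_1,\rho_2$ be localized in cones $\Lambda_1,\Lambda_2$ that lie in a common cone. Choose a cone $\widehat\Lambda<\Lambda_1$ and a unitary $V\in\mathfrak{A}^{\Lambda_a}$ such that $V\pi_0(\rho_2(A))V^*=\pi_0(A)$ for all $A\in\mathfrak{A}(\widehat\Lambda^c)$, and put $\varepsilon_{\rho_1,\rho_2}=V^*\rho_1^{\Lambda_a}(V)$.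 **Theorem.** Let $\Lambda$ be a cone such that some cone $\widehat\Lambda<\Lambda$ exists, and let $\rho_1,\rho_2$ be given by paths $\gamma_1,\gamma_2$ in $\Lambda$ extending to infinity, each of type $X$ or $Z$. Then $\varepsilon_{\rho_1,\rho_2}$ exists, does not depend on the choices of $\Lambda_1,\Lambda_2,\widehat\Lambda,V$, and: 1. if $\rho_1,\rho_2$ have the same type, then $\varepsilon_{\rho_1,\rho_2}=I$, i.e. $\varepsilon_{X,X}=\varepsilon_{Z,Z}=I$; 2. if $\rho_1=\rho^X$ is of type $X$ and $\rho_2=\rho^Z$ of type $Z$, then either $\varepsilon_{X,Z}=I$ and $\varepsilon_{Z,X}=-I$, or $\varepsilon_{X,Z}=-I$ and $\varepsilon_{Z,X}=I$, where $\varepsilon_{X,Z}=\varepsilon_{\rho^X,\rho^Z}$ and $\varepsilon_{Z,X}=\varepsilon_{\rho^Z,\rho^X}$; 3. the sign is computed by string operators: let $\widehat\Lambda<\Lambda$, let $\widehat\gamma_2$ be a path to infinity in $\widehat\Lambda$ of the type of $\gamma_2$, and for each $n$ let $\widetilde\gamma_n$ be a finite path of this type from the $n$-th site of $\gamma_2$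 to the $n$-th site of $\widehat\gamma_2$, such that $\widetilde\gamma_n$ eventually leaves every finite set of bonds and all these paths avoid some translate $\Lambda_a+x$ (such data exist). Let $V_n$ be the product of the string operators of the first $n$ bonds of $\gamma_2$, of $\widetilde\gamma_n$ and of the first $n$ bonds of $\widehat\gamma_2$. Then $\pi_0(V_n)$ converges weakly to a unitary $V\in\mathfrak{A}^{\Lambda_a}$ with $V\pi_0(\rho_2(A))=\pi_0(\rho_{\widehat\gamma_2}(A))V$ for all $A\in\mathfrak{A}$, and there is $s\in\{1,-1\}$ with $\rho_1(V_n)=sV_n$ for all large $n$ and $\varepsilon_{\rho_1,\rho_2}=sI$. -/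

import Mathlib

open Filter Topology
open scoped ComplexOrder

noncomputable section

namespace ToricCode

/-! ### The lattice -/

/-- Points of the lattice `ℤ²`. A plaquette is labelled by its lower left corner, so that the same
type also labels the plaquettes. -/
abbrev Site : Type := ℤ × ℤ

/-- Bonds of the lattice: `(v, false)` joins `v` to `v + (1, 0)` and `(v, true)` joins `v` to
`v + (0, 1)`. -/
abbrev Bond : Type := Site × Bool

/-- The second endpoint of a bond (the first one is `b.1`). -/
def Bond.tip (b : Bond) : Site := if b.2 then b.1 + (0, 1) else b.1 + (1, 0)

/-- One of the two plaquettes that a bond separates (the other one is `b.1`). -/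
def Bond.otherPlaq (b : Bond) : Site := if b.2 then b.1 - (1, 0) else b.1 - (0, 1)

/-- The two types of strings: `Z` for paths on the lattice, `X` for paths on the dual lattice. -/
inductive Charge : Type
  | X
  | Z

/-- `b` is a step from `v` to `w`: for type `Z`, the points `v`, `w` are the two endpoints of `b`;
for type `X`, the plaquettes `v`, `w` are the two plaquettes on either side of `b`. -/
def Joins : Charge → Bond → Site → Site → Prop
  | .Z, b, v, w => (v = b.1 ∧ w = b.tip) ∨ (v = b.tip ∧ w = b.1)
  | .X, b, v, w => (v = b.1 ∧ w = b.otherPlaq) ∨ (v = b.otherPlaq ∧ w = b.1)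

/-! ### The quasi-local algebra

It is realised in its standard faithful representation on `ℓ²` of the finite spin configurations:
the configuration `S` has spin down exactly at the bonds in the finite set `S`. -/

/-- The Hilbert space with orthonormal basis the finite sets of flipped spins. -/
abbrev SpinSpace : Type := lp (fun _ : Finset Bond => ℂ) 2

theorem memLp_monomial (e : Equiv.Perm (Finset Bond)) (c : Finset Bond → ℤˣ) (f : SpinSpace) :
    Memℓp (E := fun _ : Finset Bond => ℂ) (fun S => ((c S : ℤ) : ℂ) * f (e S)) 2 := by
  have h := lp.memℓp f
  rw [memℓp_gen_iff (by norm_num)] at h ⊢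
  refine ((e.summable_iff).2 h).congr fun S => ?_
  rcases Int.units_eq_one_or (c S) with h | h <;> simp [h]

/-- The operator `(U f) S = c S * f (e S)`, for a permutation `e` and signs `c`. -/
def monomialOp (e : Equiv.Perm (Finset Bond)) (c : Finset Bond → ℤˣ) :
    SpinSpace →ₗᵢ[ℂ] SpinSpace where
  toFun f := ⟨fun S => ((c S : ℤ) : ℂ) * f (e S), memLp_monomial e c f⟩
  map_add' f g := by
    ext S
    exact mul_add _ _ _
  map_smul' a f := by
    ext S
    exact mul_left_comm _ _ _
  norm_map' f := by
    rw [lp.norm_eq_tsum_rpow (by norm_num), lp.norm_eq_tsum_rpow (by norm_num)]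
    congr 1
    refine Eq.trans (tsum_congr fun S => ?_) (e.tsum_eq fun S => ‖f S‖ ^ (2 : ENNReal).toReal)
    rcases Int.units_eq_one_or (c S) with h | h <;> simp [h]

theorem monomialOp_apply (e : Equiv.Perm (Finset Bond)) (c : Finset Bond → ℤˣ) (f : SpinSpace)
    (S : Finset Bond) : monomialOp e c f S = ((c S : ℤ) : ℂ) * f (e S) := rfl

/-- Flipping the spin at `b`. -/
def flipSpin (b : Bond) : Equiv.Perm (Finset Bond) where
  toFun S := symmDiff S {b}
  invFun S := symmDiff S {b}
  left_inv S := by simp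
  right_inv S := by simp

/-- The Pauli matrices `σ^x` (for `X`) and `σ^z` (for `Z`) at the bond `b`. -/
def spinPauli : Charge → Bond → (SpinSpace →L[ℂ] SpinSpace)
  | .X, b => (monomialOp (flipSpin b) 1).toContinuousLinearMap
  | .Z, b => (monomialOp 1 fun S => if b ∈ S then -1 else 1).toContinuousLinearMap

/-- The norm closed `*`-algebra generated by all Pauli matrices. -/
def spinAlgebra : StarSubalgebra ℂ (SpinSpace →L[ℂ] SpinSpace) :=
  (StarAlgebra.adjoin ℂ {T | ∃ k b, T = spinPauli k b}).topologicalClosure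

instance : IsClosed (spinAlgebra : Set (SpinSpace →L[ℂ] SpinSpace)) :=
  StarSubalgebra.isClosed_topologicalClosure _

/-- The C*-algebra of quasi-local observables. -/
def QuasiLocal : Type := spinAlgebra

instance : CStarAlgebra QuasiLocal := inferInstanceAs (CStarAlgebra spinAlgebra)

/-- The usual order of a C*-algebra: `a ≤ b` if and only if `b - a` is positive. -/
instance : PartialOrder QuasiLocal := CStarAlgebra.spectralOrder QuasiLocal

instance : StarOrderedRing QuasiLocal := CStarAlgebra.spectralOrderedRing QuasiLocal

/-- The Pauli matrices as quasi-local observables. -/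
def pauli (k : Charge) (b : Bond) : QuasiLocal :=
  ⟨spinPauli k b, StarSubalgebra.le_topologicalClosure _
    (StarAlgebra.subset_adjoin ℂ _ ⟨k, b, rfl⟩)⟩

/-- The algebra of the observables localized in a set of bonds. -/
def observables (L : Set Bond) : StarSubalgebra ℂ QuasiLocal :=
  (StarAlgebra.adjoin ℂ {A | ∃ k, ∃ b ∈ L, A = pauli k b}).topologicalClosure

/-- The star operator at the point `s`. -/
def starOp (s : Site) : QuasiLocal :=
  pauli .X (s, false) * pauli .X (s, true) *
    pauli .X (s - (1, 0), false) * pauli .X (s - (0, 1), true)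

/-- The plaquette operator at the plaquette with lower left corner `p`. -/
def plaqOp (p : Site) : QuasiLocal :=
  pauli .Z (p, false) * pauli .Z (p, true) *
    pauli .Z (p + (0, 1), false) * pauli .Z (p + (1, 0), true)

/-- `ω` is the (unique) state with value `1` on all star and plaquette operators. -/
structure IsGroundState (ω : QuasiLocal →ₚ[ℂ] ℂ) : Prop where
  map_one : ω 1 = 1
  map_starOp : ∀ s, ω (starOp s) = 1
  map_plaqOp : ∀ p, ω (plaqOp p) = 1

/-! ### Paths, string operators and string automorphisms -/

/-- The product of the Pauli matrices of type `k` along the first `n` members of a sequence of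
bonds. -/
def stringOp (k : Charge) (bond : ℕ → Bond) : ℕ → QuasiLocal
  | 0 => 1
  | n + 1 => stringOp k bond n * pauli k (bond n)

/-- A path of type `k` extending to infinity. -/
structure InfPath (k : Charge) where
  site : ℕ → Site
  bond : ℕ → Bond
  joins : ∀ n, Joins k (bond n) (site n) (site (n + 1))
  toInfinity : Tendsto bond atTop cofinite

/-- The path consists of bonds of `L`. -/
def InfPath.LiesIn {k : Charge} (γ : InfPath k) (L : Set Bond) : Prop := ∀ n, γ.bond n ∈ L

/-- A finite path of type `k` from `v` to `w`. -/
structure FinPath (k : Charge) (v w : Site) where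
  length : ℕ
  site : ℕ → Site
  bond : ℕ → Bond
  joins : ∀ n < length, Joins k (bond n) (site n) (site (n + 1))
  source : site 0 = v
  target : site length = w

/-- The string operator of a finite path. -/
def FinPath.op {k : Charge} {v w : Site} (γ : FinPath k v w) : QuasiLocal :=
  stringOp k γ.bond γ.length

/-- The finite path avoids the bonds of `L`. -/
def FinPath.Avoids {k : Charge} {v w : Site} (γ : FinPath k v w) (L : Set Bond) : Prop :=
  ∀ n < γ.length, γ.bond n ∉ L

/-- The string operator of the first `n` bonds of `γ`. -/
def InfPath.op {k : Charge} (γ : InfPath k) (n : ℕ) : QuasiLocal := stringOp k γ.bond n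

theorem spinPauli_mul_self (k : Charge) (b : Bond) : spinPauli k b * spinPauli k b = 1 := by
  cases k
  · ext f S
    simp [spinPauli, monomialOp_apply, flipSpin]
  · ext f S
    by_cases h : b ∈ S <;> simp [spinPauli, monomialOp_apply, h]

theorem star_spinPauli (k : Charge) (b : Bond) : star (spinPauli k b) = spinPauli k b := by
  have hn : ∀ f, ‖spinPauli k b f‖ = ‖f‖ := by
    cases k
    · exact fun f => (monomialOp (flipSpin b) 1).norm_map f
    · exact fun f => (monomialOp 1 fun S => if b ∈ S then -1 else 1).norm_map f
  have h1 : star (spinPauli k b) * spinPauli k b = 1 :=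
    (ContinuousLinearMap.norm_map_iff_adjoint_comp_self _).1 hn
  calc star (spinPauli k b) = star (spinPauli k b) * (spinPauli k b * spinPauli k b) := by
        rw [spinPauli_mul_self, mul_one]
    _ = spinPauli k b := by rw [← mul_assoc, h1, one_mul]

theorem spinPauli_commute (k l : Charge) {b c : Bond} (h : b ≠ c) :
    spinPauli k b * spinPauli l c = spinPauli l c * spinPauli k b := by
  ext f S
  cases k <;> cases l
  · simp [spinPauli, monomialOp_apply, flipSpin, symmDiff_assoc, symmDiff_comm {b} {c}]
  · have : (c ∈ symmDiff S {b}) ↔ c ∈ S := by simp [Finset.mem_symmDiff, h.symm]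
    simp [spinPauli, monomialOp_apply, flipSpin, this]
  · have : (b ∈ symmDiff S {c}) ↔ b ∈ S := by simp [Finset.mem_symmDiff, h]
    simp [spinPauli, monomialOp_apply, flipSpin, this]
  · simp [spinPauli, monomialOp_apply, mul_left_comm]

theorem pauli_mul_self (k : Charge) (b : Bond) : pauli k b * pauli k b = 1 :=
  Subtype.ext (spinPauli_mul_self k b)

theorem star_pauli (k : Charge) (b : Bond) : star (pauli k b) = pauli k b :=
  Subtype.ext (star_spinPauli k b)

theorem pauli_commute (k l : Charge) {b c : Bond} (h : b ≠ c) :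
    pauli k b * pauli l c = pauli l c * pauli k b :=
  Subtype.ext (spinPauli_commute k l h)

/-- The inclusion of the quasi-local algebra into the bounded operators on `SpinSpace`. -/
def spinInclusion : QuasiLocal →⋆ₐ[ℂ] (SpinSpace →L[ℂ] SpinSpace) := spinAlgebra.subtype

theorem observables_univ : observables Set.univ = ⊤ := by
  refine eq_top_iff.2 fun A _ => ?_
  have hA : spinInclusion A ∈ closure
      (StarAlgebra.adjoin ℂ {T | ∃ k b, T = spinPauli k b} : Set (SpinSpace →L[ℂ] SpinSpace)) :=
    A.2
  have himg : spinInclusion '' {A | ∃ k, ∃ b ∈ Set.univ, A = pauli k b} =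
      {T | ∃ k b, T = spinPauli k b} := by
    ext T
    constructor
    · rintro ⟨_, ⟨k, b, -, rfl⟩, rfl⟩
      exact ⟨k, b, rfl⟩
    · rintro ⟨k, b, rfl⟩
      exact ⟨pauli k b, ⟨k, b, trivial, rfl⟩, rfl⟩
  rw [← himg, ← StarAlgHom.map_adjoin, StarSubalgebra.coe_map] at hA
  have hind : Topology.IsInducing spinInclusion := Topology.IsInducing.subtypeVal
  change A ∈ closure _
  rw [hind.closure_eq_preimage_closure_image]
  exact hA

theorem stringOp_mem_unitary (k : Charge) (bond : ℕ → Bond) (n : ℕ) :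
    stringOp k bond n ∈ unitary QuasiLocal := by
  induction n with
  | zero => exact one_mem _
  | succ n ih =>
    refine mul_mem ih ?_
    rw [Unitary.mem_iff, star_pauli, pauli_mul_self]
    exact ⟨rfl, rfl⟩

/-- The inner automorphism of the quasi-local algebra given by the first `n` bonds of a path. -/
def InfPath.ad {k : Charge} (γ : InfPath k) (n : ℕ) (A : QuasiLocal) : QuasiLocal :=
  γ.op n * A * star (γ.op n)

theorem InfPath.norm_ad {k : Charge} (γ : InfPath k) (n : ℕ) (A : QuasiLocal) :
    ‖γ.ad n A‖ = ‖A‖ := by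
  have h := stringOp_mem_unitary k γ.bond n
  change ‖stringOp k γ.bond n * A * star (stringOp k γ.bond n)‖ = ‖A‖
  rw [CStarRing.norm_mul_mem_unitary _ (Unitary.star_mem h)]
  exact CStarRing.norm_mem_unitary_mul _ h

theorem InfPath.ad_mul {k : Charge} (γ : InfPath k) (n : ℕ) (A B : QuasiLocal) :
    γ.ad n (A * B) = γ.ad n A * γ.ad n B := by
  have h := Unitary.star_mul_self_of_mem (stringOp_mem_unitary k γ.bond n)
  simp only [InfPath.ad, InfPath.op]
  calc _ = stringOp k γ.bond n * A * 1 * B * star (stringOp k γ.bond n) := by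
        simp only [mul_one, mul_assoc]
    _ = _ := by rw [← h]; simp only [mul_assoc]

theorem InfPath.ad_sub {k : Charge} (γ : InfPath k) (n : ℕ) (A B : QuasiLocal) :
    γ.ad n (A - B) = γ.ad n A - γ.ad n B := by
  simp only [InfPath.ad, mul_sub, sub_mul]

theorem InfPath.ad_star {k : Charge} (γ : InfPath k) (n : ℕ) (A : QuasiLocal) :
    γ.ad n (star A) = star (γ.ad n A) := by
  simp only [InfPath.ad, star_mul, star_star, mul_assoc]

theorem InfPath.ad_algebraMap {k : Charge} (γ : InfPath k) (n : ℕ) (r : ℂ) :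
    γ.ad n (algebraMap ℂ QuasiLocal r) = algebraMap ℂ QuasiLocal r := by
  have h := Unitary.mul_star_self_of_mem (stringOp_mem_unitary k γ.bond n)
  rw [InfPath.ad, ← Algebra.commutes, mul_assoc, InfPath.op, h, mul_one]

/-- For every observable `A` the sequence `Γₙ A Γₙ*` converges in norm. -/
theorem InfPath.exists_tendsto_ad {k : Charge} (γ : InfPath k) (A : QuasiLocal) :
    ∃ B, Tendsto (fun n => γ.ad n A) atTop (𝓝 B) := by
  let K : StarSubalgebra ℂ QuasiLocal :=
    { carrier := {A | ∃ B, Tendsto (fun n => γ.ad n A) atTop (𝓝 B)}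
      mul_mem' := by
        rintro A B ⟨A', hA⟩ ⟨B', hB⟩
        exact ⟨A' * B', by simpa only [InfPath.ad_mul] using hA.mul hB⟩
      add_mem' := by
        rintro A B ⟨A', hA⟩ ⟨B', hB⟩
        exact ⟨A' + B', by simpa only [InfPath.ad, mul_add, add_mul] using hA.add hB⟩
      star_mem' := by
        rintro A ⟨A', hA⟩
        exact ⟨star A', by simpa only [InfPath.ad_star] using hA.star⟩
      algebraMap_mem' := fun r =>
        ⟨algebraMap ℂ QuasiLocal r, by simpa only [InfPath.ad_algebraMap] using tendsto_const_nhds⟩ }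
  have hclosed : IsClosed (K : Set QuasiLocal) := by
    refine isClosed_of_closure_subset fun A hA => ?_
    refine cauchySeq_tendsto_of_complete (Metric.cauchySeq_iff.2 fun ε hε => ?_)
    obtain ⟨B, ⟨B', hB⟩, hAB⟩ := Metric.mem_closure_iff.1 hA (ε / 3) (by positivity)
    obtain ⟨N, hN⟩ := Metric.cauchySeq_iff.1 hB.cauchySeq (ε / 3) (by positivity)
    refine ⟨N, fun m hm n hn => ?_⟩
    have hd : ∀ n, dist (γ.ad n A) (γ.ad n B) < ε / 3 := fun n => by
      rw [dist_eq_norm, ← InfPath.ad_sub, InfPath.norm_ad, ← dist_eq_norm]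
      exact hAB
    have h1 := hd m
    have h2 := hd n
    rw [dist_comm] at h2
    have h3 := hN m hm n hn
    have h4 := dist_triangle4 (γ.ad m A) (γ.ad m B) (γ.ad n B) (γ.ad n A)
    linarith
  have hpauli : ∀ l c, pauli l c ∈ K := by
    intro l c
    have hev : ∀ᶠ n in atTop, γ.bond n ≠ c :=
      γ.toInfinity.eventually ((Set.finite_singleton c).compl_mem_cofinite)
    obtain ⟨N, hN⟩ := eventually_atTop.1 hev
    refine ⟨γ.ad N (pauli l c), tendsto_atTop_of_eventually_const (i₀ := N) fun n hn => ?_⟩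
    induction n, hn using Nat.le_induction with
    | base => rfl
    | succ n hn ih =>
      rw [← ih]
      simp only [InfPath.ad, InfPath.op, stringOp, star_mul, star_pauli]
      calc _ = stringOp k γ.bond n * (pauli k (γ.bond n) * pauli l c) * pauli k (γ.bond n) *
            star (stringOp k γ.bond n) := by simp only [mul_assoc]
        _ = stringOp k γ.bond n * pauli l c * (pauli k (γ.bond n) * pauli k (γ.bond n)) *
            star (stringOp k γ.bond n) := by
              rw [pauli_commute k l (hN n hn)]; simp only [mul_assoc]
        _ = _ := by rw [pauli_mul_self, mul_one]
  have hle : observables Set.univ ≤ K := by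
    refine StarSubalgebra.topologicalClosure_minimal ?_ hclosed
    refine StarAlgebra.adjoin_le ?_
    rintro _ ⟨l, c, -, rfl⟩
    exact hpauli l c
  exact hle (observables_univ ▸ StarSubalgebra.mem_top)

/-- The string automorphism `ρ_γ`: the norm limit of `Ad Γₙ`, where `Γₙ` is the string operator of
the first `n` bonds of the path `γ`. -/
def InfPath.aut {k : Charge} (γ : InfPath k) : QuasiLocal →⋆ₐ[ℂ] QuasiLocal where
  toFun A := limUnder atTop fun n => γ.ad n A
  map_one' := Tendsto.limUnder_eq (by
    simpa only [← map_one (algebraMap ℂ QuasiLocal), InfPath.ad_algebraMap] using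
      tendsto_const_nhds)
  map_mul' A B := Tendsto.limUnder_eq (by
    simpa only [InfPath.ad_mul] using
      (tendsto_nhds_limUnder (γ.exists_tendsto_ad A)).mul
        (tendsto_nhds_limUnder (γ.exists_tendsto_ad B)))
  map_zero' := Tendsto.limUnder_eq (by
    simpa only [← map_zero (algebraMap ℂ QuasiLocal), InfPath.ad_algebraMap] using
      tendsto_const_nhds)
  map_add' A B := Tendsto.limUnder_eq (by
    simpa only [InfPath.ad, mul_add, add_mul] using
      (tendsto_nhds_limUnder (γ.exists_tendsto_ad A)).add
        (tendsto_nhds_limUnder (γ.exists_tendsto_ad B)))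
  commutes' r := Tendsto.limUnder_eq (by
    simpa only [InfPath.ad_algebraMap] using tendsto_const_nhds)
  map_star' A := Tendsto.limUnder_eq (by
    simpa only [InfPath.ad_star] using (tendsto_nhds_limUnder (γ.exists_tendsto_ad A)).star)

theorem InfPath.tendsto_aut {k : Charge} (γ : InfPath k) (A : QuasiLocal) :
    Tendsto (fun n => γ.op n * A * star (γ.op n)) atTop (𝓝 (γ.aut A)) :=
  tendsto_nhds_limUnder (γ.exists_tendsto_ad A)

/-! ### Cones -/

/-- A cone is given by its apex, a lattice point, by the direction of the first of its two boundary
rays and by the angle between the two rays (in counter-clockwise direction). -/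
structure Cone where
  apex : Site
  direction : ℝ
  angle : ℝ
  angle_pos : 0 < angle
  angle_lt_pi : angle < Real.pi

/-- The closed region of the plane between the two boundary rays. -/
def Cone.region (L : Cone) : Set (ℝ × ℝ) :=
  {z | ∃ r : ℝ, 0 ≤ r ∧ ∃ t ∈ Set.Icc L.direction (L.direction + L.angle),
    z = ((L.apex.1 : ℝ) + r * Real.cos t, (L.apex.2 : ℝ) + r * Real.sin t)}

/-- A lattice point as a point of the plane. -/
def Site.toPlane (v : Site) : ℝ × ℝ := (v.1, v.2)

/-- The bonds of a cone: those contained in the region, or intersected by a boundary ray. -/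
def Cone.bonds (L : Cone) : Set Bond :=
  {b | (segment ℝ (Site.toPlane b.1) (Site.toPlane b.tip) ∩ L.region).Nonempty}

/-- The cone translated by `x`. -/
def Cone.translate (L : Cone) (x : Site) : Cone := { L with apex := L.apex + x }

/-- The cone rotated counter-clockwise by the angle `θ` around its apex. -/
def Cone.rotate (L : Cone) (θ : ℝ) : Cone := { L with direction := L.direction + θ }

/-- The order `L₁ < L₂` of two disjoint cones, relative to the forbidden cone `La`: both avoid some
translate `La + x`, and for all translates `La + y` contained in `La + x` the cone `L₁` can be
rotated counter-clockwise around its apex until it meets `La + y`, in such a way that it is disjoint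
from `L₂` at any intermediate angle. -/
def Before (La L₁ L₂ : Cone) : Prop :=
  Disjoint L₁.bonds L₂.bonds ∧
  ∃ x : Site, Disjoint L₁.bonds (La.translate x).bonds ∧
    Disjoint L₂.bonds (La.translate x).bonds ∧
    ∀ y : Site, (La.translate y).bonds ⊆ (La.translate x).bonds →
      ∃ θ : ℝ, 0 ≤ θ ∧ ¬ Disjoint (L₁.rotate θ).bonds (La.translate y).bonds ∧
        ∀ t ∈ Set.Icc 0 θ, Disjoint (L₁.rotate t).bonds L₂.bonds

/-! ### The auxiliary algebra and the braiding -/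

section Braiding

variable (ω : QuasiLocal →ₚ[ℂ] ℂ)

/-- The bounded operators on the GNS Hilbert space of `ω`. -/
abbrev Op : Type := ω.GNS →L[ℂ] ω.GNS

/-- The GNS representation of `ω`. -/
def gnsRep : QuasiLocal →⋆ₐ[ℂ] Op ω := ω.gnsStarAlgHom

/-- The von Neumann algebra (double commutant) generated by the observables localized in `L`. -/
def vonNeumann (L : Set Bond) : StarSubalgebra ℂ (Op ω) :=
  StarSubalgebra.centralizer ℂ
    (StarSubalgebra.centralizer ℂ (gnsRep ω '' observables L : Set (Op ω)) : Set (Op ω))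

/-- The auxiliary algebra: the norm closure of the (directed) union over all `x` of the von Neumann
algebras of the complements of the translated cones `La + x`. -/
def auxAlgebra (La : Cone) : StarSubalgebra ℂ (Op ω) :=
  (⨆ x : Site, vonNeumann ω ((La.translate x).bonds)ᶜ).topologicalClosure

theorem vonNeumann_le_auxAlgebra (La : Cone) (x : Site) :
    vonNeumann ω ((La.translate x).bonds)ᶜ ≤ auxAlgebra ω La :=
  (le_iSup (fun x : Site => vonNeumann ω ((La.translate x).bonds)ᶜ) x).trans
    (StarSubalgebra.le_topologicalClosure _)

/-- `ρ'` is the extension of the endomorphism `ρ` of the quasi-local algebra to the auxiliary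
algebra: it is continuous in the weak operator topology on each of the von Neumann algebras of the
complements of the translated cones `La + x`. -/
structure IsAuxExtension (La : Cone) (ρ : QuasiLocal →⋆ₐ[ℂ] QuasiLocal)
    (ρ' : auxAlgebra ω La →⋆ₐ[ℂ] auxAlgebra ω La) : Prop where
  extends_rep : ∀ (A : QuasiLocal) (T : auxAlgebra ω La),
    (T : Op ω) = gnsRep ω A → (ρ' T : Op ω) = gnsRep ω (ρ A)
  weakly_continuous : ∀ x : Site, Continuous
    fun T : {T : ω.GNS →WOT[ℂ] ω.GNS // T.toCLM ∈ vonNeumann ω ((La.translate x).bonds)ᶜ} =>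
      ContinuousLinearMapWOT.ofCLM
        (ρ' ⟨T.1.toCLM, vonNeumann_le_auxAlgebra ω La x T.2⟩ : Op ω)

/-- The endomorphism `ρ` is localized in `L`. -/
def IsLocalized (ρ : QuasiLocal →⋆ₐ[ℂ] QuasiLocal) (L : Set Bond) : Prop :=
  ∀ A ∈ observables Lᶜ, ρ A = A

/-- `ε` is a braiding operator `ε_{ρ₁,ρ₂}`, relative to the forbidden cone `La`: the endomorphisms
`ρ₁`, `ρ₂` are localized in cones `L₁`, `L₂` that are contained in a common cone `L`, the unitary
`V` of the auxiliary algebra transports `ρ₂` to a representation localized in some cone `M < L₁`,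
and `ε = V* ρ₁(V)`, where `ρ₁` is extended to the auxiliary algebra. -/
def IsBraiding (La : Cone) (ρ₁ ρ₂ : QuasiLocal →⋆ₐ[ℂ] QuasiLocal) (ε : Op ω) : Prop :=
  ∃ L₁ L₂ L M : Cone, IsLocalized ρ₁ L₁.bonds ∧ IsLocalized ρ₂ L₂.bonds ∧
    L₁.bonds ∪ L₂.bonds ⊆ L.bonds ∧ Before La M L₁ ∧
    ∃ ρ₁' : auxAlgebra ω La →⋆ₐ[ℂ] auxAlgebra ω La, IsAuxExtension ω La ρ₁ ρ₁' ∧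
    ∃ V : auxAlgebra ω La, V ∈ unitary (auxAlgebra ω La) ∧
      (∀ A ∈ observables (M.bonds)ᶜ,
        (V : Op ω) * gnsRep ω (ρ₂ A) * star (V : Op ω) = gnsRep ω A) ∧
      ε = (star V * ρ₁' V : auxAlgebra ω La)

/-- The set of all values of the braiding operator `ε_{ρ₁,ρ₂}`, over all admissible choices. -/
def braidings (La : Cone) (ρ₁ ρ₂ : QuasiLocal →⋆ₐ[ℂ] QuasiLocal) : Set (Op ω) :=
  {ε | IsBraiding ω La ρ₁ ρ₂ ε}

end Braiding

/-- The data defining a net of string operators that transports the charge of the path `γ` (in the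
cone `L`) to a cone `M < L`: a path `endPath` to infinity in `M` and, for every `n`, a path `link n`
from the `n`-th site of `γ` to the `n`-th site of `endPath`, such that the links tend to infinity and
everything avoids some fixed translate of the forbidden cone `La`. -/
structure TransportNet (La L : Cone) {k : Charge} (γ : InfPath k) where
  M : Cone
  before : Before La M L
  endPath : InfPath k
  endPath_liesIn : endPath.LiesIn M.bonds
  link : ∀ n, FinPath k (γ.site n) (endPath.site n)
  link_toInfinity : ∀ F : Set Bond, F.Finite → ∀ᶠ n in atTop, (link n).Avoids F
  shift : Site
  path_avoids : γ.LiesIn ((La.translate shift).bonds)ᶜ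
  endPath_avoids : endPath.LiesIn ((La.translate shift).bonds)ᶜ
  link_avoids : ∀ n, (link n).Avoids (La.translate shift).bonds

/-- The `n`-th string operator `Vₙ` of the net. -/
def TransportNet.op {La L : Cone} {k : Charge} {γ : InfPath k} (N : TransportNet La L γ) (n : ℕ) :
    QuasiLocal :=
  γ.op n * (N.link n).op * N.endPath.op n

end ToricCode

end

open ToricCode

noncomputable section

namespace ToricCode

open scoped CStarAlgebra

/-! ### Chains modulo two -/

/-! A string operator depends only on a finite chain of bonds modulo two, and strings of types `X`
and `Z` commute up to `(-1)` to the number of common bonds (`chainOp_mul_chainOp`). The theorem thus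
becomes a statement about intersection numbers in the plane, once sequences of strings are turned
into unitaries.

Analysis. The plane has no first homology, so a finite cycle is a sum of stars or plaquettes
(`mem_span_of_bd_eq_zero`) and its string operator fixes the ground state vector. If chains `c n`
have constant boundary and converge bond by bond, two late ones differ by a far away cycle, which
commutes with a given local observable and fixes the vector. Hence the string operators converge
strongly to a self-adjoint unitary (`IsGroundState.exists_transporter`); if the limit chain is the
sum of two paths, it intertwines their automorphisms. For paths off a set of bonds with one end,
such as a cone, the chains can be chosen to avoid that set (`InfPath.exists_transport`,
`Cone.oneEnded`). Transporting `γ₁` into a translate of `La` gives a unitary that implements `ρ₁`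
outside the translate. By the double commutant theorem the extension of `ρ₁` must be conjugation
with it on the von Neumann algebra there, and these conjugations define the extension.

The braiding is a sign. If `V` is the limit of string operators of `c n`, this conjugation
multiplies each of them by the sign of its intersection with `γ₁`, which is eventually constant. A
general `V` is compared with a transporter `V₀` of this kind with the same target cone: `V * V₀`
commutes with the observables outside that cone, while `ρ₁` is implemented far away by limits of
strings avoiding it. So the extension fixes `V * V₀`, and `V` yields the same sign (`braidings_eq`).

Computing the sign. Up to a finite chain, `γ₁` together with a path `δ` in `La` is the coboundary of
a potential `f`, and the exponent of the sign is the sum of the values of `f` at infinity at the two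
ends of the transport (`eventually_pair_eq`). The order `M < L` allows `M` to be turned to the first
ray of `La` without meeting `L`, so the value in `M` is the value on that side of `La` and does not
depend on `M` (`Before.endValue_eq`). Equal types give no sign. For different types, choose targets
`γ'`, `η'` in disjoint parts of `M`. The intersection number of `γ + γ'` with `η + η'` is seen by
both transports (`exists_eventually_pair_pair`) and cancels in the sum of the exponents, leaving the
contributions of `γ'` and `η'`. The directions follow each other as `γ'`, `η'`, `La`, `L` around the
circle: `γ'` and `La` separate `η'` from `L`, but `η'` and `La` do not separate `γ'` from `L`. Hence
the exponents add up to one. -/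

/-- Finite chains of bonds with coefficients modulo two. -/
abbrev Chain : Type := Bond →₀ ZMod 2

/-- The other type of strings. -/
def Charge.dual : Charge → Charge
  | .X => .Z
  | .Z => .X

@[simp] theorem Charge.dual_dual (k : Charge) : k.dual.dual = k := by cases k <;> rfl

theorem Charge.eq_or_eq_dual (k l : Charge) : l = k ∨ l = k.dual := by
  cases k <;> cases l <;> simp [Charge.dual]

theorem Charge.dual_ne (k : Charge) : k.dual ≠ k := by cases k <;> simp [Charge.dual]

/-- The end of a bond different from `b.1`, on the lattice or on the dual lattice. -/
def Bond.target : Charge → Bond → Site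
  | .Z, b => b.tip
  | .X, b => b.otherPlaq

theorem joins_iff {k : Charge} {b : Bond} {v w : Site} :
    Joins k b v w ↔ (v = b.1 ∧ w = b.target k) ∨ (v = b.target k ∧ w = b.1) := by
  cases k <;> rfl

theorem Joins.symm {k : Charge} {b : Bond} {v w : Site} (h : Joins k b v w) : Joins k b w v := by
  rw [joins_iff] at h ⊢
  tauto

theorem Bond.target_ne (k : Charge) (b : Bond) : b.target k ≠ b.1 := by
  obtain ⟨⟨x, y⟩, c⟩ := b
  cases k <;> cases c <;> simp [Bond.target, Bond.tip, Bond.otherPlaq]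

/-- The coboundary of a function on the points of the lattice or of the dual lattice. -/
def cobd (k : Charge) (f : Site → ZMod 2) (b : Bond) : ZMod 2 := f b.1 + f (b.target k)

/-- The evaluation of a cochain on finite chains. -/
def pair (S : Bond → ZMod 2) : Chain →ₗ[ZMod 2] ZMod 2 := Finsupp.linearCombination (ZMod 2) S

/-- The boundary of a finite chain. -/
def bd (k : Charge) : Chain →ₗ[ZMod 2] (Site →₀ ZMod 2) :=
  Finsupp.linearCombination (ZMod 2) fun b =>
    Finsupp.single b.1 1 + Finsupp.single (b.target k) 1

/-- The four bonds incident to a point of the lattice or of the dual lattice. -/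
def inc : Charge → Site → Chain
  | .Z, v => Finsupp.single (v, false) 1 + Finsupp.single (v, true) 1 +
      Finsupp.single (v - (1, 0), false) 1 + Finsupp.single (v - (0, 1), true) 1
  | .X, v => Finsupp.single (v, false) 1 + Finsupp.single (v, true) 1 +
      Finsupp.single (v + (0, 1), false) 1 + Finsupp.single (v + (1, 0), true) 1

@[simp] theorem pair_single (S : Bond → ZMod 2) (b : Bond) (a : ZMod 2) :
    pair S (Finsupp.single b a) = a * S b := by
  simp [pair]

theorem pair_add_left (S T : Bond → ZMod 2) (c : Chain) :
    pair (S + T) c = pair S c + pair T c := by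
  simp [pair, Finsupp.linearCombination_apply, Finsupp.sum, mul_add, Finset.sum_add_distrib]

theorem pair_congr {S T : Bond → ZMod 2} {c : Chain} (h : ∀ b, c b ≠ 0 → S b = T b) :
    pair S c = pair T c := by
  simp only [pair, Finsupp.linearCombination_apply, Finsupp.sum]
  exact Finset.sum_congr rfl fun b hb => by rw [h b (Finsupp.mem_support_iff.1 hb)]

theorem pair_eq_zero {S : Bond → ZMod 2} {c : Chain} (h : ∀ b, c b ≠ 0 → S b = 0) :
    pair S c = 0 := by
  rw [pair_congr (T := 0) h]
  simp [pair]

theorem pair_comm (c d : Chain) : pair c d = pair d c := by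
  induction c using Finsupp.induction_linear with
  | zero => simp [pair, Finsupp.linearCombination_apply]
  | add f g hf hg => rw [Finsupp.coe_add, pair_add_left, hf, hg, map_add]
  | single b a =>
    rw [pair_single]
    induction d using Finsupp.induction_linear with
    | zero => simp
    | add f g hf hg => rw [map_add, hf, hg, Finsupp.add_apply, mul_add]
    | single b' a' =>
      by_cases hb : b = b'
      · simp [hb, mul_comm]
      · simp [hb, Ne.symm hb]

@[simp] theorem bd_single (k : Charge) (b : Bond) :
    bd k (Finsupp.single b 1) = Finsupp.single b.1 1 + Finsupp.single (b.target k) 1 := by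
  simp [bd]

theorem Joins.bd_single {k : Charge} {b : Bond} {v w : Site} (h : Joins k b v w) :
    bd k (Finsupp.single b 1) = Finsupp.single v 1 + Finsupp.single w 1 := by
  rw [joins_iff] at h
  rcases h with ⟨rfl, rfl⟩ | ⟨rfl, rfl⟩
  · simp
  · simp [add_comm]

/-- The coboundary is the transpose of the boundary. -/
theorem pair_cobd (k : Charge) (f : Site → ZMod 2) (c : Chain) :
    pair (cobd k f) c = Finsupp.linearCombination (ZMod 2) f (bd k c) := by
  induction c using Finsupp.induction_linear with
  | zero => simp
  | add f g hf hg => rw [map_add, map_add, map_add, hf, hg]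
  | single b a =>
    have : Finsupp.single b a = a • Finsupp.single b (1 : ZMod 2) := by simp
    rw [this, map_smul, map_smul, map_smul]
    simp [cobd]

/-- The star of `v` is the coboundary of the point mass at `v`; this turns pairing with `inc k v`
into reading off a boundary coefficient in `pair_inc`. -/
theorem inc_apply (k : Charge) (v : Site) (b : Bond) :
    inc k v b = cobd k (Pi.single v 1) b := by
  obtain ⟨⟨x, y⟩, c⟩ := b
  obtain ⟨p, q⟩ := v
  cases k <;> cases c <;>
  simp only [inc, cobd, Bond.target, Bond.tip, Bond.otherPlaq, Finsupp.add_apply,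
    Finsupp.single_apply, Pi.single_apply, Prod.mk.injEq, Prod.mk_sub_mk, Prod.mk_add_mk] <;>
  simp <;> grind

theorem pair_inc (c : Chain) (k : Charge) (v : Site) : pair c (inc k v) = bd k c v := by
  rw [pair_comm, pair_congr (T := cobd k (Pi.single v 1)) fun b _ => inc_apply k v b, pair_cobd]
  simp [Finsupp.linearCombination_apply, Finsupp.sum, Pi.single_apply, eq_comm]

theorem add_self_finsupp {α : Type*} (x : α →₀ ZMod 2) : x + x = 0 := by
  ext
  simp [CharTwo.add_self_eq_zero]

/-- Around an elementary cycle each of the four corners is met by two bonds and cancels modulo two.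
-/
theorem bd_inc_dual (k : Charge) (v : Site) : bd k (inc k.dual v) = 0 := by
  obtain ⟨x, y⟩ := v
  have h : ∀ A B C D : Site →₀ ZMod 2, A + B + (A + C) + (C + D) + (B + D) = 0 :=
    fun A B C D => by
      calc _ = (A + A) + (B + B) + (C + C) + (D + D) := by abel
        _ = 0 := by simp only [add_self_finsupp, add_zero]
  cases k
  · simp only [inc, Charge.dual, map_add, bd_single, Bond.target, Bond.otherPlaq,
      Prod.mk_sub_mk, if_true, Bool.false_eq_true, if_false, sub_zero]
    rw [← h]
  · simp only [inc, Charge.dual, map_add, bd_single, Bond.target, Bond.tip,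
      Prod.mk_add_mk, if_true, Bool.false_eq_true, if_false, add_zero]
    rw [← h]

/-! ### Potentials -/

theorem exists_int_primitive (a : ℤ → ZMod 2) :
    ∃ g : ℤ → ZMod 2, g 0 = 0 ∧ ∀ n, g (n + 1) = g n + a n := by
  let g : ℤ → ZMod 2 := fun n => match n with
    | Int.ofNat n => ∑ i ∈ Finset.range n, a i
    | Int.negSucc n => ∑ i ∈ Finset.range (n + 1), a (-(i + 1))
  refine ⟨g, by change ∑ i ∈ Finset.range 0, a i = 0; simp, fun n => ?_⟩
  match n with
  | Int.ofNat n =>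
    change ∑ i ∈ Finset.range (n + 1), a i = _
    rw [Finset.sum_range_succ]
    rfl
  | Int.negSucc 0 =>
    change (∑ i ∈ Finset.range 0, a i) = ∑ i ∈ Finset.range 1, a (-(i + 1)) + a (Int.negSucc 0)
    have : (Int.negSucc 0 : ℤ) = -1 := rfl
    simp [this, CharTwo.add_self_eq_zero]
  | Int.negSucc (n + 1) =>
    change ∑ i ∈ Finset.range (n + 1), a (-(i + 1)) =
      ∑ i ∈ Finset.range (n + 1 + 1), a (-(i + 1)) + a (Int.negSucc (n + 1))
    have : (Int.negSucc (n + 1) : ℤ) = -((n + 1 : ℕ) + 1) := by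
      rw [Int.negSucc_eq]
    rw [Finset.sum_range_succ _ (n + 1), this, add_assoc, CharTwo.add_self_eq_zero, add_zero]

theorem pair_inc_X (S : Bond → ZMod 2) (v : Site) : pair S (inc .X v) =
    S (v, false) + S (v, true) + S (v + (0, 1), false) + S (v + (1, 0), true) := by
  simp [inc]

theorem pair_inc_Z (S : Bond → ZMod 2) (v : Site) : pair S (inc .Z v) =
    S (v, false) + S (v, true) + S (v - (1, 0), false) + S (v - (0, 1), true) := by
  simp [inc]

/-- Integrate along the horizontal axis and then along each column. The relation for horizontal
bonds holds on the axis by construction and is carried from row to row, upwards and downwards, by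
closedness on each plaquette. -/
theorem exists_potential_Z {S : Bond → ZMod 2} (hS : ∀ v, pair S (inc .X v) = 0) :
    ∃ f, S = cobd .Z f := by
  obtain ⟨g, -, hg⟩ := exists_int_primitive fun x => S ((x, 0), false)
  choose h h0 hh using fun x : ℤ => exists_int_primitive fun y => S ((x, y), true)
  have h2 : (2 : ZMod 2) = 0 := rfl
  have key : ∀ x y : ℤ, S ((x, y + 1), false) = S ((x, y), false) + S ((x, y), true) +
      S ((x + 1, y), true) := fun x y => by
    have := hS (x, y)
    rw [pair_inc_X] at this
    simp only [Prod.mk_add_mk, add_zero] at this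
    linear_combination this - (S ((x, y), false) + S ((x, y), true) + S ((x + 1, y), true)) * h2
  have horiz : ∀ x y : ℤ, g (x + 1) + h (x + 1) y = g x + h x y + S ((x, y), false) := fun x y => by
    induction y using Int.induction_on with
    | zero => rw [h0, h0, hg]; ring
    | succ n ih =>
      rw [hh, hh, key]
      linear_combination ih + S ((x, n), true) * h2 * (-1)
    | pred n ih =>
      have e1 := hh (x + 1) (-n - 1)
      have e2 := hh x (-n - 1)
      have e3 := key x (-n - 1)
      simp only [sub_add_cancel] at e1 e2 e3
      rw [e1, e2, e3] at ih
      linear_combination ih + S ((x, -n - 1), true) * h2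
  refine ⟨fun v => g v.1 + h v.1 v.2, ?_⟩
  ext ⟨⟨x, y⟩, c⟩
  cases c
  · simp only [cobd, Bond.target, Bond.tip, Prod.mk_add_mk, add_zero]
    simp only [Bool.false_eq_true, if_false]
    rw [horiz]
    linear_combination -(g x + h x y) * h2
  · simp only [cobd, Bond.target, Bond.tip, Prod.mk_add_mk, add_zero, if_true]
    rw [hh]
    linear_combination -(g x + h x y) * h2

/-- A cochain on the plane that is closed is a coboundary. -/
theorem exists_potential {k : Charge} {S : Bond → ZMod 2} (hS : ∀ v, pair S (inc k v) = 0) :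
    ∃ f, S = cobd k.dual f := by
  cases k
  · exact exists_potential_Z hS
  -- The point reflection, combined with exchanging horizontal and vertical bonds, interchanges the
  -- lattice and the dual lattice.
  · obtain ⟨f, hf⟩ := exists_potential_Z (S := fun b => S (-b.1, !b.2)) fun v => by
      have := hS (-v)
      rw [pair_inc_Z] at this
      rw [pair_inc_X, ← this]
      simp only [Bool.not_false, Bool.not_true, neg_add, ← sub_eq_add_neg]
      ring
    refine ⟨fun v => f (-v), ?_⟩
    ext ⟨⟨x, y⟩, c⟩
    have := congrFun hf ((-x, -y), !c)
    cases c <;>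
    simpa [cobd, Bond.target, Bond.tip, Charge.dual, Bond.otherPlaq, neg_add_eq_sub] using this

/-- A finite cycle is a sum of elementary cycles. -/
theorem mem_span_of_bd_eq_zero {k : Charge} {c : Chain} (hc : bd k c = 0) :
    c ∈ Submodule.span (ZMod 2) (Set.range (inc k.dual)) := by
  -- A functional that kills the elementary cycles but not `c` would be a closed cochain, hence a
  -- coboundary, and a coboundary vanishes on every cycle.
  by_contra hmem
  obtain ⟨φ, hφ, hle⟩ := Submodule.exists_le_ker_of_notMem hmem
  have hpair : φ = pair fun b => φ (Finsupp.single b 1) := by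
    ext b
    simp
  obtain ⟨f, hf⟩ := exists_potential (k := k.dual) (S := fun b => φ (Finsupp.single b 1))
    fun v => by
      rw [← hpair]
      exact hle (Submodule.subset_span ⟨v, rfl⟩)
  apply hφ
  rw [hpair, hf, pair_cobd, Charge.dual_dual, hc, map_zero]

/-! ### Chains of paths -/

section Path

variable {k : Charge} (γ : InfPath k)

/-- The chain of the first `n` bonds of a path. -/
def InfPath.prefixChain (n : ℕ) : Chain := ∑ i ∈ Finset.range n, Finsupp.single (γ.bond i) 1

theorem InfPath.prefixChain_succ (n : ℕ) :
    γ.prefixChain (n + 1) = γ.prefixChain n + Finsupp.single (γ.bond n) 1 :=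
  Finset.sum_range_succ _ _

theorem InfPath.eventually_ne (b : Bond) : ∀ᶠ n in atTop, γ.bond n ≠ b :=
  γ.toInfinity.eventually ((Set.finite_singleton b).compl_mem_cofinite)

theorem InfPath.exists_eventually_prefixChain (b : Bond) :
    ∃ s, ∀ᶠ n in atTop, γ.prefixChain n b = s := by
  obtain ⟨N, hN⟩ := eventually_atTop.1 (γ.eventually_ne b)
  refine ⟨γ.prefixChain N b, eventually_atTop.2 ⟨N, fun n hn => ?_⟩⟩
  induction n, hn using Nat.le_induction with
  | base => rfl
  | succ n hn ih => rw [γ.prefixChain_succ, Finsupp.add_apply, ih, Finsupp.single_apply,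
      if_neg (hN n hn), add_zero]

/-- The parity of the number of times a path uses a bond. -/
def InfPath.parity (b : Bond) : ZMod 2 := (γ.exists_eventually_prefixChain b).choose

theorem InfPath.eventually_prefixChain (b : Bond) :
    ∀ᶠ n in atTop, γ.prefixChain n b = γ.parity b :=
  (γ.exists_eventually_prefixChain b).choose_spec

theorem InfPath.prefixChain_eq_zero {b : Bond} (h : ∀ n, γ.bond n ≠ b) (n : ℕ) :
    γ.prefixChain n b = 0 := by
  induction n with
  | zero => simp [InfPath.prefixChain]
  | succ n ih => rw [γ.prefixChain_succ, Finsupp.add_apply, ih, Finsupp.single_apply,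
      if_neg (h n), add_zero]

theorem InfPath.parity_eq_zero {b : Bond} (h : ∀ n, γ.bond n ≠ b) : γ.parity b = 0 := by
  obtain ⟨n, hn⟩ := (γ.eventually_prefixChain b).exists
  rw [← hn, γ.prefixChain_eq_zero h]

variable {γ} in
theorem InfPath.LiesIn.parity_eq_zero {L : Set Bond} (h : γ.LiesIn L) {b : Bond} (hb : b ∉ L) :
    γ.parity b = 0 :=
  γ.parity_eq_zero fun n hn => hb (by rw [← hn]; exact h n)

variable {γ} in
theorem InfPath.LiesIn.prefixChain_eq_zero {L : Set Bond} (h : γ.LiesIn L) {b : Bond} (hb : b ∉ L)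
    (n : ℕ) : γ.prefixChain n b = 0 :=
  γ.prefixChain_eq_zero (fun n hn => hb (by rw [← hn]; exact h n)) n

theorem InfPath.bd_prefixChain (n : ℕ) : bd k (γ.prefixChain n) =
    Finsupp.single (γ.site 0) 1 + Finsupp.single (γ.site n) 1 := by
  induction n with
  | zero => simp [InfPath.prefixChain, CharTwo.add_self_eq_zero, ← Finsupp.single_add]
  | succ n ih =>
    rw [γ.prefixChain_succ, map_add, ih, (γ.joins n).bd_single, add_assoc,
      ← add_assoc (Finsupp.single (γ.site n) 1), ← Finsupp.single_add,
      CharTwo.add_self_eq_zero, Finsupp.single_zero, zero_add]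

theorem finite_incident (k : Charge) (v : Site) : {b : Bond | b.1 = v ∨ b.target k = v}.Finite := by
  refine (inc k v).support.finite_toSet.subset fun b hb => ?_
  have hne := b.target_ne k
  simp only [Finset.mem_coe, Finsupp.mem_support_iff, inc_apply, cobd]
  rcases hb with rfl | rfl
  · simp [hne]
  · simp [hne.symm]

theorem InfPath.eventually_site_ne (v : Site) : ∀ᶠ n in atTop, γ.site n ≠ v := by
  filter_upwards [γ.toInfinity.eventually (finite_incident k v).compl_mem_cofinite] with n hn hv
  apply hn
  rcases joins_iff.1 (γ.joins n) with h | h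
  · exact Or.inl (h.1 ▸ hv)
  · exact Or.inr (h.1 ▸ hv)

/-- A sequence of chains that converges pointwise converges on every finite chain. -/
theorem eventually_pair {c : ℕ → Chain} {S : Bond → ZMod 2}
    (h : ∀ b, ∀ᶠ n in atTop, c n b = S b) (d : Chain) :
    ∀ᶠ n in atTop, pair (c n) d = pair S d := by
  have := (Finset.eventually_all d.support).2 fun b _ => h b
  filter_upwards [this] with n hn
  exact pair_congr fun b hb => hn b (Finsupp.mem_support_iff.2 hb)

/-- Once the path has left `v` for good, only its starting point can contribute to the boundary at
`v`. -/
theorem InfPath.pair_parity_inc (v : Site) :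
    pair γ.parity (inc k v) = (Finsupp.single (γ.site 0) 1 : Site →₀ ZMod 2) v := by
  obtain ⟨n, h1, h2⟩ := ((eventually_pair γ.eventually_prefixChain (inc k v)).and
    (γ.eventually_site_ne v)).exists
  rw [← h1, pair_inc, γ.bd_prefixChain, Finsupp.add_apply, Finsupp.single_apply (a := γ.site n),
    if_neg h2, add_zero]

end Path

/-! ### Intersection numbers -/

/-- A cycle and a cycle on the dual lattice have an even number of common bonds. -/
theorem pair_cycles {k : Charge} {c d : Chain} (hc : bd k c = 0) (hd : bd k.dual d = 0) :
    pair c d = 0 := by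
  have h := mem_span_of_bd_eq_zero hd
  rw [Charge.dual_dual] at h
  clear hd
  induction h using Submodule.span_induction with
  | mem x hx =>
    obtain ⟨v, rfl⟩ := hx
    rw [pair_inc, hc, Finsupp.zero_apply]
  | zero => exact map_zero _
  | add x y _ _ hx hy => rw [map_add, hx, hy, add_zero]
  | smul a x _ hx => rw [map_smul, hx, smul_zero]

theorem eventually_pair_comm {c : ℕ → Chain} {S : Bond → ZMod 2}
    (h : ∀ b, ∀ᶠ n in atTop, c n b = S b) (d : Chain) :
    ∀ᶠ n in atTop, pair d (c n) = pair S d := by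
  simpa only [pair_comm d] using eventually_pair h d

theorem eq_of_add_eq_zero_zmod {a b : ZMod 2} (h : a + b = 0) : a = b :=
  CharTwo.add_eq_zero.1 h

/-- The intersection numbers of two sequences of chains with constant boundaries, one on the
lattice and one on the dual lattice, are eventually constant. -/
theorem exists_eventually_pair_pair {k : Charge} {c d : ℕ → Chain} {S T : Bond → ZMod 2}
    (hc : ∀ b, ∀ᶠ n in atTop, c n b = S b) (hd : ∀ b, ∀ᶠ n in atTop, d n b = T b)
    (hbc : ∀ n, bd k (c n) = bd k (c 0)) (hbd : ∀ n, bd k.dual (d n) = bd k.dual (d 0)) :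
    ∃ s, (∀ᶠ n in atTop, pair S (d n) = s) ∧ ∀ᶠ n in atTop, pair T (c n) = s := by
  -- The four terms form the intersection number of the cycles `c m + c m'` and `d n + d n'`.
  have key : ∀ m m' n n', pair (c m) (d n) + pair (c m) (d n') + pair (c m') (d n) +
      pair (c m') (d n') = 0 := fun m m' n n' => by
    have := pair_cycles (k := k) (c := c m + c m') (d := d n + d n')
      (by rw [map_add, hbc m, hbc m', add_self_finsupp])
      (by rw [map_add, hbd n, hbd n', add_self_finsupp])
    rw [Finsupp.coe_add, pair_add_left, map_add, map_add] at this
    rw [← this]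
    ring
  obtain ⟨m₀, hm₀⟩ := eventually_atTop.1 (eventually_pair hc (d 0))
  obtain ⟨n₀, hn₀⟩ := eventually_atTop.1 (eventually_pair_comm hd (c 0))
  -- Uniform in `n`: convergence against the single chain `d 0` suffices, because `key` compares `d
  -- n` with `d 0`.
  have h1 : ∀ m ≥ m₀, ∀ n, pair (c m) (d n) = pair (c m₀) (d n) := fun m hm n => by
    have := key m m₀ n 0
    rw [hm₀ m hm, hm₀ m₀ le_rfl] at this
    refine eq_of_add_eq_zero_zmod ?_
    rw [← this]
    linear_combination -CharTwo.add_self_eq_zero (pair S (d 0))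
  have h2 : ∀ n ≥ n₀, ∀ m, pair (c m) (d n) = pair (c m) (d n₀) := fun n hn m => by
    have := key m 0 n n₀
    rw [hn₀ n hn, hn₀ n₀ le_rfl] at this
    refine eq_of_add_eq_zero_zmod ?_
    rw [← this]
    linear_combination -CharTwo.add_self_eq_zero (pair T (c 0))
  refine ⟨pair (c m₀) (d n₀), ?_, ?_⟩
  · filter_upwards [eventually_ge_atTop n₀] with n hn
    obtain ⟨m, hm, hm'⟩ := ((eventually_pair hc (d n)).and (eventually_ge_atTop m₀)).exists
    rw [← hm, h1 m hm', h2 n hn]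
  · filter_upwards [eventually_ge_atTop m₀] with m hm
    obtain ⟨n, hn, hn'⟩ := ((eventually_pair_comm hd (c m)).and (eventually_ge_atTop n₀)).exists
    rw [← hn, h1 m hm, h2 n hn']

/-! ### Lattice steps and finite chains with prescribed boundary -/

theorem exists_joins_fst (k : Charge) (v : Site) :
    ∃ b, Joins k b v (v + (1, 0)) ∧ (b.1 = v ∨ b.1 = v + (1, 0)) := by
  cases k
  · exact ⟨(v + (1, 0), true), by simp [joins_iff, Bond.target, Bond.otherPlaq], Or.inr rfl⟩
  · exact ⟨(v, false), by simp [joins_iff, Bond.target, Bond.tip], Or.inl rfl⟩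

theorem exists_joins_snd (k : Charge) (v : Site) :
    ∃ b, Joins k b v (v + (0, 1)) ∧ (b.1 = v ∨ b.1 = v + (0, 1)) := by
  cases k
  · exact ⟨(v + (0, 1), false), by simp [joins_iff, Bond.target, Bond.otherPlaq], Or.inr rfl⟩
  · exact ⟨(v, true), by simp [joins_iff, Bond.target, Bond.tip], Or.inl rfl⟩

theorem exists_chain (k : Charge) (v w : Site) :
    ∃ e : Chain, bd k e = Finsupp.single v 1 + Finsupp.single w 1 := by
  let r : Site → Site → Prop := fun v w =>
    ∃ e : Chain, bd k e = Finsupp.single v 1 + Finsupp.single w 1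
  have hrefl : ∀ v, r v v := fun v => ⟨0, by rw [map_zero, add_self_finsupp]⟩
  have hstep : ∀ {u v w : Site} {b : Bond}, Joins k b v w → r u v → r u w := by
    rintro u v w b hb ⟨e, he⟩
    refine ⟨e + Finsupp.single b 1, ?_⟩
    rw [map_add, he, hb.bd_single, add_assoc, ← add_assoc (Finsupp.single v 1),
      add_self_finsupp, zero_add]
  have h1 : ∀ x y z : ℤ, r (x, y) (x + z, y) := fun x y z => by
    induction z using Int.induction_on with
    | zero => simpa using hrefl (x, y)
    | succ n ih =>
      obtain ⟨b, hb, -⟩ := exists_joins_fst k (x + n, y)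
      simpa [add_assoc] using hstep hb ih
    | pred n ih =>
      obtain ⟨b, hb, -⟩ := exists_joins_fst k (x + (-n - 1), y)
      refine hstep hb.symm ?_
      simpa [add_assoc] using ih
  have h2 : ∀ (u : Site) (x y z : ℤ), r u (x, y) → r u (x, y + z) := fun u x y z hu => by
    induction z using Int.induction_on with
    | zero => simpa using hu
    | succ n ih =>
      obtain ⟨b, hb, -⟩ := exists_joins_snd k (x, y + n)
      simpa [add_assoc] using hstep hb ih
    | pred n ih =>
      obtain ⟨b, hb, -⟩ := exists_joins_snd k (x, y + (-n - 1))
      refine hstep hb.symm ?_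
      simpa [add_assoc] using ih
  have := h2 v w.1 v.2 (w.2 - v.2) (by simpa using h1 v.1 v.2 (w.1 - v.1))
  simpa using this

/-- A finite chain whose boundary consists of two points contains a path between them. -/
theorem exists_finPath {k : Charge} {c : Chain} {v w : Site}
    (hc : bd k c = Finsupp.single v 1 + Finsupp.single w 1) :
    ∃ p : FinPath k v w, ∀ n < p.length, c (p.bond n) ≠ 0 := by
  classical
  let r : Site → Site → Prop := fun v w => ∃ b, c b ≠ 0 ∧ Joins k b v w
  have hr : Relation.ReflTransGen r v w := by
    by_contra hvw
    -- The indicator of the points reachable along bonds of `c` has no jump on `c`, whereas its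
    -- pairing with the boundary of `c` would be one.
    let f : Site → ZMod 2 := fun u => if Relation.ReflTransGen r v u then 1 else 0
    have h0 : pair (cobd k f) c = 0 := pair_eq_zero fun b hb => by
      have h1 : r b.1 (b.target k) := ⟨b, hb, joins_iff.2 (Or.inl ⟨rfl, rfl⟩)⟩
      have h2 : r (b.target k) b.1 := ⟨b, hb, joins_iff.2 (Or.inr ⟨rfl, rfl⟩)⟩
      have : Relation.ReflTransGen r v b.1 ↔ Relation.ReflTransGen r v (b.target k) :=
        ⟨fun h => h.tail h1, fun h => h.tail h2⟩
      simp only [cobd, f, this]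
      exact CharTwo.add_self_eq_zero _
    rw [pair_cobd, hc, map_add] at h0
    simp [f, hvw, Relation.ReflTransGen.refl] at h0
  clear hc
  induction hr with
  | refl => exact ⟨⟨0, fun _ => v, fun _ => (v, true), by simp, rfl, rfl⟩, by simp⟩
  | @tail u w _ huw ih =>
    obtain ⟨p, hp⟩ := ih
    obtain ⟨b, hb, hj⟩ := huw
    refine ⟨⟨p.length + 1, fun i => if i ≤ p.length then p.site i else w,
      fun i => if i < p.length then p.bond i else b, ?_, by simpa using p.source, by simp⟩, ?_⟩
    · intro n hn
      rcases Nat.lt_succ_iff_lt_or_eq.1 hn with h | rfl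
      · simpa [h, h.le, Nat.succ_le_iff] using p.joins n h
      · simpa [p.target] using hj
    · intro n hn
      rcases Nat.lt_succ_iff_lt_or_eq.1 hn with h | rfl
      · simpa [h] using hp n h
      · simpa using hb

/-! ### Sets of bonds with one end -/

/-- Outside a finite set, the function `f` has the value `a` at both ends of the bonds of `B`. -/
def EndValue (k : Charge) (B : Set Bond) (f : Site → ZMod 2) (a : ZMod 2) : Prop :=
  {b ∈ B | ¬ (f b.1 = a ∧ f (b.target k) = a)}.Finite

/-- A function that is constant along all but finitely many bonds of `B` is constant outside a
finite set. -/
def OneEnded (k : Charge) (B : Set Bond) : Prop :=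
  ∀ f : Site → ZMod 2, {b ∈ B | cobd k f b ≠ 0}.Finite → ∃ a, EndValue k B f a

/-- The square with centre `0` and side length `2 n`. -/
def box (n : ℕ) : Finset Site := Finset.Icc (-(n : ℤ), -(n : ℤ)) ((n : ℤ), (n : ℤ))

theorem mem_box {n : ℕ} {v : Site} : v ∈ box n ↔ |v.1| ≤ n ∧ |v.2| ≤ n := by
  simp only [box, Finset.mem_Icc, Prod.le_def, abs_le]
  tauto

theorem eventually_mem_box (v : Site) : ∀ᶠ n in atTop, v ∈ box n := by
  filter_upwards [eventually_ge_atTop (max |v.1| |v.2|).toNat] with n hn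
  rw [mem_box]
  omega

theorem sum_inc_apply (k : Charge) (f : Site → ZMod 2) (s : Finset Site) (b : Bond) :
    (∑ v ∈ s, f v • inc k v) b = cobd k (fun v => if v ∈ s then f v else 0) b := by
  simp only [Finsupp.finsetSum_apply, Finsupp.smul_apply, inc_apply, cobd, smul_eq_mul, mul_add,
    Finset.sum_add_distrib]
  simp [Pi.single_apply]

/-- A closed chain that is almost zero on a set with one end is a pointwise limit of finite cycles,
which agree with it on that set. -/
theorem exists_approx {k : Charge} {B : Set Bond} (hB : OneEnded k.dual B) {Z : Bond → ZMod 2}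
    (hZ : ∀ v, pair Z (inc k v) = 0) (hfin : {b ∈ B | Z b ≠ 0}.Finite) :
    ∃ c : ℕ → Chain, (∀ n, bd k (c n) = 0) ∧ (∀ b, ∀ᶠ n in atTop, c n b = Z b) ∧
      ∀ n, ∀ b ∈ B, c n b = Z b := by
  obtain ⟨f₀, rfl⟩ := exists_potential hZ
  obtain ⟨a, ha⟩ := hB f₀ hfin
  -- The constant `a` does not change the coboundary and makes the potential vanish at infinity
  -- along `B`.
  set f : Site → ZMod 2 := fun v => f₀ v + a with hf
  have hcobd : cobd k.dual f₀ = cobd k.dual f := by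
    ext b
    simp only [cobd, hf]
    linear_combination -CharTwo.add_self_eq_zero a
  have hE : {b ∈ B | ¬ (f b.1 = 0 ∧ f (b.target k.dual) = 0)}.Finite :=
    ha.subset fun b hb => ⟨hb.1, fun h => hb.2 ⟨by simp [hf, h.1, CharTwo.add_self_eq_zero],
      by simp [hf, h.2, CharTwo.add_self_eq_zero]⟩⟩
  have hev : ∀ b : Bond, ∀ᶠ n in atTop, b.1 ∈ box n ∧ b.target k.dual ∈ box n :=
    fun b => (eventually_mem_box _).and (eventually_mem_box _)
  obtain ⟨n₀, hn₀⟩ := eventually_atTop.1 ((Set.Finite.eventually_all hE).2 fun b _ => hev b)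
  have hval : ∀ n b, b.1 ∈ box n → b.target k.dual ∈ box n →
      (∑ v ∈ box n, f v • inc k.dual v) b = cobd k.dual f b := fun n b h1 h2 => by
    rw [sum_inc_apply]
    simp [cobd, h1, h2]
  rw [hcobd]
  -- Truncating the potential to a box gives a finite sum of elementary cycles. Nothing is lost on
  -- `B`: the potential is zero at both ends of all but finitely many of its bonds, and `n₀` puts
  -- the ends of the exceptional ones into the box.
  refine ⟨fun n => ∑ v ∈ box (n₀ + n), f v • inc k.dual v, fun n => ?_, fun b => ?_,
    fun n b hb => ?_⟩
  · simp [map_sum, bd_inc_dual]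
  · have := (tendsto_add_atTop_nat n₀).eventually (hev b)
    filter_upwards [this] with n hn
    rw [add_comm] at hn
    exact hval _ b hn.1 hn.2
  · by_cases hbE : f b.1 = 0 ∧ f (b.target k.dual) = 0
    · rw [sum_inc_apply]
      simp [cobd, hbE]
    · have := hn₀ (n₀ + n) (Nat.le_add_right _ _) b ⟨hb, hbE⟩
      exact hval _ b this.1 this.2

/-! ### Transport chains and linking paths -/

section Transport

variable {k : Charge} (γ η : InfPath k)

theorem InfPath.pair_parity_add_parity {e : Chain}
    (he : bd k e = Finsupp.single (γ.site 0) 1 + Finsupp.single (η.site 0) 1) (v : Site) :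
    pair (γ.parity + η.parity + e) (inc k v) = 0 := by
  rw [pair_add_left, pair_add_left, γ.pair_parity_inc, η.pair_parity_inc, pair_inc, he,
    Finsupp.add_apply]
  exact CharTwo.add_self_eq_zero _

theorem finite_chain_ne_zero (e : Chain) : {b | e b ≠ 0}.Finite :=
  e.support.finite_toSet.subset fun b hb => by simpa using hb

/-- A finite chain `e` joining the starting points closes the two paths to a cycle that equals `e`
on `B`. The finite approximations have exactly this restriction, so adding `e` once more clears `B`
and produces the boundary of a transport. -/
theorem InfPath.exists_closing {B : Set Bond} (hB : OneEnded k.dual B)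
    (hγ : ∀ b ∈ B, γ.parity b = 0) (hη : ∀ b ∈ B, η.parity b = 0) :
    ∃ (e : Chain) (c : ℕ → Chain),
      bd k e = Finsupp.single (γ.site 0) 1 + Finsupp.single (η.site 0) 1 ∧
      (∀ n, bd k (c n) = 0) ∧
      (∀ b, ∀ᶠ n in atTop, c n b = γ.parity b + η.parity b + e b) ∧ ∀ n, ∀ b ∈ B, c n b = e b := by
  obtain ⟨e, he⟩ := exists_chain k (γ.site 0) (η.site 0)
  have hBe : ∀ b ∈ B, (γ.parity + η.parity + e) b = e b := fun b hb => by
    simp [hγ b hb, hη b hb]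
  obtain ⟨c, h1, h2, h3⟩ := exists_approx hB (γ.pair_parity_add_parity η he)
    ((finite_chain_ne_zero e).subset fun b hb => by simpa [hBe b hb.1] using hb.2)
  exact ⟨e, c, he, h1, h2, fun n b hb => (h3 n b hb).trans (hBe b hb)⟩

/-- Chains that transport the charge of one path to another one, avoiding a set with one end. -/
theorem InfPath.exists_transport {B : Set Bond} (hB : OneEnded k.dual B)
    (hγ : ∀ b ∈ B, γ.parity b = 0) (hη : ∀ b ∈ B, η.parity b = 0) :
    ∃ c : ℕ → Chain,
      (∀ n, bd k (c n) = Finsupp.single (γ.site 0) 1 + Finsupp.single (η.site 0) 1) ∧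
      (∀ b, ∀ᶠ n in atTop, c n b = γ.parity b + η.parity b) ∧ ∀ n, ∀ b ∈ B, c n b = 0 := by
  obtain ⟨e, c, he, h1, h2, h3⟩ := γ.exists_closing η hB hγ hη
  refine ⟨fun n => c n + e, fun n => ?_, fun b => ?_, fun n b hb => ?_⟩
  · rw [map_add, h1, zero_add, he]
  · filter_upwards [h2 b] with n hn
    rw [Finsupp.add_apply, hn, add_assoc, CharTwo.add_self_eq_zero, add_zero]
  · rw [Finsupp.add_apply, h3 n b hb, CharTwo.add_self_eq_zero]

/-- Finite paths that link the points of two paths, tend to infinity and avoid a set with one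
end. -/
theorem InfPath.exists_links {B : Set Bond} (hB : OneEnded k.dual B)
    (hγ : γ.LiesIn Bᶜ) (hη : η.LiesIn Bᶜ) :
    ∃ p : ∀ n, FinPath k (γ.site n) (η.site n),
      (∀ F : Set Bond, F.Finite → ∀ᶠ n in atTop, (p n).Avoids F) ∧ ∀ n, (p n).Avoids B := by
  obtain ⟨e, c, he, h1, h2, h3⟩ := γ.exists_closing η hB
    (fun b hb => hγ.parity_eq_zero (by simpa using hb))
    (fun b hb => hη.parity_eq_zero (by simpa using hb))
  -- The chains `c n + e` tend to the sum of the two paths, and the prefixes cancel that sum: what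
  -- is left has its boundary at the `n`-th sites, misses `B` and eventually misses every given
  -- bond.
  set l : ℕ → Chain := fun n => c n + e + γ.prefixChain n + η.prefixChain n with hl
  have hbd : ∀ n, bd k (l n) = Finsupp.single (γ.site n) 1 + Finsupp.single (η.site n) 1 :=
    fun n => by
      simp only [hl, map_add, h1, he, γ.bd_prefixChain, η.bd_prefixChain]
      have := add_self_finsupp (Finsupp.single (γ.site 0) 1 : Site →₀ ZMod 2)
      have h' := add_self_finsupp (Finsupp.single (η.site 0) 1 : Site →₀ ZMod 2)
      have key : ∀ A B C D : Site →₀ ZMod 2, A + A = 0 → B + B = 0 →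
          0 + (A + B) + (A + C) + (B + D) = C + D := fun A B C D hA hB => by
        calc _ = (A + A) + (B + B) + (C + D) := by abel
          _ = _ := by rw [hA, hB, zero_add, zero_add]
      exact key _ _ _ _ this h'
  choose p hp using fun n => exists_finPath (hbd n)
  refine ⟨p, fun F hF => ?_, fun n i hi hb => hp n i hi ?_⟩
  · have : ∀ b, ∀ᶠ n in atTop, l n b = 0 := fun b => by
      filter_upwards [h2 b, γ.eventually_prefixChain b, η.eventually_prefixChain b] with n a1 a2 a3
      simp only [hl, Finsupp.add_apply, a1, a2, a3]
      linear_combination CharTwo.add_self_eq_zero (γ.parity b) +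
        CharTwo.add_self_eq_zero (η.parity b) + CharTwo.add_self_eq_zero (e b)
    filter_upwards [(Set.Finite.eventually_all hF).2 fun b _ => this b] with n hn i hi hb
    exact hp n i hi (hn _ hb)
  · simp only [hl, Finsupp.add_apply, h3 n _ hb, hγ.prefixChain_eq_zero (not_not.2 hb),
      hη.prefixChain_eq_zero (not_not.2 hb), CharTwo.add_self_eq_zero]

/-! ### Signs from potentials -/

/-- The sum of the parities of two paths of dual type is a coboundary up to a finite chain. -/
theorem exists_path_potential (γ₁ δ : InfPath k.dual) :
    ∃ (f : Site → ZMod 2) (e : Chain), cobd k f = γ₁.parity + δ.parity + e := by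
  obtain ⟨e, he⟩ := exists_chain k.dual (γ₁.site 0) (δ.site 0)
  obtain ⟨f, hf⟩ := exists_potential (γ₁.pair_parity_add_parity δ he)
  rw [Charge.dual_dual] at hf
  exact ⟨f, e, hf.symm⟩

/-- Stokes for the potential: the boundary of `c n` gives the two values of `f`, the path `δ`
contributes nothing, and the finite correction `e` sees only the limit `S`. -/
theorem eventually_pair_parity {k₁ k₂ : Charge} {γ₁ : InfPath k₁} {δ : InfPath k₂} {f : Site → ZMod 2} {e : Chain}
    (hf : cobd k f = γ₁.parity + δ.parity + e) {c : ℕ → Chain} {S : Bond → ZMod 2}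
    (hc : ∀ b, ∀ᶠ n in atTop, c n b = S b)
    (hbd : ∀ n, bd k (c n) = Finsupp.single (γ.site 0) 1 + Finsupp.single (η.site 0) 1)
    (hδ : ∀ n b, c n b ≠ 0 → δ.parity b = 0) :
    ∀ᶠ n in atTop, pair γ₁.parity (c n) = f (γ.site 0) + f (η.site 0) + pair S e := by
  filter_upwards [eventually_pair_comm hc e] with n hn
  have := pair_cobd k f (c n)
  rw [hf, pair_add_left, pair_add_left, pair_eq_zero (hδ n), hn, hbd n] at this
  simp only [add_zero, map_add, Finsupp.linearCombination_single, one_smul] at this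
  rw [← this, add_assoc, CharTwo.add_self_eq_zero, add_zero]

/-- Along the path only the correction `e` changes the potential. Together with
`eventually_pair_parity` this trades the values of `f` at the starting points for those at infinity.
-/
theorem InfPath.eventually_potential {f : Site → ZMod 2} {S : Bond → ZMod 2} {e : Chain}
    (hf : cobd k f = S + e) (hS : ∀ n, S (γ.bond n) = 0) :
    ∀ᶠ n in atTop, f (γ.site n) = f (γ.site 0) + pair γ.parity e := by
  filter_upwards [eventually_pair_comm γ.eventually_prefixChain e] with n hn
  have := pair_cobd k f (γ.prefixChain n)
  rw [hf, pair_add_left, hn, γ.bd_prefixChain, pair_eq_zero, zero_add] at this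
  · simp only [map_add, Finsupp.linearCombination_single, one_smul] at this
    rw [this, ← add_assoc, CharTwo.add_self_eq_zero, zero_add]
  · intro b hb
    by_contra h
    exact hb (γ.prefixChain_eq_zero (fun i hi => h (by rw [← hi]; exact hS i)) n)

theorem EndValue.eventually {B : Set Bond} {f : Site → ZMod 2} {a : ZMod 2}
    (h : EndValue k B f a) {γ : InfPath k} (hγ : γ.LiesIn B) :
    ∀ᶠ n in atTop, f (γ.site n) = a := by
  filter_upwards [γ.toInfinity.eventually h.compl_mem_cofinite] with n hn
  by_contra hne
  refine hn ⟨hγ n, fun hb => hne ?_⟩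
  rcases joins_iff.1 (γ.joins n) with h' | h'
  · rw [h'.1, hb.1]
  · rw [h'.1, hb.2]

end Transport

/-! ### String operators of chains -/

theorem spinPauli_commute_same (k : Charge) (b c : Bond) :
    spinPauli k b * spinPauli k c = spinPauli k c * spinPauli k b := by
  rcases eq_or_ne b c with rfl | h
  · rfl
  · exact spinPauli_commute k k h

theorem spinPauli_anticommute {k l : Charge} (h : k ≠ l) (b : Bond) :
    spinPauli k b * spinPauli l b = -(spinPauli l b * spinPauli k b) := by
  ext f S
  cases k <;> cases l
  · exact absurd rfl h
  · have : b ∈ symmDiff S {b} ↔ b ∉ S := by simp [Finset.mem_symmDiff]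
    by_cases hb : b ∈ S <;> simp [spinPauli, monomialOp_apply, flipSpin, this, hb]
  · have : b ∈ symmDiff S {b} ↔ b ∉ S := by simp [Finset.mem_symmDiff]
    by_cases hb : b ∈ S <;> simp [spinPauli, monomialOp_apply, flipSpin, this, hb]
  · exact absurd rfl h

theorem pauli_commute_same (k : Charge) (b c : Bond) :
    pauli k b * pauli k c = pauli k c * pauli k b :=
  Subtype.ext (spinPauli_commute_same k b c)

theorem pauli_anticommute {k l : Charge} (h : k ≠ l) (b : Bond) :
    pauli k b * pauli l b = -(pauli l b * pauli k b) :=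
  Subtype.ext (spinPauli_anticommute h b)

theorem pauli_mem_unitary (k : Charge) (b : Bond) : pauli k b ∈ unitary QuasiLocal := by
  rw [Unitary.mem_iff, star_pauli, pauli_mul_self]
  exact ⟨rfl, rfl⟩

/-- Chains are the free module over `ZMod 2` on the bonds, and Pauli matrices of one type commute
and square to one. The universal property requires a commutative target, hence the subgroup
generated by them. -/
theorem exists_chainOp (k : Charge) : ∃ P : Chain → QuasiLocal, P 0 = 1 ∧
    (∀ c d, P (c + d) = P c * P d) ∧ ∀ b, P (Finsupp.single b 1) = pauli k b := by
  let u : Bond → unitary QuasiLocal := fun b => ⟨pauli k b, pauli_mem_unitary k b⟩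
  have hcomm : IsMulCommutative (Subgroup.closure (Set.range u)) :=
    Subgroup.isMulCommutative_closure <| by
      rintro _ ⟨b, rfl⟩ _ ⟨c, rfl⟩
      exact Subtype.ext (pauli_commute_same k b c)
  let _ : CommGroup (Subgroup.closure (Set.range u)) := { mul_comm := hcomm.is_comm.comm }
  let v : Bond → Subgroup.closure (Set.range u) := fun b => ⟨u b, Subgroup.subset_closure ⟨b, rfl⟩⟩
  have hv : ∀ b, v b * v b = 1 := fun b => Subtype.ext (Subtype.ext (pauli_mul_self k b))
  let φ : Chain →+ Additive (Subgroup.closure (Set.range u)) := Finsupp.liftAddHom fun b =>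
    ZMod.lift 2 ⟨zmultiplesHom _ (Additive.ofMul (v b)), by
      rw [zmultiplesHom_apply]
      change (2 : ℤ) • Additive.ofMul (v b) = 0
      rw [two_smul, ← ofMul_mul, hv, ofMul_one]⟩
  refine ⟨fun c => ((φ c).toMul : unitary QuasiLocal), ?_, fun c d => ?_, fun b => ?_⟩
  · dsimp only
    rw [map_zero]
    rfl
  · dsimp only
    rw [map_add]
    rfl
  · have h1 : (1 : ZMod 2) = ((1 : ℤ) : ZMod 2) := by simp
    have : φ (Finsupp.single b 1) = Additive.ofMul (v b) := by
      rw [Finsupp.liftAddHom_apply_single, h1, ZMod.lift_coe]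
      simp
    dsimp only
    rw [this]
    rfl

/-- The product of the Pauli matrices of type `k` over the bonds of a finite chain. -/
def chainOp (k : Charge) : Chain → QuasiLocal := (exists_chainOp k).choose

@[simp] theorem chainOp_zero (k : Charge) : chainOp k 0 = 1 := (exists_chainOp k).choose_spec.1

theorem chainOp_add (k : Charge) (c d : Chain) : chainOp k (c + d) = chainOp k c * chainOp k d :=
  (exists_chainOp k).choose_spec.2.1 c d

@[simp] theorem chainOp_single (k : Charge) (b : Bond) :
    chainOp k (Finsupp.single b 1) = pauli k b :=
  (exists_chainOp k).choose_spec.2.2 b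

theorem zmod_two_cases (a : ZMod 2) : a = 0 ∨ a = 1 := by
  fin_cases a
  · exact Or.inl rfl
  · exact Or.inr rfl

theorem chain_induction {p : Chain → Prop} (h0 : p 0)
    (h : ∀ b c, c b = 0 → p c → p (Finsupp.single b 1 + c)) (c : Chain) : p c := by
  induction c using Finsupp.induction with
  | zero => exact h0
  | single_add b a c hb ha ih =>
    rcases zmod_two_cases a with rfl | rfl
    · exact absurd rfl ha
    · exact h b c (Finsupp.notMem_support_iff.1 hb) ih

theorem chainOp_comm (k : Charge) (c d : Chain) :
    chainOp k c * chainOp k d = chainOp k d * chainOp k c := by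
  rw [← chainOp_add, add_comm, chainOp_add]

theorem chainOp_mul_self (k : Charge) (c : Chain) : chainOp k c * chainOp k c = 1 := by
  rw [← chainOp_add, add_self_finsupp, chainOp_zero]

theorem star_chainOp (k : Charge) (c : Chain) : star (chainOp k c) = chainOp k c := by
  induction c using chain_induction with
  | h0 => simp
  | h b c _ ih => rw [chainOp_add, star_mul, ih, chainOp_single, star_pauli, ← chainOp_single,
      chainOp_comm]

theorem pauli_mem_observables (k : Charge) {L : Set Bond} {b : Bond} (hb : b ∈ L) :
    pauli k b ∈ observables L :=
  StarSubalgebra.le_topologicalClosure _ (StarAlgebra.subset_adjoin ℂ _ ⟨k, b, hb, rfl⟩)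

theorem observables_mono {L M : Set Bond} (h : L ⊆ M) : observables L ≤ observables M :=
  StarSubalgebra.topologicalClosure_mono (StarAlgebra.adjoin_mono fun _ ⟨k, b, hb, hA⟩ =>
    ⟨k, b, h hb, hA⟩)

theorem chainOp_mem_observables (k : Charge) {L : Set Bond} {c : Chain}
    (hc : ∀ b, c b ≠ 0 → b ∈ L) : chainOp k c ∈ observables L := by
  revert hc
  induction c using chain_induction with
  | h0 => intro _; rw [chainOp_zero]; exact one_mem _
  | h b c hb ih =>
    intro hc
    rw [chainOp_add, chainOp_single]
    refine mul_mem (pauli_mem_observables k (hc b ?_)) (ih fun b' hb' => hc b' ?_)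
    · simp [hb]
    · have : b ≠ b' := fun h => hb' (h ▸ hb)
      simpa [Finsupp.single_apply, this] using hb'

theorem stringOp_eq_chainOp (k : Charge) (bond : ℕ → Bond) (n : ℕ) :
    stringOp k bond n = chainOp k (∑ i ∈ Finset.range n, Finsupp.single (bond i) 1) := by
  induction n with
  | zero => simp [stringOp]
  | succ n ih => rw [stringOp, ih, Finset.sum_range_succ, chainOp_add, chainOp_single]

theorem InfPath.op_eq_chainOp {k : Charge} (γ : InfPath k) (n : ℕ) :
    γ.op n = chainOp k (γ.prefixChain n) :=
  stringOp_eq_chainOp _ _ _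

/-! ### Commutation relations -/

/-- The sign `(-1) ^ a`. -/
def sgn (a : ZMod 2) : ℂ := if a = 0 then 1 else -1

@[simp] theorem sgn_zero : sgn 0 = 1 := by simp [sgn]

@[simp] theorem sgn_one : sgn 1 = -1 := by simp [sgn]

theorem sgn_add (a b : ZMod 2) : sgn (a + b) = sgn a * sgn b := by
  rcases zmod_two_cases a with rfl | rfl <;> rcases zmod_two_cases b with rfl | rfl <;>
    simp [CharTwo.add_self_eq_zero]

theorem sgn_eq_one_or (a : ZMod 2) : sgn a = 1 ∨ sgn a = -1 := by
  rcases zmod_two_cases a with rfl | rfl <;> simp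

/-- The sign that appears when strings of the types `k` and `l` with `a` common bonds are
exchanged. -/
def phase (k l : Charge) (a : ZMod 2) : ℂ := open Classical in if k = l then 1 else sgn a

theorem phase_self (k : Charge) (a : ZMod 2) : phase k k a = 1 := by simp [phase]

theorem phase_of_ne {k l : Charge} (h : k ≠ l) (a : ZMod 2) : phase k l a = sgn a := by
  simp [phase, h]

theorem phase_add (k l : Charge) (a b : ZMod 2) :
    phase k l (a + b) = phase k l a * phase k l b := by
  unfold phase
  split_ifs
  · simp
  · exact sgn_add a b

@[simp] theorem phase_zero (k l : Charge) : phase k l 0 = 1 := by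
  simp [phase]

theorem phase_mul_self (k l : Charge) (a : ZMod 2) : phase k l a * phase k l a = 1 := by
  rw [← phase_add, CharTwo.add_self_eq_zero, phase_zero]

theorem phase_eq_one_or (k l : Charge) (a : ZMod 2) : phase k l a = 1 ∨ phase k l a = -1 := by
  unfold phase
  split_ifs
  · exact Or.inl rfl
  · exact sgn_eq_one_or a

theorem chainOp_mul_pauli (k l : Charge) (c : Chain) (b : Bond) :
    chainOp k c * pauli l b = phase k l (c b) • (pauli l b * chainOp k c) := by
  induction c using chain_induction with
  | h0 => simp
  | h a c _ ih =>
    have h1 : pauli k a * pauli l b =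
        phase k l ((Finsupp.single a 1 : Chain) b) • (pauli l b * pauli k a) := by
      rcases eq_or_ne a b with rfl | hab
      · rcases eq_or_ne k l with rfl | hkl
        · simp [phase_self]
        · simp [phase_of_ne hkl, pauli_anticommute hkl]
      · simp [hab, pauli_commute k l hab]
    rw [chainOp_add, chainOp_single, mul_assoc, ih, mul_smul_comm, ← mul_assoc, h1,
      smul_mul_assoc, smul_smul, Finsupp.add_apply, phase_add, mul_comm (phase _ _ _), mul_assoc]

/-- Each common bond contributes one anticommutation if the types differ. All signs of the theorem
come from this relation. -/
theorem chainOp_mul_chainOp (k l : Charge) (c d : Chain) :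
    chainOp k c * chainOp l d = phase k l (pair c d) • (chainOp l d * chainOp k c) := by
  induction d using chain_induction with
  | h0 => simp
  | h a d _ ih =>
    rw [chainOp_add, chainOp_single, ← mul_assoc, chainOp_mul_pauli, smul_mul_assoc, mul_assoc, ih,
      mul_smul_comm, smul_smul, map_add, phase_add, pair_single, one_mul, mul_assoc]

theorem chainOp_conj_chainOp (k l : Charge) (c d : Chain) :
    chainOp k c * chainOp l d * star (chainOp k c) = phase k l (pair c d) • chainOp l d := by
  rw [chainOp_mul_chainOp, star_chainOp, smul_mul_assoc, mul_assoc, chainOp_mul_self, mul_one]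

theorem InfPath.aut_chainOp {k : Charge} (γ : InfPath k) (l : Charge) (d : Chain) :
    γ.aut (chainOp l d) = phase k l (pair γ.parity d) • chainOp l d := by
  refine tendsto_nhds_unique (γ.tendsto_aut _) (tendsto_const_nhds.congr' ?_)
  filter_upwards [eventually_pair γ.eventually_prefixChain d] with n hn
  rw [γ.op_eq_chainOp, chainOp_conj_chainOp, hn]

theorem InfPath.aut_pauli {k : Charge} (γ : InfPath k) (l : Charge) (b : Bond) :
    γ.aut (pauli l b) = phase k l (γ.parity b) • pauli l b := by
  simpa using γ.aut_chainOp l (Finsupp.single b 1)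

theorem pauli_ne_zero (k : Charge) (b : Bond) : pauli k b ≠ 0 := by
  intro h
  have h1 := pauli_mul_self k b
  rw [h, zero_mul] at h1
  have h2 : (0 : SpinSpace →L[ℂ] SpinSpace) = 1 := congrArg Subtype.val h1
  have h3 := congrFun (congrArg DFunLike.coe h2) (lp.single 2 (∅ : Finset Bond) (1 : ℂ))
  have h4 := congrArg (fun f : SpinSpace => f ∅) h3
  simp at h4

/-! ### Star homomorphisms on localized observables -/

/-- Two star homomorphisms that agree on Pauli matrices agree on localized observables. -/
theorem starAlgHom_eq_of_pauli {B : Type*} [CStarAlgebra B] {φ ψ : QuasiLocal →⋆ₐ[ℂ] B}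
    {L : Set Bond} (h : ∀ k, ∀ b ∈ L, φ (pauli k b) = ψ (pauli k b)) {A : QuasiLocal}
    (hA : A ∈ observables L) : φ A = ψ A := by
  have hcl : IsClosed (StarAlgHom.equalizer φ ψ : Set QuasiLocal) :=
    isClosed_eq (map_continuous φ) (map_continuous ψ)
  refine StarSubalgebra.topologicalClosure_minimal (StarAlgebra.adjoin_le ?_) hcl hA
  rintro _ ⟨k, b, hb, rfl⟩
  exact h k b hb

theorem mem_observables_univ (A : QuasiLocal) : A ∈ observables Set.univ := by
  rw [observables_univ]
  exact StarSubalgebra.mem_top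

theorem InfPath.isLocalized {k : Charge} {γ : InfPath k} {L : Set Bond}
    (h : ∀ b, b ∉ L → γ.parity b = 0) : IsLocalized γ.aut L := fun A hA =>
  starAlgHom_eq_of_pauli (φ := γ.aut) (ψ := StarAlgHom.id ℂ QuasiLocal) (fun l b hb => by
    rw [γ.aut_pauli, h b hb, phase_zero, one_smul]
    rfl) hA

/-- The Pauli matrix of the other type at `b` detects the parity of the path there. This serves for
the cones in `IsBraiding`, which localize the automorphism but need not contain the path. -/
theorem InfPath.parity_eq_zero_of_isLocalized {k : Charge} {γ : InfPath k} {L : Set Bond}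
    (h : IsLocalized γ.aut L) {b : Bond} (hb : b ∉ L) : γ.parity b = 0 := by
  have h1 := h _ (pauli_mem_observables k.dual hb)
  rw [γ.aut_pauli, phase_of_ne k.dual_ne.symm] at h1
  rcases zmod_two_cases (γ.parity b) with h2 | h2
  · exact h2
  · rw [h2, sgn_one, neg_smul, one_smul, neg_eq_iff_add_eq_zero, ← two_smul ℂ] at h1
    simp [pauli_ne_zero] at h1

/-- String automorphisms preserve the algebras of localized observables. -/
theorem InfPath.aut_mem_observables {k : Charge} (γ : InfPath k) {L : Set Bond} {A : QuasiLocal}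
    (hA : A ∈ observables L) : γ.aut A ∈ observables L := by
  have hcl : IsClosed ((observables L).comap γ.aut : Set QuasiLocal) :=
    (StarSubalgebra.isClosed_topologicalClosure _).preimage (map_continuous γ.aut)
  refine StarSubalgebra.topologicalClosure_minimal (StarAlgebra.adjoin_le ?_) hcl hA
  rintro _ ⟨l, b, hb, rfl⟩
  change γ.aut _ ∈ observables L
  rw [γ.aut_pauli]
  exact SMulMemClass.smul_mem _ (pauli_mem_observables l hb)

/-- An element of the algebra generated by Pauli matrices commutes with string operators far
away. -/
theorem exists_finite_commute {A : QuasiLocal}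
    (hA : A ∈ StarAlgebra.adjoin ℂ {A | ∃ k, ∃ b ∈ (Set.univ : Set Bond), A = pauli k b}) :
    ∃ F : Set Bond, F.Finite ∧ ∀ k c, (∀ b ∈ F, c b = 0) →
      chainOp k c * A = A * chainOp k c := by
  induction hA using StarAlgebra.adjoin_induction with
  | mem A hA =>
    obtain ⟨l, b, -, rfl⟩ := hA
    refine ⟨{b}, Set.finite_singleton b, fun k c hc => ?_⟩
    rw [chainOp_mul_pauli, hc b rfl, phase_zero, one_smul]
  | algebraMap r => exact ⟨∅, Set.finite_empty, fun k c _ => (Algebra.commutes r _).symm⟩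
  | add A B _ _ hA hB =>
    obtain ⟨F, hF, h1⟩ := hA
    obtain ⟨G, hG, h2⟩ := hB
    refine ⟨F ∪ G, hF.union hG, fun k c hc => ?_⟩
    rw [mul_add, add_mul, h1 k c fun b hb => hc b (Or.inl hb), h2 k c fun b hb => hc b (Or.inr hb)]
  | mul A B _ _ hA hB =>
    obtain ⟨F, hF, h1⟩ := hA
    obtain ⟨G, hG, h2⟩ := hB
    refine ⟨F ∪ G, hF.union hG, fun k c hc => ?_⟩
    rw [← mul_assoc, h1 k c fun b hb => hc b (Or.inl hb), mul_assoc,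
      h2 k c fun b hb => hc b (Or.inr hb), mul_assoc]
  | star A _ hA =>
    obtain ⟨F, hF, h1⟩ := hA
    refine ⟨F, hF, fun k c hc => ?_⟩
    have := congrArg star (h1 k c hc)
    rw [star_mul, star_mul, star_chainOp] at this
    exact this.symm

/-! ### The ground state -/

section GNS

variable {ω : QuasiLocal →ₚ[ℂ] ℂ}

variable (ω) in
/-- The cyclic vector of the GNS representation. -/
def vacuum : ω.GNS := ((ω.toPreGNS 1 : ω.PreGNS) : ω.GNS)

theorem gnsRep_vacuum (A : QuasiLocal) :
    gnsRep ω A (vacuum ω) = ((ω.toPreGNS A : ω.PreGNS) : ω.GNS) := by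
  simp [gnsRep, vacuum]

/-- For such `U` and the cyclic vector `Ω`, `‖(U - 1)Ω‖²` equals `ω((U - 1)²) = 2 - 2 ω(U)`, which
is zero. -/
theorem gnsRep_vacuum_eq_of_map_eq_one {U : QuasiLocal} (hU : star U = U) (hU' : U * U = 1)
    (h1 : ω 1 = 1) (h : ω U = 1) : gnsRep ω U (vacuum ω) = vacuum ω := by
  rw [← sub_eq_zero, gnsRep_vacuum, vacuum, ← UniformSpace.Completion.coe_sub, ← map_sub,
    ← norm_eq_zero, UniformSpace.Completion.norm_coe, ← sq_eq_zero_iff]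
  have := ω.preGNS_norm_sq (ω.toPreGNS (U - 1))
  rw [PositiveLinearMap.ofPreGNS_toPreGNS, star_sub, hU, star_one] at this
  have h2 : (U - 1) * (U - 1) = 1 - U - (U - 1) := by
    rw [sub_mul, mul_sub, hU', mul_one, one_mul]
  have h3 : ω (1 - U - (U - 1)) = 0 := by rw [map_sub, map_sub, map_sub, h, h1, sub_self]
  rw [h2, h3] at this
  exact_mod_cast this

theorem starOp_eq_chainOp (v : Site) : starOp v = chainOp .X (inc .Z v) := by
  simp only [starOp, inc, chainOp_add, chainOp_single]

theorem plaqOp_eq_chainOp (v : Site) : plaqOp v = chainOp .Z (inc .X v) := by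
  simp only [plaqOp, inc, chainOp_add, chainOp_single]

/-- Closed strings act trivially on the ground state vector. -/
theorem IsGroundState.chainOp_vacuum (hω : IsGroundState ω) {k : Charge} {c : Chain}
    (hc : bd k c = 0) : gnsRep ω (chainOp k c) (vacuum ω) = vacuum ω := by
  have h := mem_span_of_bd_eq_zero hc
  clear hc
  induction h using Submodule.span_induction with
  | mem x hx =>
    obtain ⟨v, rfl⟩ := hx
    refine gnsRep_vacuum_eq_of_map_eq_one (star_chainOp _ _) (chainOp_mul_self _ _) hω.map_one ?_
    cases k
    · rw [← hω.map_starOp v, starOp_eq_chainOp]; rfl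
    · rw [← hω.map_plaqOp v, plaqOp_eq_chainOp]; rfl
  | zero => simp
  | add x y _ _ hx hy => rw [chainOp_add, map_mul, mul_apply_eq_comp, hy, hx]
  | smul a x _ hx => rcases zmod_two_cases a with rfl | rfl <;> simp [hx]

/-- The vectors given by observables generated by Pauli matrices are dense. -/
theorem dense_local_vectors :
    Dense ((fun A => gnsRep ω A (vacuum ω)) ''
      (StarAlgebra.adjoin ℂ {A | ∃ k, ∃ b ∈ (Set.univ : Set Bond), A = pauli k b} :
        Set QuasiLocal)) := by
  refine DenseRange.dense_image (f := fun A => gnsRep ω A (vacuum ω)) ?_ ?_ ?_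
  · have : (fun A => gnsRep ω A (vacuum ω)) =
        (fun x : ω.PreGNS => (x : ω.GNS)) ∘ ω.toPreGNS := funext gnsRep_vacuum
    rw [this]
    exact (UniformSpace.Completion.denseRange_coe).comp ω.toPreGNS.surjective.denseRange
      (UniformSpace.Completion.continuous_coe _)
  · exact (ContinuousLinearMap.apply ℂ ω.GNS (vacuum ω)).continuous.comp (map_continuous (gnsRep ω))
  · intro A
    exact mem_observables_univ A

theorem norm_gnsRep_chainOp (k : Charge) (c : Chain) (ψ : ω.GNS) :
    ‖gnsRep ω (chainOp k c) ψ‖ = ‖ψ‖ := by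
  refine (ContinuousLinearMap.norm_map_iff_adjoint_comp_self _).2 ?_ ψ
  change star (gnsRep ω (chainOp k c)) * gnsRep ω (chainOp k c) = 1
  rw [← map_star, star_chainOp, ← map_mul, chainOp_mul_self, map_one]

/-- The string operators of chains with a fixed boundary converge strongly if the chains converge
pointwise. -/
theorem IsGroundState.exists_tendsto_chainOp (hω : IsGroundState ω) {k : Charge} {c : ℕ → Chain}
    {S : Bond → ZMod 2} (hc : ∀ b, ∀ᶠ n in atTop, c n b = S b)
    (hbd : ∀ n, bd k (c n) = bd k (c 0)) (ψ : ω.GNS) :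
    ∃ φ, Tendsto (fun n => gnsRep ω (chainOp k (c n)) ψ) atTop (𝓝 φ) := by
  refine cauchySeq_tendsto_of_complete (Metric.cauchySeq_iff'.2 fun ε hε => ?_)
  obtain ⟨_, ⟨A, hA, rfl⟩, hψ⟩ := Metric.mem_closure_iff.1 (dense_local_vectors (ω := ω) ψ)
    (ε / 2) (half_pos hε)
  obtain ⟨F, hF, hcomm⟩ := exists_finite_commute hA
  obtain ⟨N, hN⟩ := eventually_atTop.1 ((Set.Finite.eventually_all hF).2 fun b _ => hc b)
  have hconst : ∀ n ≥ N, gnsRep ω (chainOp k (c n)) (gnsRep ω A (vacuum ω)) =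
      gnsRep ω (chainOp k (c N)) (gnsRep ω A (vacuum ω)) := fun n hn => by
    -- The bracket is a cycle that vanishes on `F`: its string operator passes through `A` and is
    -- absorbed by the vacuum.
    have h1 : c n = c N + (c N + c n) := by rw [← add_assoc, add_self_finsupp, zero_add]
    have h2 : chainOp k (c N + c n) * A = A * chainOp k (c N + c n) := hcomm _ _ fun b hb => by
      rw [Finsupp.add_apply, hN n hn b hb, hN N le_rfl b hb, CharTwo.add_self_eq_zero]
    conv_lhs => rw [h1, chainOp_add, map_mul, mul_apply_eq_comp,
      ← mul_apply_eq_comp (gnsRep ω (chainOp k (c N + c n))), ← map_mul, h2, map_mul,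
      mul_apply_eq_comp, hω.chainOp_vacuum (by
        rw [map_add, hbd n, hbd N, add_self_finsupp])]
  refine ⟨N, fun n hn => ?_⟩
  have hd : ∀ n, dist (gnsRep ω (chainOp k (c n)) ψ)
      (gnsRep ω (chainOp k (c n)) (gnsRep ω A (vacuum ω))) < ε / 2 := fun n => by
    rw [dist_eq_norm, ← map_sub, norm_gnsRep_chainOp, ← dist_eq_norm]
    exact hψ
  have h1 := hd n
  have h2 := hd N
  rw [hconst n hn] at h1
  rw [dist_comm] at h2
  exact (dist_triangle _ _ _).trans_lt (by linarith)

/-- The charge transporter of a sequence of chains with a fixed boundary. -/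
theorem IsGroundState.exists_transporter (hω : IsGroundState ω) {k : Charge} {c : ℕ → Chain}
    {S : Bond → ZMod 2} (hc : ∀ b, ∀ᶠ n in atTop, c n b = S b)
    (hbd : ∀ n, bd k (c n) = bd k (c 0)) :
    ∃ W : Op ω, star W = W ∧ W * W = 1 ∧
      ∀ ψ, Tendsto (fun n => gnsRep ω (chainOp k (c n)) ψ) atTop (𝓝 (W ψ)) := by
  choose φ hφ using hω.exists_tendsto_chainOp hc hbd
  let W : Op ω := continuousLinearMapOfTendsto (fun n => gnsRep ω (chainOp k (c n)))
    (tendsto_pi_nhds.2 hφ)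
  have hW : ∀ ψ, Tendsto (fun n => gnsRep ω (chainOp k (c n)) ψ) atTop (𝓝 (W ψ)) := hφ
  have hstar : star W = W := by
    refine ((ContinuousLinearMap.eq_adjoint_iff W W).2 fun x y => ?_).symm
    refine tendsto_nhds_unique ((hW x).inner tendsto_const_nhds)
      ((tendsto_const_nhds.inner (hW y)).congr fun n => ?_)
    rw [← ContinuousLinearMap.adjoint_inner_left, ← ContinuousLinearMap.star_eq_adjoint,
      ← map_star, star_chainOp]
  refine ⟨W, hstar, ?_, hW⟩
  -- Strong limits of unitaries are isometric, and a self-adjoint isometry has square one.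
  have hn : ∀ ψ, ‖W ψ‖ = ‖ψ‖ := fun ψ => by
    refine tendsto_nhds_unique (hW ψ).norm ?_
    simp only [norm_gnsRep_chainOp, tendsto_const_nhds]
  have h1 : star W * W = 1 := (ContinuousLinearMap.norm_map_iff_adjoint_comp_self _).1 hn
  rwa [hstar] at h1

theorem tendsto_wot {T : ℕ → Op ω} {W : Op ω}
    (h : ∀ ψ, Tendsto (fun n => T n ψ) atTop (𝓝 (W ψ))) :
    Tendsto (fun n => ContinuousLinearMapWOT.ofCLM (T n)) atTop
      (𝓝 (ContinuousLinearMapWOT.ofCLM W)) := by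
  rw [ContinuousLinearMapWOT.tendsto_iff_forall_dual_apply_tendsto]
  exact fun ψ y => (y.continuous.tendsto _).comp (h ψ)

/-- The relation `T A = B T` passes to strong limits. -/
theorem mul_eq_mul_of_tendsto {T : ℕ → Op ω} {W A B : Op ω}
    (h : ∀ ψ, Tendsto (fun n => T n ψ) atTop (𝓝 (W ψ))) (hAB : ∀ᶠ n in atTop, T n * A = B * T n) :
    W * A = B * W := by
  ext ψ
  refine tendsto_nhds_unique (h (A ψ)) (((B.continuous.tendsto _).comp (h ψ)).congr' ?_)
  filter_upwards [hAB] with n hn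
  exact (congrArg (fun X : Op ω => X ψ) hn).symm

/-- Conjugation with a self-adjoint unitary. -/
def conjHom (W : Op ω) (h1 : star W = W) (h2 : W * W = 1) : Op ω →⋆ₐ[ℂ] Op ω where
  toFun T := W * T * W
  map_one' := by rw [mul_one, h2]
  map_mul' S T := by
    calc W * (S * T) * W = W * S * 1 * T * W := by simp only [mul_one, mul_assoc]
      _ = _ := by rw [← h2]; simp only [mul_assoc]
  map_zero' := by simp
  map_add' S T := by rw [mul_add, add_mul]
  commutes' r := by rw [← Algebra.commutes, mul_assoc, h2, mul_one]
  map_star' T := by rw [star_mul, star_mul, h1, mul_assoc]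

/-- A transporter intertwines the string automorphisms. -/
theorem transporter_intertwines {k : Charge} {c : ℕ → Chain} {γ η : InfPath k}
    (hc : ∀ b, ∀ᶠ n in atTop, c n b = γ.parity b + η.parity b) {W : Op ω} (h1 : star W = W)
    (h2 : W * W = 1) (hW : ∀ ψ, Tendsto (fun n => gnsRep ω (chainOp k (c n)) ψ) atTop (𝓝 (W ψ)))
    (A : QuasiLocal) : W * gnsRep ω (γ.aut A) * W = gnsRep ω (η.aut A) := by
  refine starAlgHom_eq_of_pauli (φ := ((conjHom W h1 h2).comp (gnsRep ω)).comp γ.aut)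
    (ψ := (gnsRep ω).comp η.aut) (fun l b _ => ?_) (mem_observables_univ A)
  change W * gnsRep ω (γ.aut (pauli l b)) * W = gnsRep ω (η.aut (pauli l b))
  -- At `b` the chains eventually agree with the sum of the two paths, so the exchange sign is the
  -- product of the signs of the two automorphisms.
  have h3 : W * gnsRep ω (pauli l b) =
      (phase k l (γ.parity b + η.parity b) • gnsRep ω (pauli l b)) * W := by
    refine mul_eq_mul_of_tendsto hW ?_
    filter_upwards [hc b] with n hn
    rw [← map_mul, chainOp_mul_pauli, map_smul, map_mul, hn, smul_mul_assoc]
  rw [γ.aut_pauli, η.aut_pauli, map_smul, map_smul, mul_smul_comm, h3, smul_mul_assoc,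
    smul_mul_assoc, smul_mul_assoc, mul_assoc, h2, mul_one, smul_smul, phase_add, ← mul_assoc, phase_mul_self,
    one_mul]

/-! ### Localized von Neumann algebras -/

theorem gnsRep_mem_vonNeumann {L : Set Bond} {A : QuasiLocal} (hA : A ∈ observables L) :
    gnsRep ω A ∈ vonNeumann ω L := by
  rw [vonNeumann, StarSubalgebra.mem_centralizer_iff]
  intro C hC
  have hC' := StarSubalgebra.mem_centralizer_iff ℂ |>.1 hC
  have h1 := hC' _ ⟨A, hA, rfl⟩
  refine ⟨h1.1.symm, ?_⟩
  have h2 := congrArg star h1.2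
  simp only [star_mul, star_star] at h2
  exact h2

/-- Membership in the commutant. -/
theorem mem_commutant_iff {L : Set Bond} {C : Op ω} :
    C ∈ StarSubalgebra.centralizer ℂ (gnsRep ω '' observables L : Set (Op ω)) ↔
      ∀ A ∈ observables L, gnsRep ω A * C = C * gnsRep ω A := by
  rw [StarSubalgebra.mem_centralizer_iff]
  constructor
  · exact fun h A hA => (h _ ⟨A, hA, rfl⟩).1
  · rintro h _ ⟨A, hA, rfl⟩
    refine ⟨h A hA, ?_⟩
    rw [← map_star]
    exact h _ (star_mem hA)

theorem mem_vonNeumann_iff {L : Set Bond} {T : Op ω} :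
    T ∈ vonNeumann ω L ↔ ∀ C : Op ω,
      (∀ A ∈ observables L, gnsRep ω A * C = C * gnsRep ω A) → C * T = T * C := by
  rw [vonNeumann, StarSubalgebra.mem_centralizer_iff]
  constructor
  · exact fun h C hC => (h C (mem_commutant_iff.2 hC)).1
  · intro h C hC
    exact ⟨h C (mem_commutant_iff.1 hC), h _ (mem_commutant_iff.1 (star_mem hC))⟩

theorem vonNeumann_mono {L M : Set Bond} (h : L ⊆ M) : vonNeumann ω L ≤ vonNeumann ω M :=
  fun _ hT => mem_vonNeumann_iff.2 fun C hC =>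
    mem_vonNeumann_iff.1 hT C fun A hA => hC A (observables_mono h hA)

/-- Strong limits of localized observables belong to the von Neumann algebra. -/
theorem mem_vonNeumann_of_tendsto {L : Set Bond} {A : ℕ → QuasiLocal} {W : Op ω}
    (h : ∀ ψ, Tendsto (fun n => gnsRep ω (A n) ψ) atTop (𝓝 (W ψ))) (hA : ∀ n, A n ∈ observables L) :
    W ∈ vonNeumann ω L :=
  mem_vonNeumann_iff.2 fun _ hC =>
    (mul_eq_mul_of_tendsto h (Eventually.of_forall fun n => hC _ (hA n))).symm

end GNS

/-! ### The double commutant theorem -/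

section DoubleCommutant

variable {H : Type*} [NormedAddCommGroup H] [InnerProductSpace ℂ H]

/-- The diagonal action of an operator on a finite power of the Hilbert space. -/
def diagOp {n : ℕ} (T : H →L[ℂ] H) :
    PiLp 2 (fun _ : Fin n => H) →L[ℂ] PiLp 2 (fun _ : Fin n => H) :=
  ((PiLp.continuousLinearEquiv 2 ℂ (fun _ : Fin n => H)).symm : _ →L[ℂ] _) ∘L
    (ContinuousLinearMap.pi fun i : Fin n => T ∘L PiLp.proj 2 (fun _ => H) i)

@[simp] theorem diagOp_apply {n : ℕ} (T : H →L[ℂ] H) (x : PiLp 2 (fun _ : Fin n => H)) (i : Fin n) :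
    diagOp T x i = T (x i) := rfl

variable [CompleteSpace H]

/-- An operator in the double commutant of a star algebra is a strong limit of its elements. -/
theorem exists_approx_of_commutant (A : StarSubalgebra ℂ (H →L[ℂ] H)) {T : H →L[ℂ] H}
    (hT : ∀ C : H →L[ℂ] H, (∀ a ∈ A, a * C = C * a) → C * T = T * C) {n : ℕ} (ξ : Fin n → H)
    {ε : ℝ} (hε : 0 < ε) : ∃ a ∈ A, ∀ i, ‖T (ξ i) - a (ξ i)‖ < ε := by
  let x : PiLp 2 (fun _ : Fin n => H) := WithLp.toLp 2 ξ
  let φ : (H →L[ℂ] H) →ₗ[ℂ] PiLp 2 (fun _ : Fin n => H) :=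
    { toFun := fun a => diagOp a x
      map_add' := fun a b => by ext i; simp
      map_smul' := fun r a => by ext i; simp }
  let K₀ : Submodule ℂ (PiLp 2 (fun _ : Fin n => H)) := A.toSubalgebra.toSubmodule.map φ
  let K := K₀.topologicalClosure
  have hK : IsClosed (K : Set (PiLp 2 (fun _ : Fin n => H))) := K₀.isClosed_topologicalClosure
  have : CompleteSpace K := hK.completeSpace_coe
  -- The projection onto the closed orbit of `x` commutes with the diagonal action of `A`, so its
  -- matrix entries lie in the commutant of `A` and therefore commute with `T`.
  let P := K.starProjection
  have hdiag : ∀ a ∈ A, ∀ y ∈ K, diagOp a y ∈ K := by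
    intro a ha y hy
    have hmaps : Set.MapsTo (diagOp a) (K₀ : Set (PiLp 2 (fun _ : Fin n => H))) K₀ := by
      rintro _ ⟨b, hb, rfl⟩
      exact ⟨a * b, mul_mem (S := StarSubalgebra ℂ (H →L[ℂ] H)) ha hb, by ext i; simp [φ]⟩
    exact hmaps.closure (diagOp a).continuous hy
  have hadj : ∀ (a : H →L[ℂ] H) (y z : PiLp 2 (fun _ : Fin n => H)),
      inner ℂ (diagOp a y) z = inner ℂ y (diagOp (star a) z) := fun a y z => by
    simp only [PiLp.inner_apply, diagOp_apply]
    exact Finset.sum_congr rfl fun i _ => (ContinuousLinearMap.adjoint_inner_right a _ _).symm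
  have hdiag' : ∀ a ∈ A, ∀ y ∈ Kᗮ, diagOp a y ∈ Kᗮ := by
    intro a ha y hy
    rw [Submodule.mem_orthogonal'] at hy ⊢
    intro z hz
    rw [hadj]
    exact hy _ (hdiag _ (star_mem ha) z hz)
  have hP : ∀ a ∈ A, ∀ y, P (diagOp a y) = diagOp a (P y) := by
    intro a ha y
    have h1 : diagOp a y = diagOp a (P y) + diagOp a (y - P y) := by rw [← map_add]; simp
    have h2 : P (diagOp a (P y)) = diagOp a (P y) :=
      Submodule.starProjection_eq_self_iff.2 (hdiag a ha _ (K.starProjection_apply_mem y))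
    have h3 : P (diagOp a (y - P y)) = 0 :=
      (K.starProjection_apply_eq_zero_iff).2
        (hdiag' a ha _ (K.sub_starProjection_mem_orthogonal y))
    rw [h1, map_add, h2, h3, add_zero]
  let ι : Fin n → H →L[ℂ] PiLp 2 (fun _ : Fin n => H) := fun j =>
    ((PiLp.continuousLinearEquiv 2 ℂ (fun _ : Fin n => H)).symm : _ →L[ℂ] _) ∘L
      ContinuousLinearMap.single ℂ (fun _ : Fin n => H) j
  let pr : Fin n → PiLp 2 (fun _ : Fin n => H) →L[ℂ] H := fun i => PiLp.proj 2 (fun _ => H) i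
  have hι : ∀ (a : H →L[ℂ] H) j v, diagOp a (ι j v) = ι j (a v) := by
    intro a j v
    ext i
    rcases eq_or_ne i j with rfl | hij
    · simp [ι]
    · simp [ι, hij]
  have hsum : ∀ y, y = ∑ j, ι j (y j) := by
    intro y
    ext i
    simp only [ι, ContinuousLinearMap.comp_apply, WithLp.ofLp_sum, Finset.sum_apply]
    rw [Finset.sum_eq_single i] <;> simp +contextual [eq_comm]
  have hTP : ∀ y, P (diagOp T y) = diagOp T (P y) := by
    intro y
    have hentry : ∀ i j v, (P (ι j (T v))) i = T (P (ι j v) i) := by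
      intro i j v
      have := hT (pr i ∘L P ∘L ι j) fun a ha => by
        ext v
        change a (P (ι j v) i) = P (ι j (a v)) i
        rw [← hι, hP a ha]
        rfl
      exact congrArg (fun X : H →L[ℂ] H => X v) this
    ext i
    rw [hsum y]
    simp only [map_sum, hι, WithLp.ofLp_sum, Finset.sum_apply, hentry, diagOp_apply]
  -- `A` is unital, so `x` lies in its own orbit, and commuting with the projection keeps the image
  -- of `x` under `T` in the closure.
  have hx : x ∈ K := K₀.le_topologicalClosure ⟨1, one_mem A, by ext i; simp [φ]⟩
  have hTx : diagOp T x ∈ K := by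
    rw [← Submodule.starProjection_eq_self_iff]
    change P _ = _
    rw [hTP]
    congr 1
    exact Submodule.starProjection_eq_self_iff.2 hx
  obtain ⟨_, ⟨a, ha, rfl⟩, hax⟩ := Metric.mem_closure_iff.1 hTx ε hε
  refine ⟨a, ha, fun i => ?_⟩
  rw [dist_eq_norm] at hax
  exact (PiLp.norm_apply_le (diagOp T x - φ a) i).trans_lt hax

end DoubleCommutant

section AuxExtension

variable {ω : QuasiLocal →ₚ[ℂ] ℂ}

/-! ### Extensions to the auxiliary algebra -/

instance (La : Cone) : IsClosed (auxAlgebra ω La : Set (Op ω)) :=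
  StarSubalgebra.isClosed_topologicalClosure _

/-- The localized observables are weakly dense in the von Neumann algebra. -/
theorem dense_gnsRep (L : Set Bond) :
    Dense {T : {T : ω.GNS →WOT[ℂ] ω.GNS // T.toCLM ∈ vonNeumann ω L} |
      ∃ A ∈ observables L, T.1.toCLM = gnsRep ω A} := by
  intro T
  have hb := (ContinuousLinearMapWOT.withSeminorms (σ := RingHom.id ℂ) (E := ω.GNS)
    (F := ω.GNS)).hasBasis_ball (x := T.1)
  rw [closure_subtype, mem_closure_iff_nhds_basis hb]
  rintro ⟨s, r⟩ hr
  simp only at hr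
  obtain ⟨e⟩ : Nonempty (s ≃ Fin s.card) := ⟨s.equivFin⟩
  -- A common bound for the functionals in the seminorm; the summand `1` makes it positive in any
  -- case.
  set C : ℝ := ∑ p ∈ s, ‖p.2‖ + 1 with hC
  have hC0 : 0 < C := by positivity
  obtain ⟨a, ⟨A, hA, rfl⟩, ha⟩ := exists_approx_of_commutant ((observables L).map (gnsRep ω))
    (T := T.1.toCLM) (fun D hD => mem_vonNeumann_iff.1 T.2 D fun A hA => hD _ ⟨A, hA, rfl⟩)
    (fun i => (e.symm i).1.1) (div_pos hr hC0)
  refine ⟨ContinuousLinearMapWOT.ofCLM (gnsRep ω A),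
    ⟨⟨_, gnsRep_mem_vonNeumann hA⟩, ⟨A, hA, rfl⟩, rfl⟩, ?_⟩
  rw [Seminorm.mem_ball]
  refine Seminorm.finset_sup_apply_lt hr fun p hp => ?_
  change ‖p.2 ((ContinuousLinearMapWOT.ofCLM (gnsRep ω A) - T.1) p.1)‖ < r
  have h1 := ha (e ⟨p, hp⟩)
  simp only [Equiv.symm_apply_apply] at h1
  rw [← norm_neg, ← map_neg, ContinuousLinearMapWOT.sub_apply, neg_sub]
  have h2 : ‖p.2‖ ≤ C := by
    have := Finset.single_le_sum (f := fun p : ω.GNS × _ => ‖p.2‖) (fun _ _ => norm_nonneg _) hp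
    linarith
  calc _ ≤ ‖p.2‖ * ‖T.1 p.1 - gnsRep ω A p.1‖ := p.2.le_opNorm _
    _ ≤ C * ‖T.1 p.1 - gnsRep ω A p.1‖ := by gcongr
    _ < C * (r / C) := by gcongr; exact h1
    _ = r := by field_simp

/-- The self-adjoint unitary `W` implements the endomorphism `ρ` on the observables localized in
`L`. -/
structure Implements (W : Op ω) (ρ : QuasiLocal →⋆ₐ[ℂ] QuasiLocal) (L : Set Bond) : Prop where
  star_eq : star W = W
  mul_self : W * W = 1
  conj : ∀ A ∈ observables L, W * gnsRep ω (ρ A) * W = gnsRep ω A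

theorem Implements.conj' {W : Op ω} {ρ : QuasiLocal →⋆ₐ[ℂ] QuasiLocal} {L : Set Bond}
    (h : Implements W ρ L) {A : QuasiLocal} (hA : A ∈ observables L) :
    W * gnsRep ω A * W = gnsRep ω (ρ A) := by
  rw [← h.conj A hA]
  calc _ = (W * W) * gnsRep ω (ρ A) * (W * W) := by simp only [mul_assoc]
    _ = _ := by rw [h.mul_self, one_mul, mul_one]

theorem Implements.mul_gnsRep {W : Op ω} {ρ : QuasiLocal →⋆ₐ[ℂ] QuasiLocal} {L : Set Bond}
    (h : Implements W ρ L) {A : QuasiLocal} (hA : A ∈ observables L) :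
    W * gnsRep ω A = gnsRep ω (ρ A) * W := by
  rw [← h.conj' hA, mul_assoc _ W W, h.mul_self, mul_one]

theorem Implements.gnsRep_mul {W : Op ω} {ρ : QuasiLocal →⋆ₐ[ℂ] QuasiLocal} {L : Set Bond}
    (h : Implements W ρ L) {A : QuasiLocal} (hA : A ∈ observables L) :
    W * gnsRep ω (ρ A) = gnsRep ω A * W := by
  rw [← h.conj A hA, mul_assoc _ W W, h.mul_self, mul_one]

/-- Conjugation with `W` is determined on the von Neumann algebra. -/
theorem Implements.conj_eq {W W' : Op ω} {ρ : QuasiLocal →⋆ₐ[ℂ] QuasiLocal} {L : Set Bond}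
    (h : Implements W ρ L) (h' : Implements W' ρ L) {T : Op ω} (hT : T ∈ vonNeumann ω L) :
    W * T * W = W' * T * W' := by
  -- Two unitaries implementing the same endomorphism differ by an element of the commutant.
  have := mem_vonNeumann_iff.1 hT (W * W') fun A hA => by
    rw [← mul_assoc, ← h.gnsRep_mul hA, mul_assoc, ← h'.mul_gnsRep hA, mul_assoc]
  calc W * T * W = W * (T * (W * W')) * W' := by
        rw [mul_assoc, mul_assoc W, mul_assoc T, mul_assoc W, h'.mul_self, mul_one]
    _ = (W * W) * W' * T * W' := by rw [← this]; simp only [mul_assoc]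
    _ = _ := by rw [h.mul_self, one_mul]

/-- If `C` commutes with the observables of `L`, so does `W * C * W`, because `ρ` preserves these
observables; the conjugation can thus be moved from `T` to the commutant. -/
theorem Implements.conj_mem {W : Op ω} {ρ : QuasiLocal →⋆ₐ[ℂ] QuasiLocal} {L : Set Bond}
    (h : Implements W ρ L) (hρ : ∀ A ∈ observables L, ρ A ∈ observables L) {T : Op ω}
    (hT : T ∈ vonNeumann ω L) : W * T * W ∈ vonNeumann ω L := by
  rw [mem_vonNeumann_iff]
  intro C hC
  have := mem_vonNeumann_iff.1 hT (W * C * W) fun A hA => by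
    rw [← mul_assoc, ← mul_assoc, ← h.gnsRep_mul hA, mul_assoc W, hC _ (hρ A hA), mul_assoc,
      mul_assoc, ← h.mul_gnsRep hA]
    simp only [mul_assoc]
  calc C * (W * T * W) = (W * W) * C * W * T * W := by
        rw [h.mul_self, one_mul]; simp only [mul_assoc]
    _ = W * (W * C * W * T) * W := by simp only [mul_assoc]
    _ = W * T * W * C * (W * W) := by rw [this]; simp only [mul_assoc]
    _ = _ := by rw [h.mul_self, mul_one]

theorem Implements.mono {W : Op ω} {ρ : QuasiLocal →⋆ₐ[ℂ] QuasiLocal} {L L' : Set Bond}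
    (h : Implements W ρ L) (hL : L' ⊆ L) : Implements W ρ L' :=
  ⟨h.star_eq, h.mul_self, fun A hA => h.conj A (observables_mono hL hA)⟩

theorem continuous_conj (W : Op ω) : Continuous fun T : ω.GNS →WOT[ℂ] ω.GNS =>
    ContinuousLinearMapWOT.ofCLM (W * T.toCLM * W) := by
  refine ContinuousLinearMapWOT.continuous_of_dual_apply_continuous fun x y => ?_
  exact ContinuousLinearMapWOT.continuous_dual_apply (W x) (y ∘L W)

/-- An extension of an endomorphism to the auxiliary algebra is given by conjugation with an
implementing unitary. -/
theorem IsAuxExtension.eq_conj {La : Cone} {ρ : QuasiLocal →⋆ₐ[ℂ] QuasiLocal}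
    {ρ' : auxAlgebra ω La →⋆ₐ[ℂ] auxAlgebra ω La} (h : IsAuxExtension ω La ρ ρ') {x : Site}
    {W : Op ω} (hW : Implements W ρ ((La.translate x).bonds)ᶜ) {T : auxAlgebra ω La}
    (hT : (T : Op ω) ∈ vonNeumann ω ((La.translate x).bonds)ᶜ) :
    (ρ' T : Op ω) = W * T * W := by
  have h1 := (h.weakly_continuous x).ext_on (dense_gnsRep _)
    ((continuous_conj W).comp continuous_subtype_val) (by
      rintro T ⟨A, hA, hT⟩
      have := h.extends_rep A ⟨T.1.toCLM, vonNeumann_le_auxAlgebra ω La x T.2⟩ hT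
      simp only [Function.comp_apply]
      rw [this, hT, hW.conj' hA])
  exact congrArg ContinuousLinearMapWOT.toCLM
    (congrFun h1 ⟨ContinuousLinearMapWOT.ofCLM (T : Op ω), hT⟩)

/-- The translates of a cone by the members of the sequence `x` decrease, are cofinal among all
translates, and leave every bond. -/
structure Exhausts (La : Cone) (x : ℕ → Site) : Prop where
  antitone : Antitone fun j => (La.translate (x j)).bonds
  cofinal : ∀ y, ∃ j, (La.translate (x j)).bonds ⊆ (La.translate y).bonds
  leaves : ∀ b, ∃ j, b ∉ (La.translate (x j)).bonds

/-- Along an exhausting sequence the algebras are directed, so their supremum is a plain union,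
whose closure is the auxiliary algebra. -/
theorem Exhausts.exists_near {La : Cone} {x : ℕ → Site} (hx : Exhausts La x) {T : Op ω}
    (hT : T ∈ auxAlgebra ω La) {ε : ℝ} (hε : 0 < ε) :
    ∃ i, ∃ S ∈ vonNeumann ω ((La.translate (x i)).bonds)ᶜ, ‖T - S‖ < ε := by
  obtain ⟨S, hS, hd⟩ := Metric.mem_closure_iff.1 hT ε hε
  have hle : ⨆ y : Site, vonNeumann ω ((La.translate y).bonds)ᶜ ≤
      ⨆ i, vonNeumann ω ((La.translate (x i)).bonds)ᶜ := iSup_le fun y => by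
    obtain ⟨j, hj⟩ := hx.cofinal y
    exact (vonNeumann_mono (Set.compl_subset_compl.2 hj)).trans
      (le_iSup (fun i => vonNeumann ω ((La.translate (x i)).bonds)ᶜ) j)
  have hdir : Directed (· ≤ ·) fun i => vonNeumann ω ((La.translate (x i)).bonds)ᶜ :=
    Monotone.directed_le fun i j hij =>
      vonNeumann_mono (Set.compl_subset_compl.2 (hx.antitone hij))
  have hS' := hle hS
  rw [← SetLike.mem_coe, StarSubalgebra.coe_iSup_of_directed hdir, Set.mem_iUnion] at hS'
  obtain ⟨i, hi⟩ := hS'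
  rw [dist_eq_norm] at hd
  exact ⟨i, S, hi, hd⟩

theorem norm_conj_le {W : Op ω} (h1 : star W = W) (h2 : W * W = 1) (T : Op ω) :
    ‖W * T * W‖ = ‖T‖ := by
  have hW : W ∈ unitary (Op ω) := by
    rw [Unitary.mem_iff, h1]
    exact ⟨h2, h2⟩
  rw [CStarRing.norm_mul_mem_unitary _ hW, CStarRing.norm_mem_unitary_mul _ hW]

/-- An element of the auxiliary algebra that commutes with unitaries that implement `ρ` far away is
invariant under the extension of `ρ`. -/
theorem IsAuxExtension.eq_self_of_commute {La : Cone} {ρ : QuasiLocal →⋆ₐ[ℂ] QuasiLocal}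
    {ρ' : auxAlgebra ω La →⋆ₐ[ℂ] auxAlgebra ω La} (h : IsAuxExtension ω La ρ ρ')
    {x : ℕ → Site} (hx : Exhausts La x) (U : auxAlgebra ω La)
    (hU : ∀ j, ∃ W : Op ω, Implements W ρ ((La.translate (x j)).bonds)ᶜ ∧ W * U = U * W) :
    ρ' U = U := by
  rw [← sub_eq_zero, ← norm_le_zero_iff]
  refine le_of_forall_pos_le_add fun ε hε => ?_
  obtain ⟨i, S, hS, hd⟩ := hx.exists_near U.2 (half_pos hε)
  obtain ⟨W, hW, hc⟩ := hU i
  -- On the nearby element `S` the extension is conjugation with `W`. Since `W` commutes with `U`,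
  -- this keeps the distance between `S` and `U`.
  let S' : auxAlgebra ω La := ⟨S, vonNeumann_le_auxAlgebra ω La _ hS⟩
  have h1 : ‖ρ' (U - S')‖ < ε / 2 := (NonUnitalStarAlgHom.norm_apply_le ρ' _).trans_lt hd
  have h2 : ‖ρ' S' - U‖ < ε / 2 := by
    have : ((ρ' S' - U : auxAlgebra ω La) : Op ω) = W * (S - U) * W := by
      rw [mul_sub, sub_mul, hc, mul_assoc (U : Op ω), hW.mul_self, mul_one]
      exact congrArg (· - (U : Op ω)) (h.eq_conj hW (T := S') hS)
    change ‖((ρ' S' - U : auxAlgebra ω La) : Op ω)‖ < _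
    rw [this, norm_conj_le hW.star_eq hW.mul_self, norm_sub_rev]
    exact hd
  have h3 : ρ' U - U = ρ' (U - S') + (ρ' S' - U) := by rw [map_sub]; abel
  rw [h3]
  exact (norm_add_le _ _).trans (by linarith)

/-- The extension of an endomorphism to the auxiliary algebra exists if it is implemented outside
all translates of the forbidden cone. -/
theorem exists_isAuxExtension {La : Cone} {ρ : QuasiLocal →⋆ₐ[ℂ] QuasiLocal}
    (hρ : ∀ L, ∀ A ∈ observables L, ρ A ∈ observables L) {x : ℕ → Site} (hx : Exhausts La x)
    (hW : ∀ j, ∃ W : Op ω, Implements W ρ ((La.translate (x j)).bonds)ᶜ) :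
    ∃ ρ' : auxAlgebra ω La →⋆ₐ[ℂ] auxAlgebra ω La, IsAuxExtension ω La ρ ρ' := by
  choose W hW using hW
  have hmono : ∀ {i j}, i ≤ j →
      ((La.translate (x i)).bonds)ᶜ ⊆ ((La.translate (x j)).bonds)ᶜ := fun hij =>
    Set.compl_subset_compl.2 (hx.antitone hij)
  -- On each von Neumann algebra the sequence of conjugations is stationary, so the limit defining
  -- the extension exists there trivially and passes to the norm closure.
  have hconst : ∀ {i j} {T : Op ω}, T ∈ vonNeumann ω ((La.translate (x i)).bonds)ᶜ → i ≤ j →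
      W j * T * W j = W i * T * W i := fun hT hij =>
    ((hW _).mono (hmono hij)).conj_eq (hW _) hT
  have hlim : ∀ {i} {T : Op ω}, T ∈ vonNeumann ω ((La.translate (x i)).bonds)ᶜ →
      Tendsto (fun j => W j * T * W j) atTop (𝓝 (W i * T * W i)) := fun {i T} hT =>
    tendsto_atTop_of_eventually_const (i₀ := i) fun j hj => hconst hT hj
  have hex : ∀ T : auxAlgebra ω La, ∃ B : auxAlgebra ω La,
      Tendsto (fun j => W j * T * W j) atTop (𝓝 (B : Op ω)) := by
    intro T
    have hcauchy : CauchySeq fun j => W j * (T : Op ω) * W j := by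
      refine Metric.cauchySeq_iff'.2 fun ε hε => ?_
      obtain ⟨i, S, hS, hd⟩ := hx.exists_near T.2 (half_pos hε)
      refine ⟨i, fun j hj => ?_⟩
      have hn : ∀ j, ‖W j * (T : Op ω) * W j - W j * S * W j‖ < ε / 2 := fun j => by
        rw [← sub_mul, ← mul_sub, norm_conj_le (hW j).star_eq (hW j).mul_self]
        exact hd
      have h1 := hn j
      have h2 := hn i
      rw [hconst hS hj] at h1
      rw [← dist_eq_norm] at h1 h2
      rw [dist_comm] at h2
      exact (dist_triangle _ _ _).trans_lt (by linarith)
    obtain ⟨B, hB⟩ := cauchySeq_tendsto_of_complete hcauchy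
    have hmem : B ∈ auxAlgebra ω La := by
      change B ∈ closure _
      refine Metric.mem_closure_iff.2 fun ε hε => ?_
      obtain ⟨i, S, hS, hd⟩ := hx.exists_near T.2 (half_pos hε)
      refine ⟨W i * S * W i, (le_iSup (fun y => vonNeumann ω ((La.translate y).bonds)ᶜ) (x i))
        ((hW i).conj_mem (hρ _) hS), ?_⟩
      have : ‖B - W i * S * W i‖ ≤ ε / 2 := by
        refine le_of_tendsto (hB.sub (hlim hS)).norm (Eventually.of_forall fun j => ?_)
        rw [← sub_mul, ← mul_sub, norm_conj_le (hW j).star_eq (hW j).mul_self]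
        exact hd.le
      rw [dist_eq_norm]
      linarith
    exact ⟨⟨B, hmem⟩, hB⟩
  choose Φ hΦ using hex
  have huniq : ∀ {T B : auxAlgebra ω La},
      Tendsto (fun j => W j * T * W j) atTop (𝓝 (B : Op ω)) → Φ T = B := fun h =>
    Subtype.ext (tendsto_nhds_unique (hΦ _) h)
  have hsq := fun j => (hW j).mul_self
  have halg : ∀ r : ℂ, Φ (algebraMap ℂ _ r) = algebraMap ℂ _ r := fun r => huniq <| by
    refine tendsto_const_nhds.congr fun j => ?_
    change algebraMap ℂ (Op ω) r = W j * algebraMap ℂ (Op ω) r * W j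
    rw [← Algebra.commutes, mul_assoc, hsq, mul_one]
  let ρ' : auxAlgebra ω La →⋆ₐ[ℂ] auxAlgebra ω La :=
    { toFun := Φ
      map_one' := by simpa using halg 1
      map_mul' := fun S T => huniq <| ((hΦ S).mul (hΦ T)).congr fun j => by
        change _ = W j * ((S : Op ω) * T) * W j
        calc _ = W j * (S : Op ω) * (W j * W j) * T * W j := by simp only [mul_assoc]
          _ = _ := by rw [hsq, mul_one, mul_assoc (W j)]
      map_zero' := by simpa using halg 0
      map_add' := fun S T => huniq <| ((hΦ S).add (hΦ T)).congr fun j => by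
        change _ = W j * ((S : Op ω) + T) * W j
        rw [mul_add, add_mul]
      commutes' := halg
      map_star' := fun T => huniq <| (hΦ T).star.congr fun j => by
        change _ = W j * star (T : Op ω) * W j
        rw [star_mul, star_mul, (hW j).star_eq, mul_assoc] }
  refine ⟨ρ', fun A T hT => ?_, fun y => ?_⟩
  · refine tendsto_nhds_unique (hΦ T) ?_
    rw [hT]
    -- Agreement with `ρ` is needed only on Pauli matrices, each of which eventually lies outside
    -- the translates; it then extends to the norm closure.
    let K : StarSubalgebra ℂ QuasiLocal :=
      { carrier := {A | Tendsto (fun j => W j * gnsRep ω A * W j) atTop (𝓝 (gnsRep ω (ρ A)))}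
        mul_mem' := fun {A B} hA hB => by
          simp only [Set.mem_ofPred_eq, map_mul] at hA hB ⊢
          refine (hA.mul hB).congr fun j => ?_
          calc _ = W j * gnsRep ω A * (W j * W j) * gnsRep ω B * W j := by simp only [mul_assoc]
            _ = _ := by rw [hsq, mul_one, mul_assoc (W j)]
        add_mem' := fun {A B} hA hB => by
          simp only [Set.mem_ofPred_eq, map_add] at hA hB ⊢
          simpa only [mul_add, add_mul] using hA.add hB
        star_mem' := fun {A} hA => by
          simp only [Set.mem_ofPred_eq, map_star] at hA ⊢
          refine hA.star.congr fun j => ?_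
          rw [star_mul, star_mul, (hW j).star_eq, mul_assoc]
        algebraMap_mem' := fun r => by
          simp only [Set.mem_ofPred_eq, AlgHomClass.commutes]
          refine tendsto_const_nhds.congr fun j => ?_
          rw [← Algebra.commutes, mul_assoc, hsq, mul_one] }
    have hclosed : IsClosed (K : Set QuasiLocal) := by
      refine isClosed_of_closure_subset fun A hA => ?_
      refine Metric.tendsto_atTop.2 fun ε hε => ?_
      obtain ⟨B, hB, hAB⟩ := Metric.mem_closure_iff.1 hA (ε / 3) (by positivity)
      obtain ⟨N, hN⟩ := Metric.tendsto_atTop.1 hB (ε / 3) (by positivity)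
      rw [dist_eq_norm] at hAB
      refine ⟨N, fun n hn => ?_⟩
      have h1 : dist (W n * gnsRep ω A * W n) (W n * gnsRep ω B * W n) < ε / 3 := by
        rw [dist_eq_norm, ← sub_mul, ← mul_sub, norm_conj_le (hW n).star_eq (hW n).mul_self,
          ← map_sub]
        exact (NonUnitalStarAlgHom.norm_apply_le _ _).trans_lt hAB
      have h2 : dist (gnsRep ω (ρ B)) (gnsRep ω (ρ A)) < ε / 3 := by
        rw [dist_eq_norm, norm_sub_rev, ← map_sub, ← map_sub]
        exact (NonUnitalStarAlgHom.norm_apply_le _ _).trans_lt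
          ((NonUnitalStarAlgHom.norm_apply_le _ _).trans_lt hAB)
      have h3 := hN n hn
      have := dist_triangle4 (W n * gnsRep ω A * W n) (W n * gnsRep ω B * W n)
        (gnsRep ω (ρ B)) (gnsRep ω (ρ A))
      linarith
    refine StarSubalgebra.topologicalClosure_minimal (StarAlgebra.adjoin_le ?_) hclosed
      (mem_observables_univ A)
    rintro _ ⟨l, b, -, rfl⟩
    obtain ⟨i, hi⟩ := hx.leaves b
    refine tendsto_atTop_of_eventually_const (i₀ := i) fun j hj => ?_
    exact (hW j).conj' (observables_mono (hmono hj) (pauli_mem_observables l hi))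
  -- On the algebra of any one translate the limit is conjugation with a single unitary, which is
  -- weakly continuous.
  · obtain ⟨j, hj⟩ := hx.cofinal y
    have hsub := Set.compl_subset_compl.2 hj
    refine ((continuous_conj (W j)).comp continuous_subtype_val).congr fun T => ?_
    have : Φ ⟨T.1.toCLM, vonNeumann_le_auxAlgebra ω La y T.2⟩ =
        ⟨W j * T.1.toCLM * W j, vonNeumann_le_auxAlgebra ω La (x j)
          ((hW j).conj_mem (hρ _) (vonNeumann_mono hsub T.2))⟩ :=
      huniq (hlim (vonNeumann_mono hsub T.2))
    exact congrArg (fun B : auxAlgebra ω La => ContinuousLinearMapWOT.ofCLM (B : Op ω)) this.symm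

end AuxExtension

/-! ### Directions and cones -/

/-- The unit vector of direction `φ`. -/
def unitVec (φ : ℝ) : ℝ × ℝ := (Real.cos φ, Real.sin φ)

/-- The distance of `z` from the line of direction `φ`, positive on the left of the line. -/
def side (φ : ℝ) (z : ℝ × ℝ) : ℝ := Real.cos φ * z.2 - Real.sin φ * z.1

theorem side_add (φ : ℝ) (z w : ℝ × ℝ) : side φ (z + w) = side φ z + side φ w := by
  simp only [side, Prod.fst_add, Prod.snd_add]; ring

theorem side_sub (φ : ℝ) (z w : ℝ × ℝ) : side φ (z - w) = side φ z - side φ w := by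
  simp only [side, Prod.fst_sub, Prod.snd_sub]; ring

theorem side_smul (φ r : ℝ) (z : ℝ × ℝ) : side φ (r • z) = r * side φ z := by
  simp only [side, Prod.smul_fst, Prod.smul_snd, smul_eq_mul]; ring

theorem side_unitVec (φ ψ : ℝ) : side φ (unitVec ψ) = Real.sin (ψ - φ) := by
  simp only [side, unitVec, Real.sin_sub]; ring

theorem side_add_int_mul_two_pi (φ : ℝ) (m : ℤ) : side (φ + m * (2 * Real.pi)) = side φ := by
  ext z
  simp only [side, Real.cos_add_int_mul_two_pi, Real.sin_add_int_mul_two_pi]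

theorem abs_side_le (φ : ℝ) (z : ℝ × ℝ) : |side φ z| ≤ |z.1| + |z.2| := by
  have h1 : |Real.cos φ * z.2| ≤ |z.2| := by
    rw [abs_mul]
    exact mul_le_of_le_one_left (abs_nonneg _) (Real.abs_cos_le_one φ)
  have h2 : |Real.sin φ * z.1| ≤ |z.1| := by
    rw [abs_mul]
    exact mul_le_of_le_one_left (abs_nonneg _) (Real.abs_sin_le_one φ)
  calc _ ≤ |Real.cos φ * z.2| + |Real.sin φ * z.1| := abs_sub _ _
    _ ≤ _ := by linarith

/-- Every vector has polar coordinates with an angle in a given interval. -/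
theorem exists_polar (z : ℝ × ℝ) (a : ℝ) : ∃ r : ℝ, 0 ≤ r ∧
    ∃ t ∈ Set.Ico a (a + 2 * Real.pi), z = r • unitVec t := by
  set w : ℂ := ⟨z.1, z.2⟩
  obtain ⟨m, hm, -⟩ := existsUnique_add_zsmul_mem_Ico Real.two_pi_pos w.arg a
  refine ⟨‖w‖, norm_nonneg _, _, hm, ?_⟩
  ext
  · simp only [zsmul_eq_mul, unitVec, Prod.smul_mk, smul_eq_mul, Real.cos_add_int_mul_two_pi]
    exact (Complex.norm_mul_cos_arg w).symm
  · simp only [zsmul_eq_mul, unitVec, Prod.smul_mk, smul_eq_mul, Real.sin_add_int_mul_two_pi]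
    exact (Complex.norm_mul_sin_arg w).symm

namespace Cone

variable (K : Cone)

/-- The signed distance from the first boundary line, nonnegative on the cone. -/
def lo (z : ℝ × ℝ) : ℝ := side K.direction (z - K.apex.toPlane)

/-- The signed distance from the second boundary line, nonnegative on the cone. -/
def hi (z : ℝ × ℝ) : ℝ := -side (K.direction + K.angle) (z - K.apex.toPlane)

/-- `z` is strictly between the directions of the two boundary rays. -/
def Inside (z : ℝ × ℝ) : Prop :=
  0 < side K.direction z ∧ side (K.direction + K.angle) z < 0

theorem inside_unitVec {φ : ℝ} (h1 : K.direction < φ) (h2 : φ < K.direction + K.angle) :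
    K.Inside (unitVec φ) := by
  have := K.angle_lt_pi
  rw [Inside, side_unitVec, side_unitVec]
  exact ⟨Real.sin_pos_of_pos_of_lt_pi (by linarith) (by linarith),
    Real.sin_neg_of_neg_of_neg_pi_lt (by linarith) (by linarith)⟩

theorem inside_unitVec_mod {φ : ℝ} (m : ℤ) (h1 : K.direction + m * (2 * Real.pi) < φ)
    (h2 : φ < K.direction + m * (2 * Real.pi) + K.angle) : K.Inside (unitVec φ) := by
  have := K.inside_unitVec (φ := φ + (-m : ℤ) * (2 * Real.pi)) (by push_cast; linarith)
    (by push_cast; linarith)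
  simpa only [unitVec, Real.cos_add_int_mul_two_pi, Real.sin_add_int_mul_two_pi] using this

/-- Polar coordinates of the points of a cone. -/
theorem exists_polar_of_side {z : ℝ × ℝ} (h1 : 0 ≤ side K.direction z)
    (h2 : side (K.direction + K.angle) z ≤ 0) : ∃ r : ℝ, 0 ≤ r ∧
      ∃ t ∈ Set.Icc K.direction (K.direction + K.angle), z = r • unitVec t := by
  have ha := K.angle_pos
  have hb := K.angle_lt_pi
  obtain ⟨r, hr, t, ht, rfl⟩ := exists_polar z K.direction
  rw [side_smul, side_unitVec] at h1 h2
  rcases hr.eq_or_lt with rfl | hr'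
  · exact ⟨0, le_rfl, K.direction, ⟨le_rfl, by linarith⟩, by simp⟩
  have h1' : 0 ≤ Real.sin (t - K.direction) := nonneg_of_mul_nonneg_right h1 hr'
  have h2' : Real.sin (t - (K.direction + K.angle)) ≤ 0 := nonpos_of_mul_nonpos_right h2 hr'
  refine ⟨r, hr, t, ⟨ht.1, ?_⟩, rfl⟩
  by_contra hlt
  push Not at hlt
  have h3 : t - K.direction ≤ Real.pi := by
    by_contra hgt
    push Not at hgt
    have : Real.sin (t - K.direction - 2 * Real.pi) < 0 :=
      Real.sin_neg_of_neg_of_neg_pi_lt (by linarith [ht.2]) (by linarith)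
    rw [Real.sin_sub_two_pi] at this
    linarith
  have : 0 < Real.sin (t - (K.direction + K.angle)) :=
    Real.sin_pos_of_pos_of_lt_pi (by linarith) (by linarith)
  linarith

theorem Inside.exists_polar {K : Cone} {z : ℝ × ℝ} (h : K.Inside z) :
    ∃ r : ℝ, 0 < r ∧ ∃ t ∈ Set.Ioo K.direction (K.direction + K.angle), z = r • unitVec t := by
  obtain ⟨r, hr, t, ht, rfl⟩ := K.exists_polar_of_side h.1.le h.2.le
  rw [Inside, side_smul, side_smul, side_unitVec, side_unitVec] at h
  have hr' : 0 < r := by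
    rcases hr.eq_or_lt with rfl | hr'
    · simp at h
    · exact hr'
  refine ⟨r, hr', t, ⟨lt_of_le_of_ne ht.1 ?_, lt_of_le_of_ne ht.2 ?_⟩, rfl⟩
  · rintro rfl
    simp at h
  · rintro rfl
    simp at h

/-- An angle below `π` makes the sector an intersection of two half planes, so that the two affine
functions `lo` and `hi` replace angles. -/
theorem mem_region_iff {z : ℝ × ℝ} : z ∈ K.region ↔ 0 ≤ K.lo z ∧ 0 ≤ K.hi z := by
  have ha := K.angle_pos
  have hb := K.angle_lt_pi
  have heq : ∀ r t : ℝ, z = ((K.apex.1 : ℝ) + r * Real.cos t, (K.apex.2 : ℝ) + r * Real.sin t) ↔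
      z - K.apex.toPlane = r • unitVec t := by
    intro r t
    simp only [Prod.ext_iff, Prod.fst_sub, Prod.snd_sub, Site.toPlane, unitVec, Prod.smul_mk,
      smul_eq_mul]
    constructor <;> rintro ⟨h1, h2⟩ <;> constructor <;> linarith
  simp only [region, Set.mem_ofPred_eq, heq, lo, hi]
  constructor
  · rintro ⟨r, hr, t, ht, h⟩
    rw [h, side_smul, side_smul, side_unitVec, side_unitVec]
    refine ⟨mul_nonneg hr (Real.sin_nonneg_of_nonneg_of_le_pi (by linarith [ht.1])
      (by linarith [ht.2])), ?_⟩
    have : Real.sin (t - (K.direction + K.angle)) ≤ 0 :=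
      Real.sin_nonpos_of_nonpos_of_neg_pi_le (by linarith [ht.2]) (by linarith [ht.1])
    nlinarith
  · rintro ⟨h1, h2⟩
    exact K.exists_polar_of_side h1 (by linarith)

theorem lo_sub (z w : ℝ × ℝ) : K.lo z - K.lo w = side K.direction (z - w) := by
  simp only [lo, side_sub]; ring

theorem hi_sub (z w : ℝ × ℝ) : K.hi z - K.hi w = -side (K.direction + K.angle) (z - w) := by
  simp only [hi, side_sub]; ring

theorem abs_lo_sub_le (z w : ℝ × ℝ) : |K.lo z - K.lo w| ≤ |z.1 - w.1| + |z.2 - w.2| := by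
  rw [lo_sub]
  exact abs_side_le _ _

theorem abs_hi_sub_le (z w : ℝ × ℝ) : |K.hi z - K.hi w| ≤ |z.1 - w.1| + |z.2 - w.2| := by
  rw [hi_sub, abs_neg]
  exact abs_side_le _ _

end Cone

/-- The points of the segment of a bond. -/
theorem mem_segment_bond {b : Bond} {z : ℝ × ℝ}
    (hz : z ∈ segment ℝ b.1.toPlane b.tip.toPlane) :
    ∃ s ∈ Set.Icc (0 : ℝ) 1, z = b.1.toPlane + s • (b.tip.toPlane - b.1.toPlane) := by
  rw [segment_eq_image'] at hz
  obtain ⟨s, hs, rfl⟩ := hz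
  exact ⟨s, hs, rfl⟩

theorem tip_toPlane_sub (b : Bond) : b.tip.toPlane - b.1.toPlane = (1, 0) ∨
    b.tip.toPlane - b.1.toPlane = (0, 1) := by
  obtain ⟨⟨x, y⟩, c⟩ := b
  cases c <;> simp [Bond.tip, Site.toPlane]

/-- The taxicab distance. -/
def taxi (z w : ℝ × ℝ) : ℝ := |z.1 - w.1| + |z.2 - w.2|

theorem taxi_segment {b : Bond} {z : ℝ × ℝ} (hz : z ∈ segment ℝ b.1.toPlane b.tip.toPlane) :
    taxi z b.1.toPlane ≤ 1 := by
  obtain ⟨s, hs, rfl⟩ := mem_segment_bond hz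
  rcases tip_toPlane_sub b with h | h <;> rw [h] <;>
    simp [taxi, abs_of_nonneg hs.1, hs.2]

theorem taxi_tip (b : Bond) : taxi b.tip.toPlane b.1.toPlane ≤ 1 :=
  taxi_segment (right_mem_segment _ _ _)

namespace Cone

variable (K : Cone)

theorem mem_bonds_iff {b : Bond} : b ∈ K.bonds ↔
    ∃ z ∈ segment ℝ b.1.toPlane b.tip.toPlane, 0 ≤ K.lo z ∧ 0 ≤ K.hi z := by
  simp only [bonds, Set.Nonempty, Set.mem_inter_iff, mem_region_iff]
  rfl

theorem mem_bonds_of_fst {b : Bond} (h1 : 0 ≤ K.lo b.1.toPlane) (h2 : 0 ≤ K.hi b.1.toPlane) :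
    b ∈ K.bonds :=
  K.mem_bonds_iff.2 ⟨_, left_mem_segment _ _ _, h1, h2⟩

theorem mem_bonds_of_tip {b : Bond} (h1 : 0 ≤ K.lo b.tip.toPlane) (h2 : 0 ≤ K.hi b.tip.toPlane) :
    b ∈ K.bonds :=
  K.mem_bonds_iff.2 ⟨_, right_mem_segment _ _ _, h1, h2⟩

/-- The base point is within taxicab distance one of a point of the region, and `lo` and `hi` are
1-Lipschitz for this distance. -/
theorem neg_one_le_of_mem_bonds {b : Bond} (h : b ∈ K.bonds) :
    -1 ≤ K.lo b.1.toPlane ∧ -1 ≤ K.hi b.1.toPlane := by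
  obtain ⟨z, hz, h1, h2⟩ := K.mem_bonds_iff.1 h
  have h3 := (K.abs_lo_sub_le z b.1.toPlane).trans (taxi_segment hz)
  have h4 := (K.abs_hi_sub_le z b.1.toPlane).trans (taxi_segment hz)
  rw [abs_le] at h3 h4
  constructor <;> linarith

/-- The sum of the distances from the boundary lines; it tends to infinity on the cone. -/
def height (z : ℝ × ℝ) : ℝ := K.lo z + K.hi z

/-- A bond of the cone far away from the apex has an endpoint in the cone. -/
theorem exists_endpoint {b : Bond} (hb : b ∈ K.bonds) (hh : 4 < K.height b.1.toPlane) :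
    (0 ≤ K.lo b.1.toPlane ∧ 0 ≤ K.hi b.1.toPlane) ∨
      (0 ≤ K.lo b.tip.toPlane ∧ 0 ≤ K.hi b.tip.toPlane) := by
  obtain ⟨z, hz, h1, h2⟩ := K.mem_bonds_iff.1 hb
  obtain ⟨s, hs, rfl⟩ := mem_segment_bond hz
  have e1 := K.lo_sub (b.1.toPlane + s • (b.tip.toPlane - b.1.toPlane)) b.1.toPlane
  have e2 := K.hi_sub (b.1.toPlane + s • (b.tip.toPlane - b.1.toPlane)) b.1.toPlane
  rw [add_sub_cancel_left, side_smul] at e1 e2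
  rw [← K.lo_sub] at e1
  have e3 := K.hi_sub b.tip.toPlane b.1.toPlane
  have h3 := (K.abs_lo_sub_le b.tip.toPlane b.1.toPlane).trans (taxi_tip b)
  have h4 := (K.abs_hi_sub_le b.tip.toPlane b.1.toPlane).trans (taxi_tip b)
  rw [abs_le] at h3 h4
  simp only [height] at hh
  obtain ⟨hs0, hs1⟩ := hs
  set l0 := K.lo b.1.toPlane
  set l1 := K.lo b.tip.toPlane
  set r0 := K.hi b.1.toPlane
  set r1 := K.hi b.tip.toPlane
  have e2' : K.hi (b.1.toPlane + s • (b.tip.toPlane - b.1.toPlane)) - r0 = s * (r1 - r0) := by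
    rw [e3]; linarith
  -- An affine function that is negative at both ends of a bond is negative all along it.
  have key : ∀ x p q : ℝ, 0 ≤ x → x - p = s * (q - p) → p < 0 → q < 0 → False := by
    intro x p q hx h hp hq
    rcases le_total p q with hpq | hpq
    · have := mul_le_of_le_one_left (sub_nonneg.2 hpq) hs1
      linarith
    · have := mul_nonpos_of_nonneg_of_nonpos hs0 (sub_nonpos.2 hpq)
      linarith
  by_contra hcon
  push Not at hcon
  obtain ⟨hc1, hc2⟩ := hcon
  -- At this height one of the two inequalities holds at both ends, so only the other one matters.
  rcases lt_or_ge l0 1 with hl | hl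
  · have hr0 : 2 < r0 := by linarith
    have hr1 : 0 ≤ r1 := by linarith
    have hl0 : l0 < 0 := by
      by_contra h; push Not at h; linarith [hc1 h]
    have hl1 : l1 < 0 := by
      by_contra h; push Not at h; linarith [hc2 h]
    exact key _ _ _ h1 e1 hl0 hl1
  · have hl1 : 0 ≤ l1 := by linarith
    have hr0 := hc1 (by linarith)
    have hr1 := hc2 hl1
    exact key _ _ _ h2 e2' hr0 hr1

/-- Only finitely many bonds of a cone have bounded height. -/
theorem finite_height_le (H : ℝ) : {b ∈ K.bonds | K.height b.1.toPlane ≤ H}.Finite := by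
  have hs : 0 < Real.sin K.angle := Real.sin_pos_of_pos_of_lt_pi K.angle_pos K.angle_lt_pi
  obtain ⟨C, hC⟩ := exists_nat_ge ((2 * (H + 3)) / Real.sin K.angle + |(K.apex.1 : ℝ)| +
    |(K.apex.2 : ℝ)|)
  refine (((box C).product (Finset.univ : Finset Bool)).finite_toSet).subset ?_
  rintro b ⟨hb, hh⟩
  obtain ⟨h1, h2⟩ := K.neg_one_le_of_mem_bonds hb
  simp only [height] at hh
  set z := b.1.toPlane with hz
  -- Both functions are at least `-1`; this bounds each of them by `H + 1` and forces `H ≥ -2`,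
  -- whence `-(H + 3) ≤ -1`.
  have hl : |K.lo z| ≤ H + 3 := abs_le.2 ⟨by linarith, by linarith⟩
  have hr : |K.hi z| ≤ H + 3 := abs_le.2 ⟨by linarith, by linarith⟩
  have hsin := Real.sin_sub (K.direction + K.angle) K.direction
  rw [add_sub_cancel_left] at hsin
  -- Cramer's rule recovers the coordinates from `lo` and `hi`; the determinant `sin angle` is
  -- positive.
  have x1 : (z.1 - K.apex.1) * Real.sin K.angle =
      K.hi z * Real.cos K.direction + K.lo z * Real.cos (K.direction + K.angle) := by
    rw [hsin]
    simp only [lo, hi, side, Prod.fst_sub, Prod.snd_sub, Site.toPlane]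
    ring
  have x2 : (z.2 - K.apex.2) * Real.sin K.angle =
      K.hi z * Real.sin K.direction + K.lo z * Real.sin (K.direction + K.angle) := by
    rw [hsin]
    simp only [lo, hi, side, Prod.fst_sub, Prod.snd_sub, Site.toPlane]
    ring
  have bound : ∀ x p q : ℝ, |p| ≤ 1 → |q| ≤ 1 →
      x * Real.sin K.angle = K.hi z * p + K.lo z * q → |x| ≤ 2 * (H + 3) / Real.sin K.angle := by
    intro x p q hp hq hx
    rw [le_div_iff₀ hs, ← abs_of_pos hs, ← abs_mul, hx]
    refine (abs_add_le _ _).trans ?_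
    rw [abs_mul, abs_mul]
    have a1 := mul_le_mul hr hp (abs_nonneg _) ((abs_nonneg _).trans hr)
    have a2 := mul_le_mul hl hq (abs_nonneg _) ((abs_nonneg _).trans hl)
    linarith
  have b1 := bound _ _ _ (Real.abs_cos_le_one _) (Real.abs_cos_le_one _) x1
  have b2 := bound _ _ _ (Real.abs_sin_le_one _) (Real.abs_sin_le_one _) x2
  have c1 : |z.1| ≤ C := by
    have := abs_sub_abs_le_abs_sub z.1 (K.apex.1 : ℝ)
    linarith [abs_nonneg (K.apex.2 : ℝ)]
  have c2 : |z.2| ≤ C := by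
    have := abs_sub_abs_le_abs_sub z.2 (K.apex.2 : ℝ)
    linarith [abs_nonneg (K.apex.1 : ℝ)]
  simp only [Finset.mem_coe]
  refine Finset.mem_product.2 ⟨mem_box.2 ⟨?_, ?_⟩, Finset.mem_univ _⟩
  · have : |(b.1.1 : ℝ)| ≤ C := c1
    exact_mod_cast this
  · have : |(b.1.2 : ℝ)| ≤ C := c2
    exact_mod_cast this

end Cone

/-! ### Cones have one end -/

theorem toPlane_add (v w : Site) : Site.toPlane (v + w) = v.toPlane + w.toPlane := by
  simp [Site.toPlane]

theorem toPlane_sub (v w : Site) : Site.toPlane (v - w) = v.toPlane - w.toPlane := by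
  simp [Site.toPlane]

theorem toPlane_nsmul (n : ℕ) (v : Site) : Site.toPlane (n • v) = (n : ℝ) • v.toPlane := by
  simp [Site.toPlane]

/-- The four unit steps of the lattice. -/
def IsStep (e : Site) : Prop := e = (1, 0) ∨ e = (-1, 0) ∨ e = (0, 1) ∨ e = (0, -1)

theorem IsStep.neg {e : Site} (h : IsStep e) : IsStep (-e) := by
  rcases h with rfl | rfl | rfl | rfl <;> simp [IsStep]

theorem IsStep.abs_side_le {e : Site} (h : IsStep e) (φ : ℝ) : |side φ e.toPlane| ≤ 1 := by
  refine (ToricCode.abs_side_le φ _).trans ?_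
  rcases h with rfl | rfl | rfl | rfl <;> simp [Site.toPlane]

/-- The four steps give the values `± cos φ` and `± sin φ`, whose squares could not sum to one if
all four were below `1 / 2`. -/
theorem exists_isStep_half_le_side (φ : ℝ) : ∃ e, IsStep e ∧ 1 / 2 ≤ side φ e.toPlane := by
  have h := Real.cos_sq_add_sin_sq φ
  by_contra hcon
  push Not at hcon
  have h1 := hcon (1, 0) (by simp [IsStep])
  have h2 := hcon (-1, 0) (by simp [IsStep])
  have h3 := hcon (0, 1) (by simp [IsStep])
  have h4 := hcon (0, -1) (by simp [IsStep])
  simp only [side, Site.toPlane, Int.cast_one, Int.cast_zero, Int.cast_neg] at h1 h2 h3 h4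
  nlinarith

theorem exists_joins_of_isStep (k : Charge) (v : Site) {e : Site} (he : IsStep e) :
    ∃ b, Joins k b v (v + e) ∧ (b.1 = v ∨ b.1 = v + e) := by
  rcases he with rfl | rfl | rfl | rfl
  · exact exists_joins_fst k v
  · obtain ⟨b, h1, h2⟩ := exists_joins_fst k (v + (-1, 0))
    have : v + (-1, 0) + (1, 0) = v := by rw [add_assoc]; simp
    rw [this] at h1 h2
    exact ⟨b, h1.symm, h2.symm⟩
  · exact exists_joins_snd k v
  · obtain ⟨b, h1, h2⟩ := exists_joins_snd k (v + (0, -1))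
    have : v + (0, -1) + (0, 1) = v := by rw [add_assoc]; simp
    rw [this] at h1 h2
    exact ⟨b, h1.symm, h2.symm⟩

/-- Every step is along a bond one of whose endpoints is one of the ends of the step. -/
theorem exists_joins_tip (k : Charge) (v : Site) {e : Site} (he : e = (1, 0) ∨ e = (0, 1)) :
    ∃ b, Joins k b v (v + e) ∧ (v + e = b.1 ∨ v + e = b.tip) := by
  obtain ⟨x, y⟩ := v
  cases k
  · rcases he with rfl | rfl
    · exact ⟨((x, y) + (1, 0), true), Or.inr ⟨by simp [Bond.otherPlaq], rfl⟩, Or.inl rfl⟩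
    · exact ⟨((x, y) + (0, 1), false), Or.inr ⟨by simp [Bond.otherPlaq], rfl⟩, Or.inl rfl⟩
  · rcases he with rfl | rfl
    · exact ⟨((x, y), false), Or.inl ⟨rfl, rfl⟩, Or.inr rfl⟩
    · exact ⟨((x, y), true), Or.inl ⟨rfl, rfl⟩, Or.inr rfl⟩

theorem Joins.eq_of_cobd {k : Charge} {b : Bond} {v w : Site} (h : Joins k b v w)
    {f : Site → ZMod 2} (hf : cobd k f b = 0) : f v = f w := by
  have := eq_of_add_eq_zero_zmod hf
  rcases joins_iff.1 h with ⟨rfl, rfl⟩ | ⟨rfl, rfl⟩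
  · exact this
  · exact this.symm

namespace Cone

variable (K : Cone)

theorem lo_add (z w : ℝ × ℝ) : K.lo (z + w) = K.lo z + side K.direction w := by
  have := K.lo_sub (z + w) z
  rw [add_sub_cancel_left] at this
  linarith

theorem hi_add (z w : ℝ × ℝ) : K.hi (z + w) = K.hi z - side (K.direction + K.angle) w := by
  have := K.hi_sub (z + w) z
  rw [add_sub_cancel_left] at this
  linarith

/-- The lattice point `v` lies in the cone, at distance at least `m` from the boundary lines. -/
def Deep (m : ℝ) (v : Site) : Prop := m ≤ K.lo v.toPlane ∧ m ≤ K.hi v.toPlane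

variable {K}

theorem Deep.mono {m n : ℝ} {v : Site} (h : K.Deep m v) (hn : n ≤ m) : K.Deep n v :=
  ⟨hn.trans h.1, hn.trans h.2⟩

theorem Deep.add_step {m : ℝ} {v e : Site} (h : K.Deep m v) (he : IsStep e) :
    K.Deep (m - 1) (v + e) := by
  have h1 := abs_le.1 (he.abs_side_le K.direction)
  have h2 := abs_le.1 (he.abs_side_le (K.direction + K.angle))
  rw [Deep, toPlane_add, lo_add, hi_add]
  exact ⟨by linarith [h.1], by linarith [h.2]⟩

theorem height_add_step (v : Site) {e : Site} (he : IsStep e) :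
    |K.height (Site.toPlane (v + e)) - K.height v.toPlane| ≤ 2 := by
  have h1 := abs_le.1 (he.abs_side_le K.direction)
  have h2 := abs_le.1 (he.abs_side_le (K.direction + K.angle))
  rw [height, height, toPlane_add, lo_add, hi_add, abs_le]
  constructor <;> linarith

theorem Inside.eventually_deep {u : Site} (hu : K.Inside u.toPlane) (m : ℝ) (v : Site) :
    ∀ᶠ n : ℕ in atTop, K.Deep m (v + n • u) := by
  have h1 : Tendsto (fun n : ℕ => K.lo v.toPlane + n * side K.direction u.toPlane) atTop atTop :=
    tendsto_atTop_add_const_left _ _ (tendsto_natCast_atTop_atTop.atTop_mul_const hu.1)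
  have h2 : Tendsto (fun n : ℕ => K.hi v.toPlane + n * -side (K.direction + K.angle) u.toPlane)
      atTop atTop :=
    tendsto_atTop_add_const_left _ _
      (tendsto_natCast_atTop_atTop.atTop_mul_const (neg_pos.2 hu.2))
  filter_upwards [h1.eventually_ge_atTop m, h2.eventually_ge_atTop m] with n hn1 hn2
  rw [Deep, toPlane_add, toPlane_nsmul, lo_add, hi_add, side_smul, side_smul]
  exact ⟨hn1, by linarith⟩

/-- Rounding the multiples of a vector inside a cone. -/
theorem Inside.eventually_round {z : ℝ × ℝ} (hz : K.Inside z) :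
    ∀ᶠ n : ℕ in atTop, K.Inside (Site.toPlane (round (n * z.1), round (n * z.2))) := by
  have h1 : Tendsto (fun n : ℕ => (n : ℝ) * side K.direction z) atTop atTop :=
    tendsto_natCast_atTop_atTop.atTop_mul_const hz.1
  have h2 : Tendsto (fun n : ℕ => (n : ℝ) * -side (K.direction + K.angle) z) atTop atTop :=
    tendsto_natCast_atTop_atTop.atTop_mul_const (neg_pos.2 hz.2)
  filter_upwards [h1.eventually_gt_atTop 1, h2.eventually_gt_atTop 1] with n hn1 hn2
  have key : ∀ φ, |side φ (Site.toPlane (round (n * z.1), round (n * z.2))) - n * side φ z| ≤ 1 := by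
    intro φ
    rw [← side_smul, ← side_sub]
    refine (ToricCode.abs_side_le _ _).trans ?_
    have a1 := abs_sub_round (n * z.1)
    have a2 := abs_sub_round (n * z.2)
    rw [abs_sub_comm] at a1 a2
    simp only [Site.toPlane, Prod.fst_sub, Prod.snd_sub, Prod.smul_fst, Prod.smul_snd, smul_eq_mul]
    linarith
  have k1 := abs_le.1 (key K.direction)
  have k2 := abs_le.1 (key (K.direction + K.angle))
  exact ⟨by linarith, by linarith⟩

theorem Inside.smul {z : ℝ × ℝ} (hz : K.Inside z) {r : ℝ} (hr : 0 < r) : K.Inside (r • z) := by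
  rw [Inside, side_smul, side_smul]
  exact ⟨mul_pos hr hz.1, mul_neg_of_pos_of_neg hr hz.2⟩

theorem Inside.ne_zero {u : Site} (hu : K.Inside u.toPlane) : u ≠ 0 := by
  rintro rfl
  have := hu.1
  simp [side, Site.toPlane] at this

variable (K)

theorem inside_middle : K.Inside (unitVec (K.direction + K.angle / 2)) :=
  K.inside_unitVec (by linarith [K.angle_pos]) (by linarith [K.angle_pos])

theorem exists_inside : ∃ u : Site, K.Inside u.toPlane := by
  obtain ⟨n, hn⟩ := K.inside_middle.eventually_round.exists
  exact ⟨_, hn⟩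

/-- A function that does not change under the steps of the cone of height greater than `H`. -/
def StepConst (H : ℝ) (g : Site → ZMod 2) : Prop :=
  ∀ v e, IsStep e → K.Deep 0 v → K.Deep 0 (v + e) → H < K.height v.toPlane →
    H < K.height (Site.toPlane (v + e)) → g (v + e) = g v

variable {K} {H : ℝ} {g : Site → ZMod 2}

/-- Walk from `v` to `w` by unit steps. Each costs at most one unit of depth and two of height, so
the assumptions keep the whole walk where `g` does not change. -/
theorem StepConst.eq_of_deep (hg : K.StepConst H g) (m : ℕ) : ∀ v w : Site, K.Deep m v →
    H + 2 * m < K.height v.toPlane → (w.1 - v.1).natAbs + (w.2 - v.2).natAbs ≤ m → g w = g v := by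
  induction m with
  | zero =>
    intro v w _ _ h
    congr 1
    ext <;> omega
  | succ m ih =>
    intro v w hd hh h
    push_cast at hd hh
    have key : ∀ e, IsStep e →
        (w.1 - (v + e).1).natAbs + (w.2 - (v + e).2).natAbs ≤ m → g w = g v := by
      intro e he hle
      have hd' := hd.add_step he
      rw [add_sub_cancel_right] at hd'
      have hb := abs_le.1 (K.height_add_step v he)
      have hm : (0 : ℝ) ≤ m := m.cast_nonneg
      rw [ih (v + e) w hd' (by linarith) hle]
      exact hg v e he (hd.mono (by linarith)) (hd'.mono hm) (by linarith) (by linarith)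
    rcases lt_trichotomy v.1 w.1 with h1 | h1 | h1
    · exact key (1, 0) (by simp [IsStep]) (by simp only [Prod.fst_add, Prod.snd_add]; omega)
    · rcases lt_trichotomy v.2 w.2 with h2 | h2 | h2
      · exact key (0, 1) (by simp [IsStep]) (by simp only [Prod.fst_add, Prod.snd_add]; omega)
      · congr 1
        ext
        exacts [h1.symm, h2.symm]
      · exact key (0, -1) (by simp [IsStep]) (by simp only [Prod.fst_add, Prod.snd_add]; omega)
    · exact key (-1, 0) (by simp [IsStep]) (by simp only [Prod.fst_add, Prod.snd_add]; omega)

/-- Far from the boundary lines the function is constant. -/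
theorem StepConst.exists_deep (hg : K.StepConst H g) : ∃ (a : ZMod 2) (m : ℕ),
    ∀ v, K.Deep m v → H + 2 * m < K.height v.toPlane → g v = a := by
  obtain ⟨u, hu⟩ := K.exists_inside
  -- The number of unit steps in one translation by `u`: at depth `m` the function is invariant
  -- under this translation.
  set m := u.1.natAbs + u.2.natAbs
  have hshift : ∀ v, K.Deep m v → H + 2 * m < K.height v.toPlane → ∀ n : ℕ,
      g (v + n • u) = g v ∧ K.Deep m (v + n • u) ∧
        H + 2 * m < K.height (Site.toPlane (v + n • u)) := by
    intro v hd hh n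
    induction n with
    | zero => simpa using ⟨hd, hh⟩
    | succ n ih =>
      obtain ⟨h1, h2, h3⟩ := ih
      have hs : v + (n + 1) • u = v + n • u + u := by rw [succ_nsmul, add_assoc]
      rw [hs]
      refine ⟨?_, ?_, ?_⟩
      · rw [← h1]
        refine hg.eq_of_deep m _ _ h2 h3 ?_
        simp only [Prod.fst_add, Prod.snd_add]
        omega
      · rw [Deep, toPlane_add, lo_add, hi_add]
        exact ⟨by linarith [h2.1, hu.1], by linarith [h2.2, hu.2]⟩
      · rw [height] at h3 ⊢
        rw [toPlane_add, lo_add, hi_add]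
        linarith [hu.1, hu.2]
  by_cases hex : ∃ v, K.Deep m v ∧ H + 2 * m < K.height v.toPlane
  · obtain ⟨v₀, hd₀, hh₀⟩ := hex
    refine ⟨g v₀, m, fun v hd hh => ?_⟩
    set D := (v.1 - v₀.1).natAbs + (v.2 - v₀.2).natAbs with hD
    -- Translate both points by the same multiple of `u` until the depth exceeds their distance `D`.
    obtain ⟨n, hn⟩ := (hu.eventually_deep (max D (|H| + 2 * D + 1)) v₀).exists
    rw [← (hshift v hd hh n).1, ← (hshift v₀ hd₀ hh₀ n).1]
    refine hg.eq_of_deep D _ _ (hn.mono (le_max_left _ _)) ?_ ?_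
    · have := hn.mono (le_max_right _ _)
      have h0 := le_abs_self H
      have h1 := abs_nonneg H
      have hD0 : (0 : ℝ) ≤ D := D.cast_nonneg
      rw [height]
      linarith [this.1, this.2]
    · simp only [Prod.fst_add, Prod.snd_add]
      omega
  · push Not at hex
    exact ⟨0, m, fun v hd hh => absurd (hex v hd) (not_le.2 hh)⟩

/-- Walking `n` steps in the same direction. -/
theorem StepConst.add_nsmul (hg : K.StepConst H g) {v e : Site} (he : IsStep e) (n : ℕ)
    (h : ∀ i ≤ n, K.Deep 0 (v + i • e) ∧ H < K.height (Site.toPlane (v + i • e))) :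
    g (v + n • e) = g v := by
  induction n with
  | zero => simp
  | succ n ih =>
    have h1 := h n (by omega)
    have h2 := h (n + 1) le_rfl
    rw [← ih fun i hi => h i (by omega)]
    rw [succ_nsmul, ← add_assoc] at h2 ⊢
    exact hg _ e he h1.1 h2.1 h1.2 h2.2

/-- A function that does not change under steps far out in a cone is constant far out. -/
theorem StepConst.exists_eq (hg : K.StepConst H g) :
    ∃ (a : ZMod 2) (H' : ℝ), ∀ v, K.Deep 0 v → H' < K.height v.toPlane → g v = a := by
  obtain ⟨a, m, ha⟩ := hg.exists_deep
  -- Depth `m` is reached by `2 * m` steps that gain at least `1 / 2` each. They lower the height by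
  -- at most `4 * m`, which leaves more than `H + 2 * m`; and if `hi` is at most `4 * m`, then `lo`
  -- exceeds `6 * m` and can afford the walk.
  refine ⟨a, |H| + 10 * m + 1, fun v hd hh => ?_⟩
  have hm0 : (0 : ℝ) ≤ m := m.cast_nonneg
  have hH := le_abs_self H
  have hH0 := abs_nonneg H
  rw [height] at hh
  have key : ∀ e, IsStep e → (∀ i : ℕ, i ≤ 2 * m → K.Deep 0 (v + i • e)) →
      K.Deep m (v + (2 * m) • e) → g v = a := by
    intro e he h1 h2
    have hh' : ∀ i : ℕ, i ≤ 2 * m → H + 2 * m < K.height (Site.toPlane (v + i • e)) := by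
      intro i hi
      have hi' : (i : ℝ) ≤ 2 * m := by exact_mod_cast hi
      have b1 := abs_le.1 (he.abs_side_le K.direction)
      have b2 := abs_le.1 (he.abs_side_le (K.direction + K.angle))
      have hi0 : (0 : ℝ) ≤ i := i.cast_nonneg
      rw [height, toPlane_add, toPlane_nsmul, lo_add, hi_add, side_smul, side_smul]
      have c1 := mul_le_mul_of_nonneg_left b1.1 hi0
      have c2 := mul_le_mul_of_nonneg_left b2.2 hi0
      linarith
    rw [← hg.add_nsmul he (2 * m) fun i hi => ⟨h1 i hi, by linarith [hh' i hi]⟩]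
    exact ha _ h2 (hh' _ le_rfl)
  obtain ⟨hd1, hd2⟩ := hd
  rcases le_total (K.hi v.toPlane) (4 * m) with h | h
  · obtain ⟨e, he, hs⟩ := exists_isStep_half_le_side (K.direction + K.angle)
    have b1 := abs_le.1 (he.neg.abs_side_le K.direction)
    have b2 : side (K.direction + K.angle) (Site.toPlane (-e)) ≤ -(1 / 2) := by
      have : Site.toPlane (-e) = (-1 : ℝ) • e.toPlane := by simp [Site.toPlane]
      rw [this, side_smul]
      linarith
    have bnd : ∀ i : ℕ, i ≤ 2 * m → K.hi v.toPlane + i * (1 / 2) ≤ K.hi (Site.toPlane (v + i • -e)) ∧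
        (m : ℝ) ≤ K.lo (Site.toPlane (v + i • -e)) := by
      intro i hi
      have hi' : (i : ℝ) ≤ 2 * m := by exact_mod_cast hi
      have hi0 : (0 : ℝ) ≤ i := i.cast_nonneg
      rw [toPlane_add, toPlane_nsmul, lo_add, hi_add, side_smul, side_smul]
      have c1 := mul_le_mul_of_nonneg_left b1.1 hi0
      have c2 := mul_le_mul_of_nonneg_left b2 hi0
      constructor <;> linarith
    refine key (-e) he.neg (fun i hi => ?_) ?_
    · have hi0 : (0 : ℝ) ≤ i := i.cast_nonneg
      exact ⟨by linarith [(bnd i hi).2], by linarith [(bnd i hi).1]⟩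
    · have := bnd (2 * m) le_rfl
      push_cast at this
      exact ⟨this.2, by linarith⟩
  · obtain ⟨e, he, hs⟩ := exists_isStep_half_le_side K.direction
    have b1 := abs_le.1 (he.abs_side_le (K.direction + K.angle))
    have bnd : ∀ i : ℕ, i ≤ 2 * m → K.lo v.toPlane + i * (1 / 2) ≤ K.lo (Site.toPlane (v + i • e)) ∧
        (m : ℝ) ≤ K.hi (Site.toPlane (v + i • e)) := by
      intro i hi
      have hi' : (i : ℝ) ≤ 2 * m := by exact_mod_cast hi
      have hi0 : (0 : ℝ) ≤ i := i.cast_nonneg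
      rw [toPlane_add, toPlane_nsmul, lo_add, hi_add, side_smul, side_smul]
      have c1 := mul_le_mul_of_nonneg_left b1.2 hi0
      have c2 := mul_le_mul_of_nonneg_left hs hi0
      constructor <;> linarith
    refine key e he (fun i hi => ?_) ?_
    · have hi0 : (0 : ℝ) ≤ i := i.cast_nonneg
      exact ⟨by linarith [(bnd i hi).1], by linarith [(bnd i hi).2]⟩
    · have := bnd (2 * m) le_rfl
      push_cast at this
      exact ⟨by linarith, this.2⟩

variable (K)

/-- The height is bounded on a finite set of bonds. -/
theorem exists_bound {F : Set Bond} (hF : F.Finite) :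
    ∃ H, ∀ b ∈ F, K.height b.1.toPlane ≤ H := by
  obtain ⟨H, hH⟩ := (hF.image fun b => K.height b.1.toPlane).bddAbove
  exact ⟨H, fun b hb => hH ⟨b, hb, rfl⟩⟩

/-- The exceptional bonds have bounded height, and a step to a higher point of the cone is made by a
bond of the cone. The `2` added to the bound allows for the difference in height between the tip and
the base of a bond. -/
theorem stepConst_of_cobd {k : Charge} {f : Site → ZMod 2}
    (hf : {b ∈ K.bonds | cobd k f b ≠ 0}.Finite) : ∃ H, ∀ v e, (e = (1, 0) ∨ e = (0, 1)) →
      K.Deep 0 (v + e) → H < K.height (Site.toPlane (v + e)) → f v = f (v + e) := by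
  obtain ⟨H, hH⟩ := K.exists_bound hf
  refine ⟨H + 2, fun v e he hd hh => ?_⟩
  obtain ⟨b, hb, hv⟩ := exists_joins_tip k v he
  refine hb.eq_of_cobd ?_
  by_contra hne
  rcases hv with hv | hv <;> rw [hv] at hd hh
  · linarith [hH b ⟨K.mem_bonds_of_fst hd.1 hd.2, hne⟩]
  · have h1 := hH b ⟨K.mem_bonds_of_tip hd.1 hd.2, hne⟩
    have h2 := (K.abs_lo_sub_le b.tip.toPlane b.1.toPlane).trans (taxi_tip b)
    have h3 := (K.abs_hi_sub_le b.tip.toPlane b.1.toPlane).trans (taxi_tip b)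
    rw [abs_le] at h2 h3
    rw [height] at hh h1
    linarith

theorem tip_eq (b : Bond) : ∃ e : Site, (e = (1, 0) ∨ e = (0, 1)) ∧ b.tip = b.1 + e := by
  obtain ⟨v, c⟩ := b
  cases c
  exacts [⟨_, Or.inl rfl, rfl⟩, ⟨_, Or.inr rfl, rfl⟩]

/-- A cone is connected far out, which is the content of `StepConst.exists_eq`. Both types are
treated alike because plaquettes are labelled by lattice points. -/
theorem oneEnded (k : Charge) : OneEnded k K.bonds := by
  intro f hf
  obtain ⟨H, hH⟩ := K.stepConst_of_cobd hf
  obtain ⟨H₁, hH₁⟩ := K.exists_bound hf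
  have hg : K.StepConst H f := by
    intro v e he h1 h2 h3 h4
    rcases he with rfl | rfl | rfl | rfl
    · exact (hH v _ (Or.inl rfl) h2 h4).symm
    · have hv : v + (-1, 0) + (1, 0) = v := by rw [add_assoc]; simp
      have := hH (v + (-1, 0)) (1, 0) (Or.inl rfl)
      rw [hv] at this
      exact this h1 h3
    · exact (hH v _ (Or.inr rfl) h2 h4).symm
    · have hv : v + (0, -1) + (0, 1) = v := by rw [add_assoc]; simp
      have := hH (v + (0, -1)) (0, 1) (Or.inr rfl)
      rw [hv] at this
      exact this h1 h3
  obtain ⟨a, H₂, ha⟩ := hg.exists_eq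
  -- Above `H + 2` and `H₂ + 2` the estimates apply to the tip as well as to the base, above `H₁`
  -- the bond is not exceptional, and above `4` one of its ends lies in the cone.
  refine ⟨a, (K.finite_height_le (max (max (H + 2) H₁) (max (H₂ + 2) 4))).subset ?_⟩
  rintro b ⟨hb, hne⟩
  refine ⟨hb, ?_⟩
  by_contra hlt
  push Not at hlt
  simp only [max_lt_iff] at hlt
  obtain ⟨⟨g1, g2⟩, g3, g4⟩ := hlt
  refine hne ?_
  have hc : cobd k f b = 0 := by
    by_contra h
    linarith [hH₁ b ⟨hb, h⟩]
  have hfst : f b.1 = a := by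
    rcases K.exists_endpoint hb g4 with h | h
    · exact ha _ h (by linarith)
    · have h2 := (K.abs_lo_sub_le b.tip.toPlane b.1.toPlane).trans (taxi_tip b)
      have h3 := (K.abs_hi_sub_le b.tip.toPlane b.1.toPlane).trans (taxi_tip b)
      rw [abs_le] at h2 h3
      have hht : K.height b.1.toPlane - 2 ≤ K.height b.tip.toPlane := by
        rw [height, height]
        linarith
      have h4 := ha _ h (by linarith)
      obtain ⟨e, he, hbe⟩ := tip_eq b
      have h5 := hH b.1 e he
      rw [← hbe] at h5
      rw [h5 h (by linarith), h4]
  exact ⟨hfst, by rw [← hfst, eq_of_add_eq_zero_zmod hc]⟩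

end Cone

/-! ### Rays -/

/-- The path stays at bounded distance of the ray in direction `u`. -/
def InfPath.Follows {k : Charge} (γ : InfPath k) (u : ℝ × ℝ) : Prop :=
  ∃ c : ℝ, 0 < c ∧ ∃ C : ℝ, ∀ n : ℕ, taxi (γ.site n).toPlane ((n * c) • u) ≤ C

theorem taxi_comm (z w : ℝ × ℝ) : taxi z w = taxi w z := by
  rw [taxi, taxi, abs_sub_comm, abs_sub_comm z.2]

theorem taxi_triangle (x y z : ℝ × ℝ) : taxi x z ≤ taxi x y + taxi y z := by
  have h1 := abs_sub_le x.1 y.1 z.1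
  have h2 := abs_sub_le x.2 y.2 z.2
  simp only [taxi]
  linarith

theorem taxi_bond_site {k : Charge} {b : Bond} {v w : Site} (h : Joins k b v w) :
    taxi b.1.toPlane v.toPlane ≤ 1 := by
  rcases joins_iff.1 h with ⟨rfl, rfl⟩ | ⟨rfl, rfl⟩
  · simp [taxi]
  · rw [taxi_comm]
    obtain ⟨⟨x, y⟩, c⟩ := b
    cases k <;> cases c <;> simp [taxi, Bond.target, Bond.tip, Bond.otherPlaq, Site.toPlane]

theorem tendsto_cofinite_of_tendsto_atTop {s : ℕ → Bond} {φ : Bond → ℝ}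
    (h : Tendsto (fun n => φ (s n)) atTop atTop) : Tendsto s atTop cofinite := by
  rw [Tendsto, le_cofinite_iff_eventually_ne]
  intro b
  rw [eventually_map]
  filter_upwards [h.eventually_gt_atTop (φ b)] with n hn
  rintro rfl
  exact lt_irrefl _ hn

/-- The points of a staircase from `0` to `u`. -/
def stair (u : Site) (r : ℕ) : Site :=
  (u.1.sign * (min r u.1.natAbs : ℕ), u.2.sign * (r - u.1.natAbs : ℕ))

theorem stair_zero (u : Site) : stair u 0 = 0 := by
  simp [stair]

theorem stair_length (u : Site) : stair u (u.1.natAbs + u.2.natAbs) = u := by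
  refine Prod.ext ?_ ?_
  · simp only [stair, min_eq_right (Nat.le_add_right _ _), Int.sign_mul_natAbs]
  · simp only [stair, Nat.add_sub_cancel_left, Int.sign_mul_natAbs]

theorem stair_succ {u : Site} {r : ℕ} (hr : r < u.1.natAbs + u.2.natAbs) :
    IsStep (stair u (r + 1) - stair u r) := by
  obtain ⟨p, q⟩ := u
  simp only [stair, IsStep, Prod.mk_sub_mk, Prod.mk.injEq] at hr ⊢
  rcases lt_or_ge r p.natAbs with h | h
  · have h1 : min (r + 1) p.natAbs = r + 1 := by omega
    have h2 : min r p.natAbs = r := by omega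
    have h3 : r + 1 - p.natAbs = 0 := by omega
    have h4 : r - p.natAbs = 0 := by omega
    rw [h1, h2, h3, h4]
    have hp : p ≠ 0 := by rintro rfl; simp at h
    rcases lt_or_gt_of_ne hp with hp | hp
    · rw [Int.sign_eq_neg_one_of_neg hp]
      right; left
      push_cast
      constructor <;> ring
    · rw [Int.sign_eq_one_of_pos hp]
      left
      push_cast
      constructor <;> ring
  · have h1 : min (r + 1) p.natAbs = p.natAbs := by omega
    have h2 : min r p.natAbs = p.natAbs := by omega
    have h3 : r + 1 - p.natAbs = r - p.natAbs + 1 := by omega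
    rw [h1, h2, h3]
    have hq : q ≠ 0 := by rintro rfl; simp at hr; omega
    rcases lt_or_gt_of_ne hq with hq | hq
    · rw [Int.sign_eq_neg_one_of_neg hq]
      right; right; right
      push_cast
      constructor <;> ring
    · rw [Int.sign_eq_one_of_pos hq]
      right; right; left
      push_cast
      constructor <;> ring

theorem taxi_stair_le (u : Site) {r : ℕ} (hr : r ≤ u.1.natAbs + u.2.natAbs) :
    |((stair u r).1 : ℝ)| + |((stair u r).2 : ℝ)| ≤ (u.1.natAbs + u.2.natAbs : ℕ) := by
  obtain ⟨p, q⟩ := u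
  have hs : ∀ z : ℤ, |(z.sign : ℝ)| ≤ 1 := by
    intro z
    rcases Int.sign_trichotomy z with h | h | h <;> rw [h] <;> simp
  simp only [stair] at hr ⊢
  have h3 : ((min r p.natAbs : ℕ) : ℝ) ≤ (p.natAbs : ℕ) := by exact_mod_cast min_le_right _ _
  have h4 : ((r - p.natAbs : ℕ) : ℝ) ≤ (q.natAbs : ℕ) := by
    have : r - p.natAbs ≤ q.natAbs := by omega
    exact_mod_cast this
  generalize min r p.natAbs = x at *
  generalize r - p.natAbs = y at *
  have h1 := mul_le_mul_of_nonneg_right (hs p) (x.cast_nonneg (α := ℝ))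
  have h2 := mul_le_mul_of_nonneg_right (hs q) (y.cast_nonneg (α := ℝ))
  rw [Int.cast_mul, Int.cast_mul, Int.cast_natCast, Int.cast_natCast, abs_mul, abs_mul,
    Nat.abs_cast, Nat.abs_cast, Nat.cast_add]
  linarith

/-- In every cone there is a path to infinity along a given direction inside the cone, and it may
be chosen to avoid a given finite set. -/
theorem Cone.exists_ray (K : Cone) (k : Charge) {u : Site} (hu : K.Inside u.toPlane) {F : Set Bond}
    (hF : F.Finite) :
    ∃ γ : InfPath k, γ.LiesIn K.bonds ∧ γ.LiesIn Fᶜ ∧ γ.Follows u.toPlane := by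
  set ℓ := u.1.natAbs + u.2.natAbs with hℓ
  have hℓ0 : 0 < ℓ := by
    by_contra h
    refine hu.ne_zero ?_
    ext <;> simp <;> omega
  have hℓ0' : (0 : ℝ) < ℓ := by exact_mod_cast hℓ0
  obtain ⟨H, hH⟩ := (hF.image fun b => K.lo b.1.toPlane).bddAbove
  -- Start so deep that staircases, which deviate by at most `ℓ`, stay in the cone and beyond the
  -- largest value of `lo` on `F`.
  obtain ⟨n₀, hn₀⟩ := (hu.eventually_deep (max (H + 1) 0 + ℓ) K.apex).exists
  set s₀ := K.apex + n₀ • u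
  -- The staircase from `0` to `u` is repeated with period `ℓ`, so the path follows `u` at speed `1
  -- / ℓ`.
  set s : ℕ → Site := fun n => s₀ + (n / ℓ) • u + stair u (n % ℓ) with hs
  have hsucc : ∀ n, s (n + 1) = s₀ + (n / ℓ) • u + stair u (n % ℓ + 1) := by
    intro n
    simp only [hs]
    have hlt := Nat.mod_lt n hℓ0
    rcases Nat.lt_or_ge (n % ℓ + 1) ℓ with h | h
    · have h1 : (n + 1) / ℓ = n / ℓ := by
        rw [Nat.succ_div_of_not_dvd]
        intro hd
        have := Nat.mod_eq_zero_of_dvd hd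
        rw [Nat.add_mod, Nat.mod_eq_of_lt (a := 1 ) (by omega), Nat.mod_eq_of_lt h] at this
        omega
      have h2 : (n + 1) % ℓ = n % ℓ + 1 := by
        rw [Nat.add_mod, Nat.mod_eq_of_lt (a := 1) (by omega), Nat.mod_eq_of_lt h]
      rw [h1, h2]
    · have h0 : n % ℓ + 1 = ℓ := by omega
      have hd : ℓ ∣ n + 1 := by
        have := Nat.div_add_mod n ℓ
        exact ⟨n / ℓ + 1, by rw [mul_add, mul_one]; omega⟩
      rw [Nat.succ_div_of_dvd hd, Nat.mod_eq_zero_of_dvd hd, stair_zero, h0, hℓ, stair_length,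
        ← hℓ, succ_nsmul, add_zero, add_assoc s₀]
  have hstep : ∀ n, ∃ b, Joins k b (s n) (s (n + 1)) ∧ (b.1 = s n ∨ b.1 = s (n + 1)) := by
    intro n
    have h := exists_joins_of_isStep k (s n) (stair_succ (u := u) (Nat.mod_lt n hℓ0))
    have : s n + (stair u (n % ℓ + 1) - stair u (n % ℓ)) = s (n + 1) := by
      rw [hsucc]
      simp only [hs]
      abel
    rwa [this] at h
  choose b hb hbs using hstep
  have hst : ∀ n (φ : ℝ), |side φ (stair u (n % ℓ)).toPlane| ≤ ℓ := fun n φ =>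
    (abs_side_le _ _).trans (taxi_stair_le u (Nat.mod_lt n hℓ0).le)
  have hlo : ∀ n, max (H + 1) 0 + (n / ℓ : ℕ) * side K.direction u.toPlane ≤
      K.lo (s n).toPlane := by
    intro n
    simp only [hs]
    rw [toPlane_add, toPlane_add, toPlane_nsmul, K.lo_add, K.lo_add, side_smul]
    linarith [hn₀.1, (abs_le.1 (hst n K.direction)).1]
  have hhi : ∀ n, 0 ≤ K.hi (s n).toPlane := by
    intro n
    simp only [hs]
    rw [toPlane_add, toPlane_add, toPlane_nsmul, K.hi_add, K.hi_add, side_smul]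
    have h1 : ((n / ℓ : ℕ) : ℝ) * side (K.direction + K.angle) u.toPlane ≤ 0 :=
      mul_nonpos_of_nonneg_of_nonpos (Nat.cast_nonneg _) hu.2.le
    linarith [hn₀.2, (abs_le.1 (hst n (K.direction + K.angle))).2, le_max_right (H + 1) 0]
  have hlo0 : ∀ n, max (H + 1) 0 ≤ K.lo (s n).toPlane := by
    intro n
    have : 0 ≤ ((n / ℓ : ℕ) : ℝ) * side K.direction u.toPlane :=
      mul_nonneg (Nat.cast_nonneg _) hu.1.le
    linarith [hlo n]
  have hdiv : Tendsto (fun n : ℕ => ((n / ℓ : ℕ) : ℝ) * side K.direction u.toPlane) atTop atTop :=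
    (tendsto_natCast_atTop_atTop.comp (Nat.tendsto_div_const_atTop hℓ0.ne')).atTop_mul_const hu.1
  have hinf : Tendsto b atTop cofinite := by
    refine tendsto_cofinite_of_tendsto_atTop (φ := fun b => K.lo b.1.toPlane) ?_
    refine tendsto_atTop_mono (fun n => ?_) (tendsto_atTop_add_const_right atTop
      (max (H + 1) 0 - 1) hdiv)
    have h1 := (K.abs_lo_sub_le (b n).1.toPlane (s n).toPlane).trans (taxi_bond_site (hb n))
    linarith [hlo n, (abs_le.1 h1).1]
  refine ⟨⟨s, b, hb, hinf⟩, fun n => ?_, fun n hn => ?_, 1 / ℓ, by positivity, ?_⟩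
  · change b n ∈ K.bonds
    have hm := le_max_right (H + 1) 0
    rcases hbs n with h | h
    · exact K.mem_bonds_of_fst (by rw [h]; linarith [hlo0 n]) (by rw [h]; exact hhi n)
    · exact K.mem_bonds_of_fst (by rw [h]; linarith [hlo0 (n + 1)]) (by rw [h]; exact hhi _)
  · have h1 : K.lo (b n).1.toPlane ≤ H := hH ⟨b n, hn, rfl⟩
    have hm := le_max_left (H + 1) 0
    rcases hbs n with h | h <;> rw [h] at h1
    · linarith [hlo0 n]
    · linarith [hlo0 (n + 1)]
  · refine ⟨|(s₀.1 : ℝ)| + |(s₀.2 : ℝ)| + ℓ + (|(u.1 : ℝ)| + |(u.2 : ℝ)|), fun n => ?_⟩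
    change taxi (s n).toPlane _ ≤ _
    set r : ℝ := (n / ℓ : ℕ) - n * (1 / ℓ) with hr
    have hr1 : |r| ≤ 1 := by
      have h1 : (n : ℝ) = ℓ * (n / ℓ : ℕ) + (n % ℓ : ℕ) := by exact_mod_cast (Nat.div_add_mod n ℓ).symm
      have h2 : ((n % ℓ : ℕ) : ℝ) ≤ ℓ := by exact_mod_cast (Nat.mod_lt n hℓ0).le
      have h3 : r = -((n % ℓ : ℕ) / ℓ) := by
        rw [hr, h1]
        field_simp
        ring
      rw [h3, abs_neg, abs_of_nonneg (by positivity), div_le_one hℓ0']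
      exact h2
    have e1 : (s n).toPlane.1 - ((n * (1 / ℓ) : ℝ) • u.toPlane).1 =
        s₀.1 + (stair u (n % ℓ)).1 + r * u.1 := by
      simp only [hs, hr, Site.toPlane, Prod.smul_mk, smul_eq_mul, Prod.fst_add, Prod.smul_fst]
      simp only [nsmul_eq_mul, Int.cast_add, Int.cast_mul, Int.cast_natCast]
      ring
    have e2 : (s n).toPlane.2 - ((n * (1 / ℓ) : ℝ) • u.toPlane).2 =
        s₀.2 + (stair u (n % ℓ)).2 + r * u.2 := by
      simp only [hs, hr, Site.toPlane, Prod.smul_mk, smul_eq_mul, Prod.snd_add, Prod.smul_snd]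
      simp only [nsmul_eq_mul, Int.cast_add, Int.cast_mul, Int.cast_natCast]
      ring
    have b1 : ∀ x y z : ℝ, |x + y + r * z| ≤ |x| + |y| + |z| := by
      intro x y z
      refine (abs_add_three _ _ _).trans ?_
      rw [abs_mul]
      have := mul_le_of_le_one_left (abs_nonneg z) hr1
      linarith
    have h3 := taxi_stair_le u (Nat.mod_lt n hℓ0).le
    rw [taxi, e1, e2]
    linarith [b1 s₀.1 (stair u (n % ℓ)).1 u.1, b1 s₀.2 (stair u (n % ℓ)).2 u.2]

theorem InfPath.Follows.abs_side_le {k : Charge} {γ : InfPath k} {u : ℝ × ℝ} (h : γ.Follows u) :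
    ∃ c : ℝ, 0 < c ∧ ∃ C : ℝ, ∀ (n : ℕ) (φ : ℝ),
      |side φ (γ.bond n).1.toPlane - n * c * side φ u| ≤ C := by
  obtain ⟨c, hc, C, hC⟩ := h
  refine ⟨c, hc, 1 + C, fun n φ => ?_⟩
  rw [← side_smul, ← side_sub]
  refine (ToricCode.abs_side_le _ _).trans ?_
  exact (taxi_triangle _ _ _).trans (add_le_add (taxi_bond_site (γ.joins n)) (hC n))

/-- A path whose direction points out of a cone eventually leaves the cone. -/
theorem InfPath.Follows.finite_range {k : Charge} {γ : InfPath k} {u : ℝ × ℝ} (h : γ.Follows u)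
    (K : Cone) (hu : side K.direction u < 0 ∨ 0 < side (K.direction + K.angle) u) :
    (K.bonds ∩ Set.range γ.bond).Finite := by
  obtain ⟨c, hc, C, hC⟩ := h.abs_side_le
  have hev : ∀ᶠ n in atTop, γ.bond n ∉ K.bonds := by
    rcases hu with hu | hu
    · have ht : Tendsto (fun n : ℕ => (n : ℝ) * -(c * side K.direction u)) atTop atTop :=
        tendsto_natCast_atTop_atTop.atTop_mul_const (by nlinarith)
      filter_upwards [ht.eventually_gt_atTop (C + 1 - side K.direction K.apex.toPlane)]
        with n hn hb
      have h1 := (K.neg_one_le_of_mem_bonds hb).1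
      rw [Cone.lo, side_sub] at h1
      linarith [(abs_le.1 (hC n K.direction)).2]
    · have ht : Tendsto (fun n : ℕ => (n : ℝ) * (c * side (K.direction + K.angle) u)) atTop atTop :=
        tendsto_natCast_atTop_atTop.atTop_mul_const (mul_pos hc hu)
      filter_upwards [ht.eventually_gt_atTop
        (C + 1 + side (K.direction + K.angle) K.apex.toPlane)] with n hn hb
      have h1 := (K.neg_one_le_of_mem_bonds hb).2
      rw [Cone.hi, side_sub] at h1
      linarith [(abs_le.1 (hC n (K.direction + K.angle))).1]
  obtain ⟨N, hN⟩ := eventually_atTop.1 hev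
  refine ((Finset.range N).image γ.bond).finite_toSet.subset ?_
  rintro _ ⟨hb, n, rfl⟩
  simp only [Finset.coe_image, Set.mem_image, Finset.mem_coe, Finset.mem_range]
  refine ⟨n, ?_, rfl⟩
  by_contra hlt
  exact hN n (not_lt.1 hlt) hb

theorem InfPath.parity_ne_zero_subset {k : Charge} (γ : InfPath k) (B : Set Bond) :
    {b ∈ B | γ.parity b ≠ 0} ⊆ B ∩ Set.range γ.bond := by
  rintro b ⟨hb, hp⟩
  refine ⟨hb, ?_⟩
  by_contra h
  exact hp (InfPath.LiesIn.parity_eq_zero (L := Set.range γ.bond) (fun n => ⟨n, rfl⟩) h)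

/-! ### Translating and rotating cones -/

namespace Cone

variable (K : Cone)

theorem translate_lo (x : Site) (z : ℝ × ℝ) :
    (K.translate x).lo z = K.lo z - side K.direction x.toPlane := by
  simp only [lo, translate, toPlane_add, side_sub, side_add]
  ring

theorem translate_hi (x : Site) (z : ℝ × ℝ) :
    (K.translate x).hi z = K.hi z + side (K.direction + K.angle) x.toPlane := by
  simp only [hi, translate, toPlane_add, side_sub, side_add]
  ring

theorem translate_bonds_subset {x y : Site} (h1 : side K.direction x.toPlane ≤
    side K.direction y.toPlane) (h2 : side (K.direction + K.angle) y.toPlane ≤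
    side (K.direction + K.angle) x.toPlane) :
    (K.translate y).bonds ⊆ (K.translate x).bonds := by
  intro b hb
  rw [mem_bonds_iff] at hb ⊢
  obtain ⟨z, hz, hz1, hz2⟩ := hb
  simp only [translate_lo, translate_hi] at hz1 hz2 ⊢
  exact ⟨z, hz, by linarith, by linarith⟩

-- Translating by a vector strictly inside the cone pushes both boundary lines inwards by fixed
-- positive amounts, eventually past any other translate and past any bond.
variable {K} in
theorem Inside.exhausts {u : Site} (hu : K.Inside u.toPlane) (x : Site) :
    Exhausts K fun j => x + j • u := by
  refine ⟨fun i j hij => ?_, fun y => ?_, fun b => ?_⟩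
  · have : (i : ℝ) ≤ j := by exact_mod_cast hij
    refine K.translate_bonds_subset ?_ ?_ <;>
      rw [toPlane_add, toPlane_add, toPlane_nsmul, toPlane_nsmul, side_add, side_add, side_smul,
        side_smul]
    · nlinarith [hu.1]
    · nlinarith [hu.2]
  · have h1 : Tendsto (fun n : ℕ => (n : ℝ) * side K.direction u.toPlane) atTop atTop :=
      tendsto_natCast_atTop_atTop.atTop_mul_const hu.1
    have h2 : Tendsto (fun n : ℕ => (n : ℝ) * -side (K.direction + K.angle) u.toPlane)
        atTop atTop := tendsto_natCast_atTop_atTop.atTop_mul_const (neg_pos.2 hu.2)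
    obtain ⟨j, hj1, hj2⟩ := ((h1.eventually_ge_atTop
      (side K.direction y.toPlane - side K.direction x.toPlane)).and
      (h2.eventually_ge_atTop (side (K.direction + K.angle) x.toPlane -
        side (K.direction + K.angle) y.toPlane))).exists
    refine ⟨j, K.translate_bonds_subset ?_ ?_⟩ <;>
      rw [toPlane_add, toPlane_nsmul, side_add, side_smul] <;> linarith
  · have h1 : Tendsto (fun n : ℕ => (n : ℝ) * side K.direction u.toPlane) atTop atTop :=
      tendsto_natCast_atTop_atTop.atTop_mul_const hu.1
    obtain ⟨j, hj⟩ := (h1.eventually_gt_atTop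
      (K.lo b.1.toPlane - side K.direction x.toPlane + 1)).exists
    refine ⟨j, fun hb => ?_⟩
    have := ((K.translate (x + j • u)).neg_one_le_of_mem_bonds hb).1
    rw [translate_lo, toPlane_add, toPlane_nsmul, side_add, side_smul] at this
    linarith

/-- Two translates of a cone contain a common translate. -/
theorem exists_translate_subset (x y : Site) : ∃ z, (K.translate z).bonds ⊆ (K.translate x).bonds ∧
    (K.translate z).bonds ⊆ (K.translate y).bonds := by
  obtain ⟨u, hu⟩ := K.exists_inside
  obtain ⟨j, hj⟩ := (hu.exhausts x).cofinal y
  refine ⟨_, ?_, hj⟩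
  simpa using (hu.exhausts x).antitone (Nat.zero_le j)

variable {K} {K' : Cone}

/-- A large multiple of `z` can be rounded to a lattice vector inside both cones, and far multiples
of this vector lie in both, wherever the apices are. Overlap at infinity is decided by directions
alone. -/
theorem infinite_inter {z : ℝ × ℝ} (h : K.Inside z) (h' : K'.Inside z) :
    (K.bonds ∩ K'.bonds).Infinite := by
  obtain ⟨n, hn, hn'⟩ := (h.eventually_round.and h'.eventually_round).exists
  set u : Site := (round (n * z.1), round (n * z.2))
  intro hfin
  obtain ⟨N, hN⟩ := eventually_atTop.1 ((hn.eventually_deep 0 0).and (hn'.eventually_deep 0 0))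
  have hinj : Function.Injective fun i : ℕ => ((0 + (N + i) • u, false) : Bond) := by
    intro i j hij
    simp only [Prod.mk.injEq, and_true, zero_add] at hij
    have h1 := congrArg (fun v : Site => side K.direction v.toPlane) hij
    simp only [toPlane_nsmul, side_smul] at h1
    have h2 := mul_right_cancel₀ hn.1.ne' h1
    have h3 : N + i = N + j := by exact_mod_cast h2
    omega
  refine Set.infinite_of_injective_forall_mem hinj (fun i => ?_) hfin
  obtain ⟨h1, h2⟩ := hN (N + i) (by omega)
  exact ⟨K.mem_bonds_of_fst h1.1 h1.2, K'.mem_bonds_of_fst h2.1 h2.2⟩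

end Cone

/-! ### Comparing values at infinity -/

theorem EndValue.eq_of_infinite {k : Charge} {B B' : Set Bond} {f : Site → ZMod 2} {a a' : ZMod 2}
    (h : EndValue k B f a) (h' : EndValue k B' f a') (hB : (B ∩ B').Infinite) : a = a' := by
  obtain ⟨b, hb, hn⟩ := (hB.sdiff (h.union h')).nonempty
  simp only [Set.mem_union, not_or] at hn
  have h1 : f b.1 = a := by
    by_contra hne
    exact hn.1 ⟨hb.1, fun hc => hne hc.1⟩
  have h2 : f b.1 = a' := by
    by_contra hne
    exact hn.2 ⟨hb.2, fun hc => hne hc.1⟩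
  rw [← h1, h2]

namespace Cone

variable {k : Charge} {f : Site → ZMod 2} {a a' : ZMod 2}

theorem eq_of_inside {K K' : Cone} {z : ℝ × ℝ} (h : K.Inside z) (h' : K'.Inside z)
    (hf : EndValue k K.bonds f a) (hf' : EndValue k K'.bonds f a') : a = a' :=
  hf.eq_of_infinite hf' (infinite_inter h h')

theorem rotate_rotate (K : Cone) (s t : ℝ) : (K.rotate s).rotate t = K.rotate (s + t) := by
  simp [rotate, add_assoc]

/-- The value at infinity does not change under rotations, as long as the rotated cones contain
only finitely many bonds across which the function changes. -/
theorem eq_of_rotate {T : ℝ} (hT : 0 ≤ T) : ∀ {K : Cone},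
    (∀ t ∈ Set.Icc 0 T, {b ∈ (K.rotate t).bonds | cobd k f b ≠ 0}.Finite) →
    EndValue k K.bonds f a → EndValue k (K.rotate T).bonds f a' → a = a' := by
  -- Cut the rotation into pieces of at most half the angle, so that consecutive cones have the
  -- direction at `3 / 4` of the angle in common.
  suffices H : ∀ n : ℕ, ∀ (K : Cone) (T : ℝ), 0 ≤ T → T ≤ n * (K.angle / 2) →
      (∀ t ∈ Set.Icc 0 T, {b ∈ (K.rotate t).bonds | cobd k f b ≠ 0}.Finite) → ∀ a a',
      EndValue k K.bonds f a → EndValue k (K.rotate T).bonds f a' → a = a' by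
    intro K hbad h h'
    obtain ⟨n, hn⟩ := exists_nat_ge (T / (K.angle / 2))
    rw [div_le_iff₀ (by linarith [K.angle_pos])] at hn
    exact H n K T hT hn hbad _ _ h h'
  have base : ∀ (K : Cone) (T : ℝ), 0 ≤ T → T ≤ K.angle / 2 → ∀ a a',
      EndValue k K.bonds f a → EndValue k (K.rotate T).bonds f a' → a = a' := by
    intro K T h0 h1 a a' h h'
    have hp := K.angle_pos
    exact eq_of_inside (z := unitVec (K.direction + 3 / 4 * K.angle))
      (K.inside_unitVec (by linarith) (by linarith))
      ((K.rotate T).inside_unitVec (by simp only [rotate]; linarith)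
        (by simp only [rotate]; linarith)) h h'
  intro n
  induction n with
  | zero =>
    intro K T h0 h1 hbad a a' h h'
    have hp := K.angle_pos
    exact base K T h0 (by simp at h1; linarith) a a' h h'
  | succ n ih =>
    intro K T h0 h1 hbad a a' h h'
    have hp := K.angle_pos
    rcases le_total T (K.angle / 2) with hle | hle
    · exact base K T h0 hle a a' h h'
    · obtain ⟨c, hc⟩ := (K.rotate (K.angle / 2)).oneEnded k f
        (hbad _ ⟨by linarith, hle⟩)
      refine (base K _ (by linarith) le_rfl a c h hc).trans ?_
      refine ih (K.rotate (K.angle / 2)) (T - K.angle / 2) (by linarith) ?_ (fun t ht => ?_) c a' hc ?_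
      · push_cast at h1
        change _ ≤ n * (K.angle / 2)
        linarith
      · rw [rotate_rotate]
        exact hbad _ ⟨by linarith [ht.1], by linarith [ht.2]⟩
      · rw [rotate_rotate, add_sub_cancel]
        exact h'

/-- All cones in a sector have the same value at infinity. -/
theorem eq_of_sector {p q : ℝ} (hbad : ∀ K : Cone, p < K.direction → K.direction + K.angle < q →
      {b ∈ K.bonds | cobd k f b ≠ 0}.Finite) {K K' : Cone} (h1 : p < K.direction)
    (h2 : K.direction + K.angle < q) (h1' : p < K'.direction) (h2' : K'.direction + K'.angle < q)
    (hf : EndValue k K.bonds f a) (hf' : EndValue k K'.bonds f a') : a = a' := by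
  wlog hle : K.direction ≤ K'.direction generalizing K K' a a'
  · exact (this h1' h2' h1 h2 hf' hf (le_of_not_ge hle)).symm
  have hp := K.angle_pos
  have hp' := K'.angle_pos
  -- With the smaller of the two angles, `J` can be turned from the first ray of `K` to that of `K'`
  -- without leaving the sector.
  set J : Cone := ⟨K.apex, K.direction, min K.angle K'.angle, lt_min hp hp',
    (min_le_left _ _).trans_lt K.angle_lt_pi⟩ with hJ
  have hJp : 0 < min K.angle K'.angle := J.angle_pos
  have hl := min_le_left K.angle K'.angle
  have hr := min_le_right K.angle K'.angle
  have hJ0 : {b ∈ J.bonds | cobd k f b ≠ 0}.Finite :=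
    hbad J h1 (by change K.direction + min K.angle K'.angle < q; linarith)
  obtain ⟨c, hc⟩ := J.oneEnded k f hJ0
  have hrot : ∀ t ∈ Set.Icc 0 (K'.direction - K.direction),
      {b ∈ (J.rotate t).bonds | cobd k f b ≠ 0}.Finite := fun t ht =>
    hbad _ (by change p < K.direction + t; linarith [ht.1]) (by
      change K.direction + t + min K.angle K'.angle < q
      linarith [ht.2])
  obtain ⟨c', hc'⟩ := (J.rotate (K'.direction - K.direction)).oneEnded k f
    (hrot _ ⟨by linarith, le_rfl⟩)
  have e1 : a = c := eq_of_inside (z := unitVec (K.direction + min K.angle K'.angle / 2))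
    (K.inside_unitVec (by linarith) (by linarith))
    (J.inside_unitVec (by change K.direction < _; linarith)
      (by change _ < K.direction + min K.angle K'.angle; linarith)) hf hc
  have e2 : c = c' := eq_of_rotate (by linarith) hrot hc hc'
  have e3 : c' = a' := eq_of_inside (z := unitVec (K'.direction + min K.angle K'.angle / 2))
    ((J.rotate _).inside_unitVec (by change K.direction + _ < _; linarith)
      (by change _ < K.direction + _ + min K.angle K'.angle; linarith))
    (K'.inside_unitVec (by linarith) (by linarith)) hc' hf'
  rw [e1, e2, e3]

/-- The same cone, with its direction shifted by a multiple of `2π`. -/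
def shift (K : Cone) (m : ℤ) : Cone := K.rotate (m * (2 * Real.pi))

theorem shift_bonds (K : Cone) (m : ℤ) : (K.shift m).bonds = K.bonds := by
  ext b
  have h1 : ∀ z, (K.shift m).lo z = K.lo z := fun z => by
    simp only [lo, shift, rotate, side_add_int_mul_two_pi]
  have h2 : ∀ z, (K.shift m).hi z = K.hi z := fun z => by
    simp only [hi, shift, rotate]
    rw [add_right_comm, side_add_int_mul_two_pi]
  simp only [mem_bonds_iff, h1, h2]

end Cone

/-- A path in a direction that is not in the cone. -/
theorem InfPath.Follows.finite_range_of_angle {k : Charge} {γ : InfPath k} {φ r : ℝ}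
    (h : γ.Follows (r • unitVec φ)) (hr : 0 < r) (K : Cone) (h1 : K.direction + K.angle < φ)
    (h2 : φ < K.direction + 2 * Real.pi) : (K.bonds ∩ Set.range γ.bond).Finite := by
  refine h.finite_range K ?_
  rw [side_smul, side_smul, side_unitVec, side_unitVec]
  have hp := K.angle_pos
  have hp' := K.angle_lt_pi
  rcases lt_or_ge φ (K.direction + K.angle + Real.pi) with hlt | hge
  · exact Or.inr (mul_pos hr (Real.sin_pos_of_pos_of_lt_pi (by linarith) (by linarith)))
  · left
    have : Real.sin (φ - K.direction - 2 * Real.pi) < 0 :=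
      Real.sin_neg_of_neg_of_neg_pi_lt (by linarith) (by linarith)
    rw [Real.sin_sub_two_pi] at this
    exact mul_neg_of_pos_of_neg hr this

/-! ### The position of the cones around the forbidden cone -/

namespace Cone

theorem lo_apex_add (K : Cone) (v : Site) :
    K.lo (Site.toPlane (K.apex + v)) = side K.direction v.toPlane := by
  rw [lo, toPlane_add, add_sub_cancel_left]

theorem hi_apex_add (K : Cone) (v : Site) :
    K.hi (Site.toPlane (K.apex + v)) = -side (K.direction + K.angle) v.toPlane := by
  rw [hi, toPlane_add, add_sub_cancel_left]

theorem bonds_subset {K K' : Cone} (h : K.apex = K'.apex) (h1 : K'.direction ≤ K.direction)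
    (h2 : K.direction + K.angle ≤ K'.direction + K'.angle) : K.bonds ⊆ K'.bonds := by
  rintro b ⟨z, hz, r, hr, t, ht, rfl⟩
  exact ⟨_, hz, r, hr, t, ⟨h1.trans ht.1, ht.2.trans h2⟩, by rw [h]⟩

/-- The directions of disjoint cones are disjoint. -/
theorem exists_angle_of_disjoint {K K' : Cone} (h : (K.bonds ∩ K'.bonds).Finite) :
    ∃ m : ℤ, K.direction + K.angle ≤ K'.direction + m * (2 * Real.pi) ∧
      K'.direction + m * (2 * Real.pi) + K'.angle ≤ K.direction + 2 * Real.pi := by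
  -- Normalise the first ray of `K'` to lie within one turn after that of `K`; a common interior
  -- direction would then give infinitely many common bonds.
  obtain ⟨m, hm, -⟩ := existsUnique_add_zsmul_mem_Ico Real.two_pi_pos K'.direction K.direction
  simp only [zsmul_eq_mul, Set.mem_Ico] at hm
  have hp := K.angle_pos
  have hp' := K'.angle_pos
  have key : ∀ (n : ℤ) (φ : ℝ), K.direction + n * (2 * Real.pi) < φ →
      φ < K.direction + n * (2 * Real.pi) + K.angle → K'.direction + m * (2 * Real.pi) < φ →
      φ < K'.direction + m * (2 * Real.pi) + K'.angle → False := fun n φ h1 h2 h3 h4 =>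
    infinite_inter (K.inside_unitVec_mod n h1 h2) (K'.inside_unitVec_mod m h3 h4) h
  refine ⟨m, ?_, ?_⟩
  · by_contra hlt
    push Not at hlt
    obtain ⟨φ, h1, h2⟩ := exists_between (lt_min hlt
      (by linarith : K'.direction + m * (2 * Real.pi) < K'.direction + m * (2 * Real.pi) + K'.angle))
    rw [lt_min_iff] at h2
    exact key 0 φ (by push_cast; linarith) (by push_cast; linarith) h1 h2.2
  · by_contra hlt
    push Not at hlt
    obtain ⟨φ, h1, h2⟩ := exists_between (lt_min hlt
      (by linarith : K.direction + 2 * Real.pi < K.direction + 2 * Real.pi + K.angle))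
    rw [lt_min_iff] at h2
    exact key 1 φ (by push_cast; linarith) (by push_cast; linarith) (by linarith) h2.1

end Cone

/-- The cones `M`, `La`, `L` lie in this order around the circle, and `M` can be rotated beyond the
first boundary ray of `La` without meeting `L`. -/
theorem Before.exists_angles {La M L : Cone} (h : Before La M L) :
    ∃ m m' : ℤ, M.direction + M.angle ≤ La.direction + m * (2 * Real.pi) ∧
      La.direction + m * (2 * Real.pi) + La.angle ≤ L.direction + m' * (2 * Real.pi) ∧
      L.direction + m' * (2 * Real.pi) + L.angle ≤ M.direction + 2 * Real.pi ∧
      ∃ θ, La.direction + m * (2 * Real.pi) - M.direction - M.angle < θ ∧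
        ∀ t ∈ Set.Icc 0 θ, Disjoint (M.rotate t).bonds L.bonds := by
  obtain ⟨hML, x, hM, hL, hrot⟩ := h
  obtain ⟨m, hm1, hm2⟩ := Cone.exists_angle_of_disjoint (K := M) (K' := La.translate x)
    (by rw [hM.inter_eq]; exact Set.finite_empty)
  change _ ≤ La.direction + _ at hm1
  change La.direction + _ + La.angle ≤ _ at hm2
  set l := La.direction + m * (2 * Real.pi) with hl
  have hp := M.angle_pos
  have hpa := La.angle_pos
  have hpl := L.angle_pos
  have hrot' : ∃ θ, l - M.direction - M.angle < θ ∧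
      ∀ t ∈ Set.Icc 0 θ, Disjoint (M.rotate t).bonds L.bonds := by
    obtain ⟨u, hu⟩ := La.exists_inside
    set w := M.apex.toPlane
    -- Move the translate so far that its bonds, seen from the apex of `M`, lie in directions
    -- strictly between the rays of `La`. Of the `3`, one unit is for the base of a bond, one for
    -- the point on it, one for strictness.
    obtain ⟨n, hn⟩ := (hu.eventually_deep (|La.lo w| + |La.hi w| + 3)
      (La.apex + x)).exists
    have hsub : (La.translate (x + n • u)).bonds ⊆ (La.translate x).bonds := by
      simpa using (hu.exhausts x).antitone (Nat.zero_le n)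
    obtain ⟨θ, h0, hmeet, hdis⟩ := hrot _ hsub
    refine ⟨θ, ?_, hdis⟩
    by_contra hle
    push Not at hle
    obtain ⟨b, hb1, hb2⟩ := Set.not_disjoint_iff.1 hmeet
    obtain ⟨z, hz, r, hr, t, ht, hzt⟩ := hb1
    have hzw : z - w = r • unitVec t := by
      rw [hzt]
      ext <;> simp [w, unitVec, Cone.rotate, Site.toPlane]
    obtain ⟨g1, g2⟩ := (La.translate (x + n • u)).neg_one_le_of_mem_bonds hb2
    rw [La.translate_lo] at g1
    rw [La.translate_hi] at g2
    obtain ⟨g3, g4⟩ := hn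
    rw [add_assoc La.apex, La.lo_apex_add] at g3
    rw [add_assoc La.apex, La.hi_apex_add] at g4
    have g5 := abs_le.1 ((La.abs_lo_sub_le z b.1.toPlane).trans (taxi_segment hz))
    have g6 := abs_le.1 ((La.abs_hi_sub_le z b.1.toPlane).trans (taxi_segment hz))
    have g7 := La.lo_sub z w
    have g8 := La.hi_sub z w
    have g9 := le_abs_self (La.lo w)
    have g10 := le_abs_self (La.hi w)
    have g11 := abs_nonneg (La.lo w)
    have g12 := abs_nonneg (La.hi w)
    have i1 : 0 < side La.direction (z - w) := by linarith
    have i2 : side (La.direction + La.angle) (z - w) < 0 := by linarith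
    rw [← side_add_int_mul_two_pi _ m, hzw, side_smul, side_unitVec] at i1 i2
    rw [add_right_comm] at i2
    have i3 : 0 < Real.sin (t - l) := by
      by_contra hle
      exact absurd (mul_nonpos_of_nonneg_of_nonpos hr (not_lt.1 hle)) (not_le.2 i1)
    have i4 : Real.sin (t - (l + La.angle)) < 0 := by
      by_contra hge
      exact absurd (mul_nonneg hr (not_lt.1 hge)) (not_le.2 i2)
    obtain ⟨ht1, ht2⟩ := ht
    change M.direction + θ ≤ t at ht1
    change t ≤ M.direction + θ + M.angle at ht2
    rcases le_total (-Real.pi) (t - l) with hc | hc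
    · exact absurd (Real.sin_nonpos_of_nonpos_of_neg_pi_le (by linarith) hc) (not_le.2 i3)
    · have := Real.sin_nonneg_of_nonneg_of_le_pi (x := t - (l + La.angle) + 2 * Real.pi)
        (by linarith) (by linarith)
      rw [Real.sin_add_two_pi] at this
      linarith
  refine ⟨m, ?_⟩
  obtain ⟨m', h1, h2⟩ := Cone.exists_angle_of_disjoint (K := (La.translate x).shift m) (K' := L)
    (by rw [Cone.shift_bonds, hL.symm.inter_eq]; exact Set.finite_empty)
  change l + La.angle ≤ _ at h1
  change _ ≤ l + 2 * Real.pi at h2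
  refine ⟨m', hm1, h1, ?_, hrot'⟩
  -- If `L` reached past the first ray of `M` after a full turn, `M` would meet a direction of `L`
  -- on its way to `La`, against disjointness during the rotation.
  obtain ⟨θ, hθ, hdis⟩ := hrot'
  by_contra hlt
  push Not at hlt
  obtain ⟨φ, hφ1, hφ2⟩ := exists_between (max_lt hlt
    (by linarith : L.direction + m' * (2 * Real.pi) < L.direction + m' * (2 * Real.pi) + L.angle))
  rw [max_lt_iff] at hφ1
  set ε := min (M.angle / 2) (θ - (l - M.direction - M.angle)) with hε
  have hε0 : 0 < ε := lt_min (by linarith) (by linarith)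
  have hε1 : ε ≤ M.angle / 2 := min_le_left _ _
  have hε2 : ε ≤ θ - (l - M.direction - M.angle) := min_le_right _ _
  set t := max 0 (φ - 2 * Real.pi - M.direction - M.angle + ε) with ht
  have ht1 : t ≤ θ := max_le (by linarith) (by linarith)
  have hins : (M.rotate t).Inside (unitVec φ) := by
    refine (M.rotate t).inside_unitVec_mod 1 ?_ ?_
    · change M.direction + t + _ < _
      rcases max_choice 0 (φ - 2 * Real.pi - M.direction - M.angle + ε) with h | h <;>
        rw [← ht] at h <;> rw [h] <;> push_cast <;> linarith
    · change _ < M.direction + t + _ + M.angle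
      have := le_max_right 0 (φ - 2 * Real.pi - M.direction - M.angle + ε)
      rw [← ht] at this
      push_cast
      linarith
  refine Cone.infinite_inter hins (L.inside_unitVec_mod m' hφ1.2 hφ2) ?_
  rw [(hdis t ⟨le_max_left _ _, ht1⟩).inter_eq]
  exact Set.finite_empty

/-- If the directions of `La` follow those of `M`, an end value of a function that jumps only at a
path inside `La` and at the bonds of `L` can be moved from `M` to the part of `La` to the right of
the path. -/
theorem Before.endValue_eq {La M L : Cone} (h : Before La M L) {k k' : Charge} {δ : InfPath k'}
    {r w : ℝ} (hr : 0 < r) (hw : 0 < w) (hw' : 2 * w < La.angle)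
    (hδ : δ.Follows (r • unitVec (La.direction + 2 * w))) {f : Site → ZMod 2} {S : Bond → ZMod 2}
    {e : Chain} (hf : cobd k f = S + δ.parity + e) (hS : ∀ b ∉ L.bonds, S b = 0) {J : Cone}
    (hJ : J.direction = La.direction) (hJw : J.angle = w) {a a' : ZMod 2}
    (hM : EndValue k M.bonds f a) (hJa : EndValue k J.bonds f a') : a = a' := by
  obtain ⟨m, m', h1, h2, h3, θ, hθ, hdis⟩ := h.exists_angles
  set l := La.direction + m * (2 * Real.pi) with hl
  have hp := M.angle_pos
  have hpl := L.angle_pos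
  -- Turn `M` past the first ray of `La` by a positive amount, small enough to stay before the
  -- direction `2 * w` of the path and within the rotation that avoids `L`.
  set ε := min (min (M.angle / 2) w) (θ - (l - M.direction - M.angle)) with hε
  have hε0 : 0 < ε := lt_min (lt_min (by linarith) hw) (by linarith)
  have hε1 : ε ≤ M.angle / 2 := (min_le_left _ _).trans (min_le_left _ _)
  have hε2 : ε ≤ w := (min_le_left _ _).trans (min_le_right _ _)
  have hε3 : ε ≤ θ - (l - M.direction - M.angle) := min_le_right _ _
  set T := l - M.direction - M.angle + ε with hT
  have hδ' : δ.Follows (r • unitVec (l + 2 * w)) := by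
    have : unitVec (l + 2 * w) = unitVec (La.direction + 2 * w) := by
      rw [hl, add_right_comm]
      simp only [unitVec, Real.cos_add_int_mul_two_pi, Real.sin_add_int_mul_two_pi]
    rwa [this]
  have hbad : ∀ t ∈ Set.Icc 0 T, {b ∈ (M.rotate t).bonds | cobd k f b ≠ 0}.Finite := by
    intro t ht
    refine ((hδ'.finite_range_of_angle hr (M.rotate t) ?_ ?_).union (finite_chain_ne_zero e)).subset
      ?_
    · change M.direction + t + M.angle < _
      linarith [ht.2]
    · change _ < M.direction + t + _
      linarith [ht.1]
    · rintro b ⟨hb, hne⟩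
      by_contra hcon
      simp only [Set.mem_union, not_or] at hcon
      refine hne ?_
      have hbL : b ∉ L.bonds := Set.disjoint_left.1 (hdis t ⟨ht.1, ht.2.trans (by linarith)⟩) hb
      have hd : δ.parity b = 0 := by
        by_contra hd
        exact hcon.1 (δ.parity_ne_zero_subset _ ⟨hb, hd⟩)
      have he : e b = 0 := by
        by_contra he
        exact hcon.2 he
      rw [hf]
      simp [hS b hbL, hd, he]
  have hT0 : 0 ≤ T := by linarith
  obtain ⟨c, hc⟩ := (M.rotate T).oneEnded k f (hbad T ⟨hT0, le_rfl⟩)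
  refine (Cone.eq_of_rotate hT0 hbad hM hc).trans ?_
  refine Cone.eq_of_inside (z := unitVec (l + ε / 2)) ((M.rotate T).inside_unitVec ?_ ?_)
    (J.inside_unitVec_mod m ?_ ?_) hc hJa
  · change M.direction + T < _
    linarith
  · change _ < M.direction + T + M.angle
    linarith
  · rw [hJ]
    linarith
  · rw [hJ, hJw]
    linarith

/-! ### Crossing a ray -/

/-- The vertical chain of `n` bonds from `(x, y)` to `(x, y + n)`. -/
def column (x y : ℤ) (n : ℕ) : Chain :=
  ∑ i ∈ Finset.range n, Finsupp.single (((x, y + i), true) : Bond) (1 : ZMod 2)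

theorem column_succ (x y : ℤ) (n : ℕ) :
    column x y (n + 1) = column x y n + Finsupp.single (((x, y + n), true) : Bond) 1 :=
  Finset.sum_range_succ _ _

theorem bd_column (x y : ℤ) (n : ℕ) :
    bd .Z (column x y n) = Finsupp.single (x, y) 1 + Finsupp.single (x, y + n) 1 := by
  induction n with
  | zero => simp [column, add_self_finsupp]
  | succ n ih =>
    have hj : Joins .Z (((x, y + n), true) : Bond) (x, y + n) (x, y + (n + 1 : ℕ)) :=
      Or.inl ⟨rfl, by simp [Bond.tip, add_assoc]⟩
    rw [column_succ, map_add, ih, hj.bd_single, add_assoc, ← add_assoc (Finsupp.single (x, y + n) 1),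
      add_self_finsupp, zero_add]

theorem column_apply (x y : ℤ) (n : ℕ) (b : Bond) : column x y n b =
    if b.2 = true ∧ b.1.1 = x ∧ y ≤ b.1.2 ∧ b.1.2 < y + n then 1 else 0 := by
  induction n with
  | zero =>
    rw [if_neg (by push_cast; omega)]
    simp [column]
  | succ n ih =>
    rw [column_succ, Finsupp.add_apply, ih, Finsupp.single_apply]
    obtain ⟨⟨p, q⟩, c⟩ := b
    simp only [Prod.mk.injEq]
    by_cases h1 : c = true ∧ p = x ∧ y ≤ q ∧ q < y + n
    · rw [if_pos h1, if_neg (by omega), if_pos (by push_cast; exact ⟨h1.1, h1.2.1, by omega, by omega⟩),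
        add_zero]
    · rw [if_neg h1, zero_add]
      by_cases h2 : (x = p ∧ y + n = q) ∧ true = c
      · rw [if_pos h2, if_pos (by push_cast; exact ⟨h2.2.symm, h2.1.1.symm, by omega, by omega⟩)]
      · rw [if_neg h2, if_neg]
        rintro ⟨g1, g2, g3, g4⟩
        push_cast at g4
        by_cases h3 : q < y + n
        · exact h1 ⟨g1, g2, g3, h3⟩
        · exact h2 ⟨⟨g2.symm, by omega⟩, g1.symm⟩

/-- The indicator function of the half plane to the right of the column `x`. -/
def rightOf (x : ℤ) (v : Site) : ZMod 2 := if x ≤ v.1 then 1 else 0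

theorem cobd_rightOf (x : ℤ) (b : Bond) :
    cobd .X (rightOf x) b = if b.2 = true ∧ b.1.1 = x then 1 else 0 := by
  obtain ⟨⟨p, q⟩, c⟩ := b
  cases c
  · simp [cobd, rightOf, Bond.target, Bond.otherPlaq, CharTwo.add_self_eq_zero]
  · simp only [cobd, rightOf, Bond.target, Bond.otherPlaq, if_true, Prod.fst_sub, true_and]
    rcases lt_trichotomy x p with h | h | h
    · rw [if_pos (by omega), if_pos (by omega), if_neg (by omega)]
      rfl
    · rw [if_pos (by omega), if_neg (by omega), if_pos (by omega)]
      rfl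
    · rw [if_neg (by omega), if_neg (by omega), if_neg (by omega)]
      rfl

/-- A path on the dual lattice that starts on one side of a column, ends on the other side, and
crosses the column between the two ends of a vertical chain, crosses this chain an odd number of
times. -/
theorem InfPath.pair_parity_column (γ : InfPath .X) {x y : ℤ} {n : ℕ}
    (hcol : ∀ m, (γ.bond m).2 = true → (γ.bond m).1.1 = x →
      y ≤ (γ.bond m).1.2 ∧ (γ.bond m).1.2 < y + n)
    (hside : ∀ᶠ m in atTop, rightOf x (γ.site 0) + rightOf x (γ.site m) = 1) :
    pair γ.parity (column x y n) = 1 := by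
  obtain ⟨m, hm1, hm2⟩ := ((eventually_pair γ.eventually_prefixChain (column x y n)).and
    hside).exists
  rw [← hm1, pair_comm]
  have h := pair_cobd .X (rightOf x) (γ.prefixChain m)
  rw [γ.bd_prefixChain] at h
  simp only [map_add, Finsupp.linearCombination_single, one_smul, hm2] at h
  rw [← h]
  refine pair_congr fun b hb => ?_
  have hb' : b ∈ Set.range γ.bond := by
    by_contra hcon
    exact hb (InfPath.LiesIn.prefixChain_eq_zero (L := Set.range γ.bond) (fun n => ⟨n, rfl⟩) hcon m)
  obtain ⟨i, rfl⟩ := hb'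
  rw [column_apply, cobd_rightOf]
  by_cases hc : (γ.bond i).2 = true ∧ (γ.bond i).1.1 = x
  · rw [if_pos hc, if_pos ⟨hc.1, hc.2, hcol i hc.1 hc.2⟩]
  · rw [if_neg hc, if_neg fun h => hc ⟨h.1, h.2.1⟩]

theorem InfPath.Follows.bounds {k : Charge} {γ : InfPath k} {u : ℝ × ℝ} (h : γ.Follows u) :
    ∃ c : ℝ, 0 < c ∧ ∃ C : ℝ, ∀ n : ℕ,
      |((γ.bond n).1.1 : ℝ) - n * c * u.1| ≤ C ∧ |((γ.bond n).1.2 : ℝ) - n * c * u.2| ≤ C ∧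
      |((γ.site n).1 : ℝ) - n * c * u.1| ≤ C := by
  obtain ⟨c, hc, C, hC⟩ := h
  refine ⟨c, hc, 1 + C, fun n => ?_⟩
  have h1 := (taxi_triangle _ _ _).trans (add_le_add (taxi_bond_site (γ.joins n)) (hC n))
  have h2 := hC n
  simp only [taxi, Site.toPlane, Prod.smul_fst, Prod.smul_snd, smul_eq_mul] at h1 h2
  have a1 := abs_nonneg (((γ.bond n).1.1 : ℝ) - n * c * u.1)
  have a2 := abs_nonneg (((γ.bond n).1.2 : ℝ) - n * c * u.2)
  have a3 := abs_nonneg (((γ.site n).1 : ℝ) - n * c * u.1)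
  have a4 := abs_nonneg (((γ.site n).2 : ℝ) - n * c * u.2)
  refine ⟨by linarith, by linarith, by linarith⟩

/-- A function whose coboundary is the parity of a path in direction `u`, near this path and up to
a finite set, takes different values on the two sides of the path. -/
theorem InfPath.Follows.eventually_add_eq_one {γ : InfPath .X} {u : Site}
    (hγ : γ.Follows u.toPlane) (hu : u.1 ≠ 0) {K : Cone} (h1 : 1 < side K.direction u.toPlane)
    (h2 : side (K.direction + K.angle) u.toPlane < -1) {f : Site → ZMod 2} {S : Bond → ZMod 2}
    (hf : cobd .Z f = γ.parity + S) (hS : {b ∈ K.bonds | S b ≠ 0}.Finite) :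
    ∀ᶠ j : ℕ in atTop, f (j • (u + (0, 1))) + f (j • (u - (0, 1))) = 1 := by
  obtain ⟨H, hH⟩ := K.exists_bound hS
  obtain ⟨c, hc, C, hC⟩ := hγ.bounds
  set p : ℝ := ((u.1 : ℤ) : ℝ) with hp
  set q : ℝ := ((u.2 : ℤ) : ℝ) with hq
  have hp0 : p ≠ 0 := by rw [hp]; exact_mod_cast hu
  have hpa : 0 < |p| := abs_pos.2 hp0
  have lim : ∀ A : ℝ, ∀ᶠ j : ℕ in atTop, A < j := fun A =>
    tendsto_natCast_atTop_atTop.eventually_gt_atTop A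
  have limlo : ∀ A : ℝ, ∀ᶠ j : ℕ in atTop, A < j * (side K.direction u.toPlane - 1) := fun A =>
    (tendsto_natCast_atTop_atTop.atTop_mul_const (sub_pos.2 h1)).eventually_gt_atTop A
  have limhi : ∀ A : ℝ, ∀ᶠ j : ℕ in atTop, A < j * (-1 - side (K.direction + K.angle) u.toPlane) :=
    fun A => (tendsto_natCast_atTop_atTop.atTop_mul_const (sub_pos.2 h2)).eventually_gt_atTop A
  have limp : ∀ A : ℝ, ∀ᶠ j : ℕ in atTop, A < j * |p| := fun A =>
    (tendsto_natCast_atTop_atTop.atTop_mul_const hpa).eventually_gt_atTop A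
  -- Test on the vertical segment of length `2 * j` centred at `j • u`. The path meets its column
  -- only within `C + C * |q / p|` of the centre, hence inside the segment for large `j`; and the
  -- segment lies too high in `K` to contain exceptional bonds.
  filter_upwards [lim (C + C * |q / p|), limp |((γ.site 0).1 : ℝ)|, limlo (max H 0 - K.lo 0),
    limhi (max H 0 - K.hi 0)] with j j1 j2 j3 j4
  set x : ℤ := j * u.1 with hx
  set y : ℤ := j * u.2 - j with hy
  have hbot : j • (u - (0, 1)) = (x, y) := by
    ext <;> simp [hx, hy, mul_sub]
  have htop : j • (u + (0, 1)) = (x, y + (2 * j : ℕ)) := by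
    ext <;> simp [hx, hy]
    ring
  have hpair : pair γ.parity (column x y (2 * j)) = 1 := by
    refine γ.pair_parity_column (fun m hm1 hm2 => ?_) ?_
    · obtain ⟨c1, c2, -⟩ := hC m
      have e1 : ((γ.bond m).1.1 : ℝ) = j * p := by rw [hm2, hx]; push_cast; rfl
      rw [e1] at c1
      change |(j : ℝ) * p - m * c * p| ≤ C at c1
      change |((γ.bond m).1.2 : ℝ) - m * c * q| ≤ C at c2
      have e2 : |((γ.bond m).1.2 : ℝ) - j * q| ≤ C + C * |q / p| := by
        have : ((γ.bond m).1.2 : ℝ) - j * q = ((γ.bond m).1.2 - m * c * q) -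
            (j * p - m * c * p) * (q / p) := by
          field_simp
          ring
        rw [this]
        refine (abs_sub _ _).trans (add_le_add c2 ?_)
        rw [abs_mul]
        exact mul_le_mul_of_nonneg_right c1 (abs_nonneg _)
      have e3 := abs_le.1 (e2.trans j1.le)
      have e4 : |((γ.bond m).1.2 : ℝ) - j * q| < j := e2.trans_lt j1
      rw [abs_lt] at e4
      constructor
      · have : (y : ℝ) ≤ (γ.bond m).1.2 := by
          rw [hy]; push_cast; rw [← hq]; linarith
        exact_mod_cast this
      · have : ((γ.bond m).1.2 : ℝ) < (y + (2 * j : ℕ) : ℤ) := by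
          rw [hy]; push_cast; rw [← hq]; linarith
        exact_mod_cast this
    · have hx' : (x : ℝ) = j * p := by rw [hx]; push_cast; rfl
      have h0 := abs_lt.1 j2
      rcases lt_or_gt_of_ne hp0 with hneg | hpos
      · have hlim : ∀ᶠ m : ℕ in atTop, C - x < m * (c * -p) :=
          (tendsto_natCast_atTop_atTop.atTop_mul_const
            (mul_pos hc (neg_pos.2 hneg))).eventually_gt_atTop _
        rw [abs_of_neg hneg] at h0
        filter_upwards [hlim] with m hm
        have h3 := (abs_le.1 (hC m).2.2).2
        change ((γ.site m).1 : ℝ) - m * c * p ≤ C at h3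
        rw [rightOf, rightOf, if_pos, if_neg, add_zero]
        · rw [not_le]
          have : ((γ.site m).1 : ℝ) < x := by linarith
          exact_mod_cast this
        · have : (x : ℝ) ≤ (γ.site 0).1 := by linarith
          exact_mod_cast this
      · have hlim : ∀ᶠ m : ℕ in atTop, C + x < m * (c * p) :=
          (tendsto_natCast_atTop_atTop.atTop_mul_const (mul_pos hc hpos)).eventually_gt_atTop _
        rw [abs_of_pos hpos] at h0
        filter_upwards [hlim] with m hm
        have h3 := (abs_le.1 (hC m).2.2).1
        change -C ≤ ((γ.site m).1 : ℝ) - m * c * p at h3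
        rw [rightOf, rightOf, if_neg, if_pos, zero_add]
        · have : (x : ℝ) ≤ (γ.site m).1 := by linarith
          exact_mod_cast this
        · rw [not_le]
          have : ((γ.site 0).1 : ℝ) < x := by linarith
          exact_mod_cast this
  have hzero : pair S (column x y (2 * j)) = 0 := by
    refine pair_eq_zero fun b hb => ?_
    rw [column_apply] at hb
    have hb' : b.2 = true ∧ b.1.1 = x ∧ y ≤ b.1.2 ∧ b.1.2 < y + (2 * j : ℕ) := by
      by_contra hcon
      exact hb (if_neg hcon)
    obtain ⟨-, g1, g2, g3⟩ := hb'
    by_contra hne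
    set i : ℝ := b.1.2 - j * q with hi
    have hij : |i| ≤ j := by
      rw [abs_le]
      have g2' : (y : ℝ) ≤ b.1.2 := by exact_mod_cast g2
      have g3' : (b.1.2 : ℝ) < (y + (2 * j : ℕ) : ℤ) := by exact_mod_cast g3
      rw [hy] at g2' g3'
      push_cast at g2' g3'
      rw [← hq] at g2' g3'
      constructor <;> linarith
    have hb1 : b.1.toPlane = 0 + ((j : ℝ) • u.toPlane + i • ((0, 1) : ℝ × ℝ)) := by
      ext
      · simp [Site.toPlane, g1, hx]
      · simp [Site.toPlane, hi, ← hq]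
    have hs : ∀ φ, |i * side φ (0, 1)| ≤ j := by
      intro φ
      have h1 : |side φ (0, 1)| ≤ 1 := (ToricCode.abs_side_le φ _).trans (by simp)
      rw [abs_mul]
      calc _ ≤ |i| * 1 := mul_le_mul_of_nonneg_left h1 (abs_nonneg _)
        _ ≤ _ := by linarith
    have hlo : max H 0 < K.lo b.1.toPlane := by
      rw [hb1, K.lo_add, side_add, side_smul, side_smul]
      linarith [(abs_le.1 (hs K.direction)).1]
    have hhi : max H 0 < K.hi b.1.toPlane := by
      rw [hb1, K.hi_add, side_add, side_smul, side_smul]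
      linarith [(abs_le.1 (hs (K.direction + K.angle))).2]
    have m1 := le_max_left H 0
    have m2 := le_max_right H 0
    have := hH b ⟨K.mem_bonds_of_fst (by linarith) (by linarith), hne⟩
    rw [Cone.height] at this
    linarith
  have h := pair_cobd .Z f (column x y (2 * j))
  rw [hf, pair_add_left, hpair, hzero, bd_column] at h
  simp only [map_add, Finsupp.linearCombination_single, one_smul, add_zero] at h
  rw [htop, hbot, h, add_comm]

theorem EndValue.eventually_nsmul {k : Charge} {K : Cone} {f : Site → ZMod 2} {a : ZMod 2}
    (h : EndValue k K.bonds f a) {u : Site} (hu : K.Inside u.toPlane) :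
    ∀ᶠ j : ℕ in atTop, f (j • u) = a := by
  obtain ⟨H, hH⟩ := K.exists_bound h
  filter_upwards [hu.eventually_deep (max (H + 1) 1) 0] with j hj
  rw [zero_add] at hj
  by_contra hne
  have h1 := le_max_left (H + 1) 1
  have h2 := le_max_right (H + 1) 1
  have := hH (j • u, false) ⟨K.mem_bonds_of_fst (by linarith [hj.1]) (by linarith [hj.2]),
    fun hb => hne hb.1⟩
  rw [Cone.height] at this
  linarith [hj.1, hj.2]

/-! ### Charge transporters -/

/-- The chains `c n` transport the charge of the path `γ` to the path `η` and avoid the translated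
cone `La + x`. -/
structure Transports (La : Cone) {k : Charge} (γ η : InfPath k) (x : Site) (c : ℕ → Chain) :
    Prop where
  bd_eq : ∀ n, bd k (c n) = Finsupp.single (γ.site 0) 1 + Finsupp.single (η.site 0) 1
  tendsto : ∀ b, ∀ᶠ n in atTop, c n b = γ.parity b + η.parity b
  avoids : ∀ n, ∀ b ∈ (La.translate x).bonds, c n b = 0

theorem exists_transports {La : Cone} {k : Charge} {γ η : InfPath k} {x : Site}
    (hγ : γ.LiesIn ((La.translate x).bonds)ᶜ) (hη : η.LiesIn ((La.translate x).bonds)ᶜ) :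
    ∃ c, Transports La γ η x c := by
  obtain ⟨c, h1, h2, h3⟩ := γ.exists_transport η ((La.translate x).oneEnded k.dual)
    (fun b hb => hγ.parity_eq_zero (not_not.2 hb)) (fun b hb => hη.parity_eq_zero (not_not.2 hb))
  exact ⟨c, h1, h2, h3⟩

theorem InfPath.LiesIn.mono {k : Charge} {γ : InfPath k} {L M : Set Bond} (h : γ.LiesIn L)
    (hLM : L ⊆ M) : γ.LiesIn M := fun n => hLM (h n)

theorem InfPath.LiesIn.of_disjoint {k : Charge} {γ : InfPath k} {L M : Set Bond} (h : γ.LiesIn L)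
    (hLM : Disjoint L M) : γ.LiesIn Mᶜ := fun n => Set.disjoint_left.1 hLM (h n)

/-- The chain of a finite path. -/
def FinPath.chain {k : Charge} {v w : Site} (p : FinPath k v w) : Chain :=
  ∑ i ∈ Finset.range p.length, Finsupp.single (p.bond i) 1

theorem FinPath.op_eq_chainOp {k : Charge} {v w : Site} (p : FinPath k v w) :
    p.op = chainOp k p.chain :=
  stringOp_eq_chainOp _ _ _

theorem FinPath.bd_chain {k : Charge} {v w : Site} (p : FinPath k v w) :
    bd k p.chain = Finsupp.single v 1 + Finsupp.single w 1 := by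
  have : ∀ n ≤ p.length, bd k (∑ i ∈ Finset.range n, Finsupp.single (p.bond i) 1) =
      Finsupp.single (p.site 0) 1 + Finsupp.single (p.site n) 1 := by
    intro n
    induction n with
    | zero => simp [add_self_finsupp]
    | succ n ih =>
      intro hn
      rw [Finset.sum_range_succ, map_add, ih (by omega), (p.joins n (by omega)).bd_single, add_assoc,
        ← add_assoc (Finsupp.single (p.site n) 1), add_self_finsupp, zero_add]
  have h := this p.length le_rfl
  rwa [p.source, p.target] at h

theorem FinPath.Avoids.chain_eq_zero {k : Charge} {v w : Site} {p : FinPath k v w} {L : Set Bond}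
    (h : p.Avoids L) {b : Bond} (hb : b ∈ L) : p.chain b = 0 := by
  rw [FinPath.chain, Finsupp.finsetSum_apply]
  refine Finset.sum_eq_zero fun i hi => Finsupp.single_eq_of_ne ?_
  rintro rfl
  exact h i (Finset.mem_range.1 hi) hb

namespace TransportNet

variable {La L : Cone} {k : Charge} {γ : InfPath k} (N : TransportNet La L γ)

/-- The chain of the `n`-th string operator of the net. -/
def chain (n : ℕ) : Chain := γ.prefixChain n + (N.link n).chain + N.endPath.prefixChain n

theorem op_eq_chainOp (n : ℕ) : N.op n = chainOp k (N.chain n) := by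
  rw [op, chain, chainOp_add, chainOp_add, γ.op_eq_chainOp, N.endPath.op_eq_chainOp,
    FinPath.op_eq_chainOp]

theorem transports : Transports La γ N.endPath N.shift N.chain where
  bd_eq n := by
    rw [chain, map_add, map_add, γ.bd_prefixChain, N.endPath.bd_prefixChain, FinPath.bd_chain]
    have key : ∀ A B C D : Site →₀ ZMod 2, C + C = 0 → D + D = 0 →
        (A + C) + (C + D) + (B + D) = A + B := fun A B C D hC hD => by
      calc _ = A + B + (C + C) + (D + D) := by abel
        _ = _ := by rw [hC, hD, add_zero, add_zero]
    exact key _ _ _ _ (add_self_finsupp _) (add_self_finsupp _)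
  tendsto b := by
    filter_upwards [γ.eventually_prefixChain b, N.endPath.eventually_prefixChain b,
      N.link_toInfinity {b} (Set.finite_singleton b)] with n h1 h2 h3
    rw [chain, Finsupp.add_apply, Finsupp.add_apply, h1, h2, h3.chain_eq_zero rfl, add_zero]
  avoids n b hb := by
    rw [chain, Finsupp.add_apply, Finsupp.add_apply, N.path_avoids.prefixChain_eq_zero (not_not.2 hb),
      N.endPath_avoids.prefixChain_eq_zero (not_not.2 hb), (N.link_avoids n).chain_eq_zero hb,
      add_zero, add_zero]

end TransportNet

/-- There are nets of string operators that transport the charge of a path to any given path in a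
cone `M < L`. -/
theorem exists_transportNet {La M L : Cone} (h : Before La M L) {k : Charge} {γ η : InfPath k}
    (hγ : γ.LiesIn L.bonds) (hη : η.LiesIn M.bonds) : Nonempty (TransportNet La L γ) := by
  have h' := h
  obtain ⟨-, x, hM, hL, -⟩ := h'
  obtain ⟨p, hp1, hp2⟩ := γ.exists_links η ((La.translate x).oneEnded k.dual) (hγ.of_disjoint hL)
    (hη.of_disjoint hM)
  exact ⟨⟨M, h, η, hη, p, hp1, x, hγ.of_disjoint hL, hη.of_disjoint hM, hp2⟩⟩

/-- The operators of `Transports` converge to a unitary of the auxiliary algebra. -/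
theorem Transports.exists_unitary {ω : QuasiLocal →ₚ[ℂ] ℂ} (hω : IsGroundState ω) {La : Cone}
    {k : Charge} {γ η : InfPath k} {x : Site} {c : ℕ → Chain} (h : Transports La γ η x c) :
    ∃ V : auxAlgebra ω La, (V : Op ω) ∈ vonNeumann ω ((La.translate x).bonds)ᶜ ∧
      star (V : Op ω) = V ∧ (V : Op ω) * V = 1 ∧
      (∀ ψ, Tendsto (fun n => gnsRep ω (chainOp k (c n)) ψ) atTop (𝓝 ((V : Op ω) ψ))) ∧
      ∀ A, (V : Op ω) * gnsRep ω (γ.aut A) * V = gnsRep ω (η.aut A) := by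
  obtain ⟨W, h1, h2, h3⟩ := hω.exists_transporter h.tendsto fun n => by rw [h.bd_eq, h.bd_eq]
  have hW := mem_vonNeumann_of_tendsto (L := ((La.translate x).bonds)ᶜ) h3 fun n =>
    chainOp_mem_observables k fun b hb hb' => hb (h.avoids n b hb')
  exact ⟨⟨W, vonNeumann_le_auxAlgebra ω La x hW⟩, hW, h1, h2, h3,
    transporter_intertwines h.tendsto h1 h2 h3⟩

theorem mem_unitary_of_mul_self {ω : QuasiLocal →ₚ[ℂ] ℂ} {La : Cone} {V : auxAlgebra ω La}
    (h1 : star (V : Op ω) = V) (h2 : (V : Op ω) * V = 1) : V ∈ unitary (auxAlgebra ω La) := by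
  have h1' : star V = V := Subtype.ext h1
  have h2' : V * V = 1 := Subtype.ext h2
  rw [Unitary.mem_iff, h1']
  exact ⟨h2', h2'⟩

/-- The eventual value of a potential along two paths gives the sign of a transporter. -/
theorem eventually_pair_eq {k k₁ k₂ : Charge} {γ₁ : InfPath k₁} {δ : InfPath k₂}
    {f : Site → ZMod 2} {e : Chain}
    (hf : cobd k f = γ₁.parity + δ.parity + e) {γ η : InfPath k} {c : ℕ → Chain}
    (hc : ∀ b, ∀ᶠ n in atTop, c n b = γ.parity b + η.parity b)
    (hbd : ∀ n, bd k (c n) = Finsupp.single (γ.site 0) 1 + Finsupp.single (η.site 0) 1)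
    (hδ : ∀ n b, c n b ≠ 0 → δ.parity b = 0)
    (hγ : ∀ n, (γ₁.parity + δ.parity) (γ.bond n) = 0)
    (hη : ∀ n, (γ₁.parity + δ.parity) (η.bond n) = 0) {B B' : Set Bond} {a a' : ZMod 2}
    (hB : EndValue k B f a) (hB' : EndValue k B' f a') (hγB : γ.LiesIn B) (hηB : η.LiesIn B') :
    ∀ᶠ n in atTop, pair γ₁.parity (c n) = a + a' := by
  obtain ⟨n, h1, h2, h3, h4⟩ := ((γ.eventually_potential hf hγ).and
    ((η.eventually_potential hf hη).and ((hB.eventually hγB).and (hB'.eventually hηB)))).exists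
  filter_upwards [eventually_pair_parity γ η hf (S := γ.parity + η.parity) hc hbd hδ] with m hm
  rw [hm, ← h3, ← h4, h1, h2, pair_add_left]
  ring

theorem finite_ne_zero_of_eq {B : Set Bond} {k k' : Charge} {f : Site → ZMod 2} {S : Bond → ZMod 2}
    {δ : InfPath k'} {e : Chain} (hf : cobd k f = S + δ.parity + e)
    (hS : {b ∈ B | S b ≠ 0}.Finite) (hδ : (B ∩ Set.range δ.bond).Finite) :
    {b ∈ B | cobd k f b ≠ 0}.Finite := by
  refine ((hS.union hδ).union (finite_chain_ne_zero e)).subset ?_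
  rintro b ⟨hb, hne⟩
  by_contra hcon
  simp only [Set.mem_union, not_or] at hcon
  refine hne ?_
  have h1 : S b = 0 := by
    by_contra h
    exact hcon.1.1 ⟨hb, h⟩
  have h2 : δ.parity b = 0 := by
    by_contra h
    exact hcon.1.2 (δ.parity_ne_zero_subset _ ⟨hb, h⟩)
  have h3 : e b = 0 := by
    by_contra h
    exact hcon.2 h
  rw [hf]
  simp [h1, h2, h3]

theorem InfPath.LiesIn.inter_range_eq_empty {k : Charge} {γ : InfPath k} {L B : Set Bond}
    (h : γ.LiesIn L) (hLB : Disjoint L B) : B ∩ Set.range γ.bond = ∅ := by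
  rw [Set.eq_empty_iff_forall_notMem]
  rintro _ ⟨hb, n, rfl⟩
  exact Set.disjoint_left.1 hLB (h n) hb

/-- The sign of a transporter with respect to a path is eventually constant. -/
theorem Transports.exists_sign {La : Cone} {k k₁ : Charge} {γ η : InfPath k} {x : Site}
    {c : ℕ → Chain} (h : Transports La γ η x c) (γ₁ : InfPath k₁) :
    ∃ s : ℂ, (s = 1 ∨ s = -1) ∧ ∀ᶠ n in atTop, phase k₁ k (pair γ₁.parity (c n)) = s := by
  rcases Charge.eq_or_eq_dual k k₁ with rfl | rfl
  · exact ⟨1, Or.inl rfl, Eventually.of_forall fun n => phase_self _ _⟩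
  -- A path to infinity in the avoided cone completes `γ₁` without meeting the transporter.
  · obtain ⟨u, hu⟩ := (La.translate x).exists_inside
    obtain ⟨δ, hδ, -⟩ := (La.translate x).exists_ray k.dual hu Set.finite_empty
    obtain ⟨f, e, hf⟩ := exists_path_potential γ₁ δ
    refine ⟨phase k.dual k (f (γ.site 0) + f (η.site 0) + pair (γ.parity + η.parity) e),
      phase_eq_one_or _ _ _, ?_⟩
    filter_upwards [eventually_pair_parity γ η hf (S := γ.parity + η.parity) h.tendsto h.bd_eq
      fun n b hb => hδ.parity_eq_zero fun hb' => hb (h.avoids n b hb')] with n hn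
    rw [hn]

/-- The sign of a transporter does not depend on the path to which the charge is transported. -/
theorem Transports.sign_eq {La M M' L L' : Cone} (hM : Before La M L) (hM' : Before La M' L')
    {k : Charge} {γ₁ : InfPath k.dual} (hL : ∀ b ∉ L.bonds, γ₁.parity b = 0)
    (hL' : ∀ b ∉ L'.bonds, γ₁.parity b = 0) {γ η η' : InfPath k} {x x' : Site} {c c' : ℕ → Chain}
    (hc : Transports La γ η x c) (hc' : Transports La γ η' x' c') (hη : η.LiesIn M.bonds)
    (hη' : η'.LiesIn M'.bonds) :
    ∀ᶠ n in atTop, pair γ₁.parity (c n) = pair γ₁.parity (c' n) := by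
  have hMc := hM
  have hMc' := hM'
  obtain ⟨hML, y, hy1, hy2, -⟩ := hMc
  obtain ⟨hML', y', hy1', hy2', -⟩ := hMc'
  -- A single translate inside all four forbidden ones, so that `δ` meets neither the chains nor the
  -- cones.
  obtain ⟨z₁, hz1, hz2⟩ := La.exists_translate_subset x x'
  obtain ⟨z₂, hz3, hz4⟩ := La.exists_translate_subset y y'
  obtain ⟨z, hz5, hz6⟩ := La.exists_translate_subset z₁ z₂
  obtain ⟨u, hu⟩ := La.exists_inside
  obtain ⟨r, hr, φ, ⟨hφ1, hφ2⟩, hφ⟩ := hu.exists_polar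
  obtain ⟨δ, hδ, -, hδf⟩ := (La.translate z).exists_ray k.dual (u := u) hu Set.finite_empty
  set w := (φ - La.direction) / 2 with hw
  have hw0 : 0 < w := by linarith
  have hwl : 2 * w < La.angle := by linarith
  have hφw : La.direction + 2 * w = φ := by linarith
  obtain ⟨f, e, hf⟩ := exists_path_potential γ₁ δ
  have hδ' : δ.Follows (r • unitVec (La.direction + 2 * w)) := by
    rwa [hφw, ← hφ]
  -- A slice of `La` along its first ray, before the direction of `δ`; both `M` and `M'` can be
  -- turned to overlap it.
  set J : Cone := ⟨La.apex + z, La.direction, w, hw0, by linarith [La.angle_lt_pi]⟩ with hJ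
  have hJz : J.bonds ⊆ (La.translate z).bonds :=
    Cone.bonds_subset rfl le_rfl (by change La.direction + w ≤ La.direction + La.angle; linarith)
  have dM : Disjoint (La.translate z).bonds M.bonds :=
    (hy1.symm.mono_left (hz6.trans hz3))
  have dM' : Disjoint (La.translate z).bonds M'.bonds :=
    (hy1'.symm.mono_left (hz6.trans hz4))
  have dL : Disjoint L.bonds (La.translate z).bonds := hy2.mono_right (hz6.trans hz3)
  have hzero : ∀ {M L : Cone}, Disjoint M.bonds L.bonds → (∀ b ∉ L.bonds, γ₁.parity b = 0) →
      ∀ b ∈ M.bonds, γ₁.parity b = 0 := fun hd h b hb => h b (Set.disjoint_left.1 hd hb)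
  have hfin : ∀ {B : Set Bond}, (∀ b ∈ B, γ₁.parity b = 0) → {b ∈ B | γ₁.parity b ≠ 0}.Finite :=
    fun h => Set.finite_empty.subset fun b hb => hb.2 (h b hb.1)
  obtain ⟨a, ha⟩ := M.oneEnded k f (finite_ne_zero_of_eq hf (hfin (hzero hML hL))
    (hδ.inter_range_eq_empty dM ▸ Set.finite_empty))
  obtain ⟨a', ha'⟩ := M'.oneEnded k f (finite_ne_zero_of_eq hf (hfin (hzero hML' hL'))
    (hδ.inter_range_eq_empty dM' ▸ Set.finite_empty))
  obtain ⟨a₀, ha₀⟩ := J.oneEnded k f (finite_ne_zero_of_eq hf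
    (hfin fun b hb => hL b fun hb' => Set.disjoint_left.1 dL hb' (hJz hb))
    (hδ'.finite_range_of_angle hr J (by change La.direction + w < _; linarith)
      (by change _ < La.direction + _; linarith [La.angle_lt_pi])))
  have e1 : a = a₀ := hM.endValue_eq hr hw0 hwl hδ' hf hL (J := J) rfl rfl ha ha₀
  have e2 : a' = a₀ := hM'.endValue_eq hr hw0 hwl hδ' hf hL' (J := J) rfl rfl ha' ha₀
  -- The sum of the two transports leads from `η` to `η'`, so the exponent of its sign is the sum of
  -- the end values, which are equal.
  have key := eventually_pair_eq hf (γ := η) (η := η') (c := fun n => c n + c' n)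
    (fun b => by
      filter_upwards [hc.tendsto b, hc'.tendsto b] with n h1 h2
      rw [Finsupp.add_apply, h1, h2]
      linear_combination CharTwo.add_self_eq_zero (γ.parity b))
    (fun n => by
      rw [map_add, hc.bd_eq, hc'.bd_eq]
      have := add_self_finsupp (Finsupp.single (γ.site 0) 1 : Site →₀ ZMod 2)
      have key : ∀ A B C : Site →₀ ZMod 2, A + A = 0 → (A + B) + (A + C) = B + C :=
        fun A B C hA => by
          calc _ = A + A + (B + C) := by abel
            _ = _ := by rw [hA, zero_add]
      exact key _ _ _ this)
    (fun n b hb => hδ.parity_eq_zero fun hbz => hb (by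
      rw [Finsupp.add_apply, hc.avoids n b (hz1 (hz5 hbz)), hc'.avoids n b (hz2 (hz5 hbz)),
        add_zero]))
    (fun n => by
      rw [Pi.add_apply, hzero hML hL _ (hη n), (hδ.of_disjoint dM).parity_eq_zero
        (not_not.2 (hη n)), add_zero])
    (fun n => by
      rw [Pi.add_apply, hzero hML' hL' _ (hη' n), (hδ.of_disjoint dM').parity_eq_zero
        (not_not.2 (hη' n)), add_zero]) ha ha' hη hη'
  filter_upwards [key] with n hn
  rw [map_add, e1, e2, CharTwo.add_self_eq_zero] at hn
  exact eq_of_add_eq_zero_zmod hn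

/-! ### The braiding -/

section Braiding

variable {ω : QuasiLocal →ₚ[ℂ] ℂ}

/-- Far away, the automorphism of a path in a cone `L` is implemented by unitaries that commute with
everything that is localized in a cone `M < L`. -/
theorem exists_implements (hω : IsGroundState ω) {La M L : Cone} (h : Before La M L) {k : Charge}
    {γ : InfPath k} (hγ : ∀ b ∉ L.bonds, γ.parity b = 0) (y : Site) :
    ∃ W : Op ω, Implements W γ.aut ((La.translate y).bonds)ᶜ ∧
      ∀ U : Op ω, (∀ A ∈ observables (M.bonds)ᶜ, U * gnsRep ω A = gnsRep ω A * U) →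
        W * U = U * W := by
  obtain ⟨hML, x, hx1, hx2, -⟩ := h
  obtain ⟨z, hz1, hz2⟩ := La.exists_translate_subset x y
  obtain ⟨u, hu⟩ := (La.translate z).exists_inside
  obtain ⟨δ, hδ, -⟩ := (La.translate z).exists_ray k hu Set.finite_empty
  have hδM : ∀ b ∈ M.bonds, δ.parity b = 0 := fun b hb => hδ.parity_eq_zero fun hb' =>
    Set.disjoint_left.1 hx1 hb (hz1 hb')
  -- Here the chains avoid `M` instead of the forbidden cone, so that their string operators are
  -- observables outside `M`.
  obtain ⟨c, h1, h2, h3⟩ := γ.exists_transport δ (M.oneEnded k.dual)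
    (fun b hb => hγ b (Set.disjoint_left.1 hML hb)) hδM
  obtain ⟨W, w1, w2, w3⟩ := hω.exists_transporter h2 fun n => by rw [h1, h1]
  refine ⟨W, ⟨w1, w2, fun A hA => ?_⟩, fun U hU => ?_⟩
  · rw [transporter_intertwines h2 w1 w2 w3]
    congr 1
    exact InfPath.isLocalized (L := (La.translate y).bonds)
      (fun b hb => hδ.parity_eq_zero fun hb' => hb (hz2 hb')) A hA
  · refine mul_eq_mul_of_tendsto w3 (Eventually.of_forall fun n => (hU _ ?_).symm)
    exact chainOp_mem_observables k fun b hb hbM => hb (h3 n b hbM)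

/-- On each approximating string operator conjugation with `W` is the string automorphism, that is
multiplication by a sign, and this passes to the strong limit. -/
theorem Transports.extension_eq {La : Cone} {k k₁ : Charge} {γ η : InfPath k}
    {γ₁ : InfPath k₁} {x : Site} {c : ℕ → Chain} (h : Transports La γ η x c)
    {s : ℂ} (hs : ∀ᶠ n in atTop, phase k₁ k (pair γ₁.parity (c n)) = s)
    {ρ' : auxAlgebra ω La →⋆ₐ[ℂ] auxAlgebra ω La} (hρ : IsAuxExtension ω La γ₁.aut ρ')
    {W : Op ω} (hW : Implements W γ₁.aut ((La.translate x).bonds)ᶜ) {V : auxAlgebra ω La}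
    (hV : (V : Op ω) ∈ vonNeumann ω ((La.translate x).bonds)ᶜ)
    (hlim : ∀ ψ, Tendsto (fun n => gnsRep ω (chainOp k (c n)) ψ) atTop (𝓝 ((V : Op ω) ψ))) :
    ρ' V = s • V := by
  refine Subtype.ext ?_
  rw [hρ.eq_conj hW hV]
  change W * (V : Op ω) * W = s • (V : Op ω)
  ext ψ
  have h1 : Tendsto (fun n => W (gnsRep ω (chainOp k (c n)) (W ψ))) atTop
      (𝓝 (W ((V : Op ω) (W ψ)))) := (W.continuous.tendsto _).comp (hlim (W ψ))
  refine tendsto_nhds_unique h1 (((hlim ψ).const_smul s).congr' ?_)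
  filter_upwards [hs] with n hn
  have h2 := hW.conj' (chainOp_mem_observables k (c := c n) fun b hb hb' => hb (h.avoids n b hb'))
  rw [γ₁.aut_chainOp, hn, map_smul] at h2
  exact (congrArg (fun X : Op ω => X ψ) h2).symm

/-- The braiding operators are given by the sign of any transporter. -/
theorem braidings_eq (hω : IsGroundState ω) {La M L : Cone} (hM : Before La M L) {k k₁ : Charge}
    {γ₁ : InfPath k₁} {γ η : InfPath k} (h₁ : γ₁.LiesIn L.bonds) (hγ : γ.LiesIn L.bonds)
    (hη : η.LiesIn M.bonds) {x : Site} {c : ℕ → Chain} (hc : Transports La γ η x c) {s : ℂ}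
    (hs : ∀ᶠ n in atTop, phase k₁ k (pair γ₁.parity (c n)) = s) :
    braidings ω La γ₁.aut γ.aut = {s • (1 : Op ω)} := by
  have hL₁ : ∀ b ∉ L.bonds, γ₁.parity b = 0 := fun b hb => h₁.parity_eq_zero hb
  have hL : ∀ b ∉ L.bonds, γ.parity b = 0 := fun b hb => hγ.parity_eq_zero hb
  obtain ⟨u, hu⟩ := La.exists_inside
  refine Set.eq_singleton_iff_unique_mem.2 ⟨?_, ?_⟩
  · obtain ⟨ρ', hρ'⟩ := exists_isAuxExtension (ω := ω) (ρ := γ₁.aut)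
      (fun L A hA => γ₁.aut_mem_observables hA) (hu.exhausts 0)
      fun j => (exists_implements hω hM hL₁ _).imp fun W hW => hW.1
    obtain ⟨V, v1, v2, v3, v4, v5⟩ := hc.exists_unitary hω
    obtain ⟨W, hW, -⟩ := exists_implements hω hM hL₁ x
    refine ⟨L, L, L, M, InfPath.isLocalized hL₁, InfPath.isLocalized hL, by simp, hM, ρ', hρ', V,
      mem_unitary_of_mul_self v2 v3, fun A hA => ?_, ?_⟩
    · rw [v2, v5]
      congr 1
      exact InfPath.isLocalized (L := M.bonds) (fun b hb => hη.parity_eq_zero hb) A hA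
    · rw [hc.extension_eq hs hρ' hW v1 v4]
      change s • (1 : Op ω) = star (V : Op ω) * (s • (V : Op ω))
      rw [v2, mul_smul_comm, v3]
  -- For arbitrary data, compare `V` with a transporter `V₀` made of strings that ends in the same
  -- cone `M'`; its sign is still `s` by `Transports.sign_eq`.
  · rintro ε ⟨L₁, L₂, L', M', hloc₁, -, -, hM', ρ', hρ', V, hV, hVA, rfl⟩
    have hL₁' : ∀ b ∉ L₁.bonds, γ₁.parity b = 0 := fun b hb =>
      InfPath.parity_eq_zero_of_isLocalized hloc₁ hb
    have hMc := hM
    have hMc' := hM'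
    obtain ⟨-, y, -, hy, -⟩ := hMc
    obtain ⟨-, y', hy', -⟩ := hMc'
    obtain ⟨z, hz, hz'⟩ := La.exists_translate_subset y y'
    obtain ⟨u', hu'⟩ := M'.exists_inside
    obtain ⟨η', hη', -⟩ := M'.exists_ray k hu' Set.finite_empty
    obtain ⟨c', hc'⟩ := exists_transports (La := La) (x := z)
      (hγ.of_disjoint (hy.mono_right hz)) (hη'.of_disjoint (hy'.mono_right hz'))
    have hs' : ∀ᶠ n in atTop, phase k₁ k (pair γ₁.parity (c' n)) = s := by
      rcases Charge.eq_or_eq_dual k k₁ with rfl | rfl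
      · filter_upwards [hs] with n hn
        rw [← hn, phase_self, phase_self]
      · filter_upwards [hs, hc.sign_eq hM hM' hL₁ hL₁' hc' hη hη'] with n h1 h2
        rw [← h2, h1]
    obtain ⟨V₀, v1, v2, v3, v4, v5⟩ := hc'.exists_unitary hω
    obtain ⟨W, hW, -⟩ := exists_implements hω hM hL₁ z
    have e0 : ρ' V₀ = s • V₀ := hc'.extension_eq hs' hρ' hW v1 v4
    have hVs : star (V : Op ω) * V = 1 := congrArg Subtype.val (Unitary.star_mul_self_of_mem hV)
    have v6 : ∀ A ∈ observables (M'.bonds)ᶜ,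
        (V₀ : Op ω) * gnsRep ω A = gnsRep ω (γ.aut A) * V₀ := by
      intro A hA
      have h1 := v5 A
      rw [show η'.aut A = A from InfPath.isLocalized (L := M'.bonds)
        (fun b hb => hη'.parity_eq_zero hb) A hA] at h1
      rw [← h1, ← mul_assoc, ← mul_assoc, v3, one_mul]
    -- `V * V₀` commutes with the observables outside `M'`, and far away `ρ₁` is implemented by
    -- limits of strings avoiding `M'`.
    have e1 : ρ' (V * V₀) = V * V₀ := by
      refine hρ'.eq_self_of_commute (hu.exhausts 0) _ fun j => ?_
      obtain ⟨W, hW, hWU⟩ := exists_implements hω hM' hL₁' ((0 : Site) + j • u)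
      refine ⟨W, hW, hWU _ fun A hA => ?_⟩
      change (V : Op ω) * V₀ * gnsRep ω A = gnsRep ω A * ((V : Op ω) * V₀)
      rw [mul_assoc, v6 A hA, ← hVA A hA]
      calc _ = (V : Op ω) * gnsRep ω (γ.aut A) * 1 * V₀ := by simp only [mul_one, mul_assoc]
        _ = _ := by rw [← hVs]; simp only [mul_assoc]
    have v3' : V₀ * V₀ = 1 := Subtype.ext v3
    have e2 : ρ' V = s • V := by
      calc ρ' V = ρ' (V * V₀ * V₀) := by rw [mul_assoc, v3', mul_one]
        _ = V * V₀ * (s • V₀) := by rw [map_mul, e1, e0]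
        _ = _ := by rw [mul_smul_comm, mul_assoc, v3', mul_one]
    rw [e2]
    change star (V : Op ω) * (s • (V : Op ω)) = s • 1
    rw [mul_smul_comm, hVs]

end Braiding

/-! ### Strings of different types -/

namespace Cone

/-- Every cone contains an integer vector that is not vertical and stays inside the cone if it is
changed by a vertical unit vector. -/
theorem exists_inside_crossing (K : Cone) : ∃ u : Site, u.1 ≠ 0 ∧ K.Inside u.toPlane ∧
    1 < side K.direction u.toPlane ∧ side (K.direction + K.angle) u.toPlane < -1 ∧
    K.Inside (Site.toPlane (u + (0, 1))) ∧ K.Inside (Site.toPlane (u - (0, 1))) := by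
  obtain ⟨v, hv⟩ := K.exists_inside
  set K₀ : Cone := { K with apex := 0 } with hK₀
  have hdeep : ∀ᶠ n : ℕ in atTop, ∀ e : Site, e = 0 ∨ e = (1, 0) →
      3 < side K.direction (Site.toPlane (n • v + e)) ∧
      side (K.direction + K.angle) (Site.toPlane (n • v + e)) < -3 := by
    filter_upwards [hv.eventually_deep (K := K₀) 4 0, hv.eventually_deep (K := K₀) 4 (1, 0)]
      with n h1 h2
    rintro e (rfl | rfl)
    · rw [Deep, zero_add, ← zero_add (n • v), show (0 : Site) = K₀.apex from rfl, lo_apex_add,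
        hi_apex_add] at h1
      rw [add_zero]
      exact ⟨by linarith [h1.1], by linarith [h1.2]⟩
    · rw [Deep, add_comm, ← zero_add (n • v + (1, 0)), show (0 : Site) = K₀.apex from rfl,
        lo_apex_add, hi_apex_add] at h2
      exact ⟨by linarith [h2.1], by linarith [h2.2]⟩
  obtain ⟨n, hn⟩ := hdeep.exists
  obtain ⟨e, he, hne⟩ : ∃ e : Site, (e = 0 ∨ e = (1, 0)) ∧ (n • v + e).1 ≠ 0 := by
    by_cases h : (n • v).1 = 0
    · exact ⟨(1, 0), Or.inr rfl, by rw [Prod.fst_add, h]; simp⟩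
    · exact ⟨0, Or.inl rfl, by rwa [add_zero]⟩
  obtain ⟨h1, h2⟩ := hn e he
  have hb : ∀ φ, |side φ (Site.toPlane (0, 1))| ≤ 1 := fun φ =>
    IsStep.abs_side_le (by simp [IsStep]) φ
  have b1 := abs_le.1 (hb K.direction)
  have b2 := abs_le.1 (hb (K.direction + K.angle))
  refine ⟨n • v + e, hne, ⟨by linarith, by linarith⟩, by linarith, by linarith, ?_, ?_⟩
  · rw [Inside, toPlane_add _ (0, 1), side_add, side_add]
    exact ⟨by linarith, by linarith⟩
  · rw [Inside, toPlane_sub _ (0, 1), side_sub, side_sub]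
    exact ⟨by linarith, by linarith⟩

end Cone

/-- A path in a direction that is, up to a multiple of `2π`, not in the cone. -/
theorem InfPath.Follows.finite_range_of_angle_mod {k : Charge} {γ : InfPath k} {φ r : ℝ}
    (h : γ.Follows (r • unitVec φ)) (hr : 0 < r) (m : ℤ) (K : Cone)
    (h1 : K.direction + K.angle < φ + m * (2 * Real.pi))
    (h2 : φ + m * (2 * Real.pi) < K.direction + 2 * Real.pi) :
    (K.bonds ∩ Set.range γ.bond).Finite := by
  refine InfPath.Follows.finite_range_of_angle ?_ hr K h1 h2
  simpa only [unitVec, Real.cos_add_int_mul_two_pi, Real.sin_add_int_mul_two_pi] using h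

theorem InfPath.parity_eq_zero_of_notMem {k : Charge} (γ : InfPath k) {b : Bond}
    (h : b ∉ Set.range γ.bond) : γ.parity b = 0 :=
  InfPath.LiesIn.parity_eq_zero (L := Set.range γ.bond) (fun n => ⟨n, rfl⟩) h

theorem InfPath.finite_parity_ne_zero {k : Charge} (γ : InfPath k) {B : Set Bond}
    (h : (B ∩ Set.range γ.bond).Finite) : {b ∈ B | γ.parity b ≠ 0}.Finite :=
  h.subset (γ.parity_ne_zero_subset B)

theorem inside_of_eq_unitVec {K : Cone} {z : ℝ × ℝ} {r φ : ℝ} (hr : 0 < r) (h1 : K.direction < φ)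
    (h2 : φ < K.direction + K.angle) (hz : z = r • unitVec φ) : K.Inside z := by
  rw [hz]
  exact (K.inside_unitVec h1 h2).smul hr

/-- A cone around a direction in a sector, in which a function has a value at infinity. -/
theorem exists_cone_in_sector {k : Charge} {f : Site → ZMod 2} {p q : ℝ}
    (hbad : ∀ K : Cone, p < K.direction → K.direction + K.angle < q →
      {b ∈ K.bonds | cobd k f b ≠ 0}.Finite) {φ : ℝ} (h1 : p < φ) (h2 : φ < q) :
    ∃ (K : Cone) (a : ZMod 2), p < K.direction ∧ K.direction < φ ∧ φ < K.direction + K.angle ∧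
      K.direction + K.angle < q ∧ EndValue k K.bonds f a := by
  have hpi := Real.pi_pos
  set ε := min (min ((φ - p) / 2) ((q - φ) / 2)) 1 with hε
  have hε0 : 0 < ε := lt_min (lt_min (by linarith) (by linarith)) one_pos
  have hε1 : ε ≤ (φ - p) / 2 := (min_le_left _ _).trans (min_le_left _ _)
  have hε2 : ε ≤ (q - φ) / 2 := (min_le_left _ _).trans (min_le_right _ _)
  have hε3 : ε ≤ 1 := min_le_right _ _
  set K : Cone := ⟨0, φ - ε, 2 * ε, by linarith, by linarith [Real.pi_gt_three]⟩ with hK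
  have g1 : p < K.direction := by change p < φ - ε; linarith
  have g2 : K.direction + K.angle < q := by change φ - ε + 2 * ε < q; linarith
  obtain ⟨a, ha⟩ := K.oneEnded k f (hbad K g1 g2)
  exact ⟨K, a, g1, by change φ - ε < φ; linarith, by change φ < φ - ε + 2 * ε; linarith, g2, ha⟩

/-- The values on the two sides of a path that crosses a vertical line add up to one. -/
theorem endValue_add_of_crossing {M₁ : Cone} {γ : InfPath .X} {u : Site} (hu : u.1 ≠ 0)
    (hγ : γ.Follows u.toPlane) (h1 : 1 < side M₁.direction u.toPlane)
    (h2 : side (M₁.direction + M₁.angle) u.toPlane < -1)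
    (hu1 : M₁.Inside (Site.toPlane (u + (0, 1)))) (hu2 : M₁.Inside (Site.toPlane (u - (0, 1))))
    {r φ : ℝ} (hφ : φ ∈ Set.Ioo M₁.direction (M₁.direction + M₁.angle))
    (huφ : u.toPlane = r • unitVec φ) {f : Site → ZMod 2} {S : Bond → ZMod 2}
    (hf : cobd .Z f = γ.parity + S) (hS : {b ∈ M₁.bonds | S b ≠ 0}.Finite) {p q : ℝ}
    (hp : p ≤ M₁.direction + 2 * Real.pi) (hq : M₁.direction + M₁.angle ≤ q)
    (hbad : ∀ K : Cone, φ < K.direction → K.direction + K.angle < q →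
      {b ∈ K.bonds | cobd .Z f b ≠ 0}.Finite)
    (hbad' : ∀ K : Cone, p < K.direction → K.direction + K.angle < φ + 2 * Real.pi →
      {b ∈ K.bonds | cobd .Z f b ≠ 0}.Finite) {K K' : Cone} {a a' : ZMod 2}
    (hK1 : φ < K.direction) (hK2 : K.direction + K.angle < q) (hK : EndValue .Z K.bonds f a)
    (hK1' : p < K'.direction) (hK2' : K'.direction + K'.angle < φ + 2 * Real.pi)
    (hK' : EndValue .Z K'.bonds f a') : a + a' = 1 := by
  have hang := M₁.angle_lt_pi
  have hcross := hγ.eventually_add_eq_one hu h1 h2 hf hS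
  have hleft : ∀ w : Site, M₁.Inside w.toPlane → 0 < side φ w.toPlane →
      ∀ᶠ j : ℕ in atTop, f (j • w) = a := by
    intro w hw hs
    obtain ⟨r', hr', ψ, hψ, hwψ⟩ := hw.exists_polar
    rw [hwψ, side_smul, side_unitVec] at hs
    have hlt : φ < ψ := by
      by_contra hle
      have := Real.sin_nonpos_of_nonpos_of_neg_pi_le (x := ψ - φ) (by linarith)
        (by linarith [hψ.1, hφ.2])
      exact absurd (mul_nonpos_of_nonneg_of_nonpos hr'.le this) (not_le.2 hs)
    obtain ⟨K₁, a₁, g1, g2, g3, g4, g5⟩ := exists_cone_in_sector hbad hlt (hψ.2.trans_le hq)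
    rw [Cone.eq_of_sector hbad hK1 hK2 g1 g4 hK g5]
    exact g5.eventually_nsmul (inside_of_eq_unitVec hr' g2 g3 hwψ)
  -- Directions before `φ` belong to the sector ending at `φ + 2π` and are therefore taken one turn
  -- later.
  have hright : ∀ w : Site, M₁.Inside w.toPlane → side φ w.toPlane < 0 →
      ∀ᶠ j : ℕ in atTop, f (j • w) = a' := by
    intro w hw hs
    obtain ⟨r', hr', ψ, hψ, hwψ⟩ := hw.exists_polar
    rw [hwψ, side_smul, side_unitVec] at hs
    have hlt : ψ < φ := by
      by_contra hle
      have := Real.sin_nonneg_of_nonneg_of_le_pi (x := ψ - φ) (by linarith)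
        (by linarith [hψ.2, hφ.1])
      exact absurd (mul_nonneg hr'.le this) (not_le.2 hs)
    obtain ⟨K₁, a₁, g1, g2, g3, g4, g5⟩ := exists_cone_in_sector hbad' (φ := ψ + 2 * Real.pi)
      (by linarith [hψ.1]) (by linarith)
    rw [Cone.eq_of_sector hbad' hK1' hK2' g1 g4 hK' g5]
    refine g5.eventually_nsmul (inside_of_eq_unitVec hr' g2 g3 ?_)
    rw [hwψ]
    simp only [unitVec, Real.cos_add_two_pi, Real.sin_add_two_pi]
  have hu0 : side φ u.toPlane = 0 := by
    rw [huφ, side_smul, side_unitVec, sub_self, Real.sin_zero, mul_zero]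
  have hup : side φ (Site.toPlane (0, 1)) = Real.cos φ := by simp [side, Site.toPlane]
  have hcos : (u.1 : ℝ) = r * Real.cos φ := congrArg Prod.fst huφ
  have hc0 : Real.cos φ ≠ 0 := by
    intro h
    rw [h, mul_zero] at hcos
    exact hu (by exact_mod_cast hcos)
  -- Upwards is to the left of the path if `cos φ` is positive and to its right if it is negative;
  -- `cos φ` is nonzero since `u` is not vertical.
  rcases lt_or_gt_of_ne hc0 with hneg | hpos
  · obtain ⟨j, j1, j2, j3⟩ := (hcross.and ((hright _ hu1 (by
      rw [toPlane_add, side_add, hu0, hup]; linarith)).and (hleft _ hu2 (by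
      rw [toPlane_sub, side_sub, hu0, hup]; linarith)))).exists
    rwa [j2, j3, add_comm] at j1
  · obtain ⟨j, j1, j2, j3⟩ := (hcross.and ((hleft _ hu1 (by
      rw [toPlane_add, side_add, hu0, hup]; linarith)).and (hright _ hu2 (by
      rw [toPlane_sub, side_sub, hu0, hup]; linarith)))).exists
    rwa [j2, j3] at j1

/-- Transporters of two charges of different types have opposite signs with respect to the paths of
the other charge. -/
theorem exists_transports_of_ne {La M L : Cone} (h : Before La M L) {γ : InfPath .X}
    {η : InfPath .Z} (hγ : γ.LiesIn L.bonds) (hη : η.LiesIn L.bonds) :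
    ∃ (γ' : InfPath .X) (η' : InfPath .Z) (x : Site) (c d : ℕ → Chain) (a b : ZMod 2),
      γ'.LiesIn M.bonds ∧ η'.LiesIn M.bonds ∧ Transports La γ γ' x c ∧ Transports La η η' x d ∧
      (∀ᶠ n in atTop, pair γ.parity (d n) = a) ∧ (∀ᶠ n in atTop, pair η.parity (c n) = b) ∧
      a + b = 1 := by
  obtain ⟨m, m', h1, h2, h3, -⟩ := h.exists_angles
  obtain ⟨hML, x, hxM, hxL, -⟩ := h
  set l := La.direction + m * (2 * Real.pi) with hl
  have hpM := M.angle_pos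
  have hpM' := M.angle_lt_pi
  have hpL := L.angle_pos
  have hpLa := La.angle_pos
  have hpLa' := La.angle_lt_pi
  -- The outer thirds of `M` keep the targets apart: `γ'` runs in the first and `η'` in the last,
  -- where it also avoids the finitely many bonds used by `γ'`.
  set M₁ : Cone := ⟨M.apex, M.direction, M.angle / 3, by linarith, by linarith⟩ with hM₁
  set M₂ : Cone := ⟨M.apex, M.direction + 2 * (M.angle / 3), M.angle / 3, by linarith,
    by linarith⟩ with hM₂
  have hM₁M : M₁.bonds ⊆ M.bonds := Cone.bonds_subset rfl le_rfl (by
    change M.direction + M.angle / 3 ≤ M.direction + M.angle; linarith)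
  have hM₂M : M₂.bonds ⊆ M.bonds := Cone.bonds_subset rfl (by
    change M.direction ≤ M.direction + 2 * (M.angle / 3); linarith) (by
    change M.direction + 2 * (M.angle / 3) + M.angle / 3 ≤ M.direction + M.angle; linarith)
  obtain ⟨u, hu, huin, hu1, hu2, hu3, hu4⟩ := M₁.exists_inside_crossing
  obtain ⟨rγ, hrγ, φ, hφ, huφ⟩ := huin.exists_polar
  obtain ⟨γ', hγ', -, hγ'f⟩ := M₁.exists_ray .X huin Set.finite_empty
  have hγ'φ := hγ'f
  rw [huφ] at hγ'φ
  obtain ⟨hφ1, hφ2⟩ := hφ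
  change M.direction < φ at hφ1
  change φ < M.direction + M.angle / 3 at hφ2
  have hfinγ : (M₂.bonds ∩ Set.range γ'.bond).Finite := by
    refine hγ'φ.finite_range_of_angle_mod hrγ 1 M₂ ?_ ?_
    · change M.direction + 2 * (M.angle / 3) + M.angle / 3 < _
      push_cast
      linarith
    · change _ < M.direction + 2 * (M.angle / 3) + _
      push_cast
      linarith
  obtain ⟨v, hv⟩ := M₂.exists_inside
  obtain ⟨rη, hrη, ψ, hψ, hvψ⟩ := hv.exists_polar
  obtain ⟨η', hη', hη'γ, hη'f⟩ := M₂.exists_ray .Z hv hfinγ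
  obtain ⟨w, hw⟩ := La.exists_inside
  obtain ⟨rδ, hrδ, θ, hθ, hwθ⟩ := hw.exists_polar
  obtain ⟨δ, hδ, -, hδf⟩ := (La.translate x).exists_ray .X (u := w) hw Set.finite_empty
  obtain ⟨δ', hδ', -, hδ'f⟩ := (La.translate x).exists_ray .Z (u := w) hw Set.finite_empty
  have hη'ψ := hη'f
  have hδθ := hδf
  have hδ'θ := hδ'f
  rw [hvψ] at hη'ψ
  rw [hwθ] at hδθ hδ'θ
  obtain ⟨hψ1, hψ2⟩ := hψ
  change M.direction + 2 * (M.angle / 3) < ψ at hψ1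
  change ψ < M.direction + 2 * (M.angle / 3) + M.angle / 3 at hψ2
  obtain ⟨hθ1, hθ2⟩ := hθ
  set θ' := θ + m * (2 * Real.pi) with hθ'
  have hγ'M := hγ'.mono hM₁M
  have hη'M := hη'.mono hM₂M
  have hML' : ∀ {k : Charge} {γ : InfPath k}, γ.LiesIn M.bonds → ∀ b ∈ L.bonds, γ.parity b = 0 :=
    fun hγ b hb => (hγ.of_disjoint hML).parity_eq_zero (not_not.2 hb)
  have hxM' : ∀ {k : Charge} {γ : InfPath k}, γ.LiesIn (La.translate x).bonds →
      ∀ b ∈ M.bonds, γ.parity b = 0 :=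
    fun hγ b hb => (hγ.of_disjoint hxM.symm).parity_eq_zero (not_not.2 hb)
  have hxL' : ∀ {k : Charge} {γ : InfPath k}, γ.LiesIn (La.translate x).bonds →
      ∀ b ∈ L.bonds, γ.parity b = 0 :=
    fun hγ b hb => (hγ.of_disjoint hxL.symm).parity_eq_zero (not_not.2 hb)
  have hdisj : ∀ i j, η'.bond i ≠ γ'.bond j := fun i j hij =>
    hη'γ i ⟨hη' i, j, hij.symm⟩
  have hγη : ∀ n, γ'.parity (η'.bond n) = 0 := fun n =>
    γ'.parity_eq_zero_of_notMem fun ⟨j, hj⟩ => hdisj n j hj.symm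
  have hηγ : ∀ n, η'.parity (γ'.bond n) = 0 := fun n =>
    η'.parity_eq_zero_of_notMem fun ⟨j, hj⟩ => hdisj j n hj
  obtain ⟨c, hc⟩ := exists_transports (La := La) (x := x) (hγ.of_disjoint hxL)
    (hγ'M.of_disjoint hxM)
  obtain ⟨d, hd⟩ := exists_transports (La := La) (x := x) (hη.of_disjoint hxL)
    (hη'M.of_disjoint hxM)
  obtain ⟨f, e, hf⟩ : ∃ (f : Site → ZMod 2) (e : Chain),
      cobd .Z f = γ'.parity + δ.parity + e := exists_path_potential (k := .Z) γ' δ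
  obtain ⟨f', e', hf'⟩ : ∃ (f : Site → ZMod 2) (e : Chain),
      cobd .X f = η'.parity + δ'.parity + e := exists_path_potential (k := .X) η' δ'
  -- Sectors without jumps at infinity. In the order `φ`, `ψ`, `θ'`, `L`, `φ + 2π`, the directions
  -- `φ` and `θ'` separate `M₂` from `L`, whereas `L` and, one turn on, `M₁` lie together between
  -- `θ'` and `ψ + 2π`.
  have hbad : ∀ K : Cone, φ < K.direction → K.direction + K.angle < θ' →
      {b ∈ K.bonds | cobd .Z f b ≠ 0}.Finite := fun K g1 g2 => by
    have := K.angle_pos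
    refine finite_ne_zero_of_eq hf (γ'.finite_parity_ne_zero
      (hγ'φ.finite_range_of_angle_mod hrγ 1 K ?_ ?_)) (hδθ.finite_range_of_angle_mod hrδ m K ?_ ?_)
    all_goals push_cast; linarith
  have hbad' : ∀ K : Cone, θ' < K.direction → K.direction + K.angle < φ + 2 * Real.pi →
      {b ∈ K.bonds | cobd .Z f b ≠ 0}.Finite := fun K g1 g2 => by
    have := K.angle_pos
    refine finite_ne_zero_of_eq hf (γ'.finite_parity_ne_zero
      (hγ'φ.finite_range_of_angle_mod hrγ 1 K ?_ ?_))
      (hδθ.finite_range_of_angle_mod hrδ (m + 1) K ?_ ?_)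
    all_goals push_cast; linarith
  have hbad'' : ∀ K : Cone, θ' < K.direction → K.direction + K.angle < ψ + 2 * Real.pi →
      {b ∈ K.bonds | cobd .X f' b ≠ 0}.Finite := fun K g1 g2 => by
    have := K.angle_pos
    refine finite_ne_zero_of_eq hf' (η'.finite_parity_ne_zero
      (hη'ψ.finite_range_of_angle_mod hrη 1 K ?_ ?_))
      (hδ'θ.finite_range_of_angle_mod hrδ (m + 1) K ?_ ?_)
    all_goals push_cast; linarith
  have p1 : φ < M₂.direction := by change φ < M.direction + 2 * (M.angle / 3); linarith
  have p2 : M₂.direction + M₂.angle < θ' := by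
    change M.direction + 2 * (M.angle / 3) + M.angle / 3 < θ'; linarith
  have p3 : θ' < (L.shift m').direction := by
    change θ' < L.direction + m' * (2 * Real.pi); linarith
  have p4 : (L.shift m').direction + (L.shift m').angle < φ + 2 * Real.pi := by
    change L.direction + m' * (2 * Real.pi) + L.angle < _; linarith
  have p5 : (L.shift m').direction + (L.shift m').angle < ψ + 2 * Real.pi := by
    change L.direction + m' * (2 * Real.pi) + L.angle < _; linarith
  have p6 : θ' < (M₁.shift 1).direction := by
    change θ' < M.direction + (1 : ℤ) * (2 * Real.pi)
    push_cast
    linarith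
  have p7 : (M₁.shift 1).direction + (M₁.shift 1).angle < ψ + 2 * Real.pi := by
    change M.direction + (1 : ℤ) * (2 * Real.pi) + M.angle / 3 < _
    push_cast
    linarith
  obtain ⟨a₁, ha₁⟩ := M₂.oneEnded .Z f (hbad M₂ p1 p2)
  obtain ⟨a₂, ha₂⟩ := (L.shift m').oneEnded .Z f (hbad' _ p3 p4)
  obtain ⟨b₁, hb₁⟩ := (M₁.shift 1).oneEnded .X f' (hbad'' _ p6 p7)
  obtain ⟨b₂, hb₂⟩ := (L.shift m').oneEnded .X f' (hbad'' _ p3 p5)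
  have hb : b₁ = b₂ := Cone.eq_of_sector hbad'' p6 p7 p3 p5 hb₁ hb₂
  have ha : a₁ + a₂ = 1 := by
    refine endValue_add_of_crossing hu hγ'f hu1 hu2 hu3 hu4 ⟨hφ1, hφ2⟩ huφ
      (hf.trans (add_assoc _ _ _)) ?_ ?_ ?_ hbad hbad' p1 p2 ha₁ p3 p4 ha₂
    · refine (finite_chain_ne_zero e).subset ?_
      rintro b ⟨hb, hne⟩
      rwa [Pi.add_apply, hxM' hδ b (hM₁M hb), zero_add] at hne
    · change θ' ≤ M.direction + _
      linarith
    · change M.direction + M.angle / 3 ≤ θ'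
      linarith
  rw [Cone.shift_bonds] at ha₂ hb₁ hb₂
  have hA := eventually_pair_eq hf hd.tendsto hd.bd_eq
    (fun n b hb => hδ.parity_eq_zero fun hb' => hb (hd.avoids n b hb'))
    (fun n => by rw [Pi.add_apply, hML' hγ'M _ (hη n), hxL' hδ _ (hη n), add_zero])
    (fun n => by rw [Pi.add_apply, hγη, hxM' hδ _ (hη'M n), add_zero]) ha₂ ha₁ hη hη'
  have hB := eventually_pair_eq hf' hc.tendsto hc.bd_eq
    (fun n b hb => hδ'.parity_eq_zero fun hb' => hb (hc.avoids n b hb'))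
    (fun n => by rw [Pi.add_apply, hML' hη'M _ (hγ n), hxL' hδ' _ (hγ n), add_zero])
    (fun n => by rw [Pi.add_apply, hηγ, hxM' hδ' _ (hγ'M n), add_zero]) hb₂ hb₁ hγ hγ'
  -- The intersection number of `γ + γ'` with `η + η'` enters both exponents and cancels in their
  -- sum.
  obtain ⟨s, hs1, hs2⟩ := exists_eventually_pair_pair (k := .X) (c := c) (d := d)
    (S := γ.parity + γ'.parity) (T := η.parity + η'.parity) hc.tendsto hd.tendsto
    (fun n => by rw [hc.bd_eq, hc.bd_eq]) (fun n => (hd.bd_eq n).trans (hd.bd_eq 0).symm)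
  refine ⟨γ', η', x, c, d, s + (a₂ + a₁), s + (b₂ + b₁), hγ'M, hη'M, hc, hd, ?_, ?_, ?_⟩
  · filter_upwards [hA, hs1] with n g1 g2
    rw [pair_add_left, g1] at g2
    rw [← g2, add_assoc, CharTwo.add_self_eq_zero, add_zero]
  · filter_upwards [hB, hs2] with n g1 g2
    rw [pair_add_left, g1] at g2
    rw [← g2, add_assoc, CharTwo.add_self_eq_zero, add_zero]
  · rw [hb, CharTwo.add_self_eq_zero, add_zero, add_right_comm, CharTwo.add_self_eq_zero, zero_add,
      add_comm, ha]

end ToricCode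

end

/-! ### The theorem -/

theorem mainTheorem3 (ω : QuasiLocal →ₚ[ℂ] ℂ) (hω : IsGroundState ω) (La L : Cone)
    (hL : ∃ M : Cone, Before La M L) :
    (∀ (k : Charge) (γ₁ γ₂ : InfPath k), γ₁.LiesIn L.bonds → γ₂.LiesIn L.bonds →
      braidings ω La γ₁.aut γ₂.aut = {1}) ∧
    (∀ (γ : InfPath .X) (η : InfPath .Z), γ.LiesIn L.bonds → η.LiesIn L.bonds →
      (braidings ω La γ.aut η.aut = {1} ∧ braidings ω La η.aut γ.aut = {-1}) ∨
      (braidings ω La γ.aut η.aut = {-1} ∧ braidings ω La η.aut γ.aut = {1})) ∧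
    (∀ (k₁ k₂ : Charge) (γ₁ : InfPath k₁) (γ₂ : InfPath k₂),
      γ₁.LiesIn L.bonds → γ₂.LiesIn L.bonds →
      Nonempty (TransportNet La L γ₂) ∧
      ∀ N : TransportNet La L γ₂, ∃ V : auxAlgebra ω La,
        V ∈ unitary (auxAlgebra ω La) ∧
        (∀ A : QuasiLocal,
          (V : Op ω) * gnsRep ω (γ₂.aut A) = gnsRep ω (N.endPath.aut A) * (V : Op ω)) ∧
        Tendsto (fun n => ContinuousLinearMapWOT.ofCLM (gnsRep ω (N.op n))) atTop
          (𝓝 (ContinuousLinearMapWOT.ofCLM (V : Op ω))) ∧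
        ∃ s : ℂ, (s = 1 ∨ s = -1) ∧ (∀ᶠ n in atTop, γ₁.aut (N.op n) = s • N.op n) ∧
          braidings ω La γ₁.aut γ₂.aut = {s • (1 : Op ω)}) := by
  obtain ⟨M, hM⟩ := hL
  obtain ⟨u, hu⟩ := M.exists_inside
  have hray : ∀ k : Charge, ∃ η : InfPath k, η.LiesIn M.bonds := fun k =>
    (M.exists_ray k hu Set.finite_empty).imp fun η h => h.1
  have hnet : ∀ {k : Charge} {γ : InfPath k}, γ.LiesIn L.bonds →
      Nonempty (TransportNet La L γ) := fun {k γ} hγ => by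
    obtain ⟨η, hη⟩ := hray k
    exact exists_transportNet hM hγ hη
  refine ⟨fun k γ₁ γ₂ h₁ h₂ => ?_, fun γ η hγ hη => ?_, fun k₁ k₂ γ₁ γ₂ h₁ h₂ =>
    ⟨hnet h₂, fun N => ?_⟩⟩
  · obtain ⟨N⟩ := hnet h₂
    have h := braidings_eq hω N.before h₁ h₂ N.endPath_liesIn N.transports (s := 1)
      (Eventually.of_forall fun n => phase_self _ _)
    rwa [one_smul] at h
  · obtain ⟨γ', η', x, c, d, a, b, hγ', hη', hc, hd, ha, hb, hab⟩ :=
      exists_transports_of_ne hM hγ hη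
    have h₁ := braidings_eq hω hM hγ hη hη' hd (s := sgn a) (by
      filter_upwards [ha] with n hn
      rw [phase_of_ne Charge.noConfusion, hn])
    have h₂ := braidings_eq hω hM hη hγ hγ' hc (s := sgn b) (by
      filter_upwards [hb] with n hn
      rw [phase_of_ne Charge.noConfusion, hn])
    rw [h₁, h₂]
    -- The exponents add up to one, so exactly one of the two braiding operators is `-1`.
    rcases zmod_two_cases a with rfl | rfl
    · left
      rw [zero_add] at hab
      simp [hab]
    · right
      have hb0 : b = 0 := add_eq_left.1 hab
      simp [hb0]
  · obtain ⟨V, -, v2, v3, v4, v5⟩ := N.transports.exists_unitary hω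
    obtain ⟨s, hs1, hs2⟩ := N.transports.exists_sign γ₁
    refine ⟨V, mem_unitary_of_mul_self v2 v3, fun A => ?_, ?_, s, hs1, ?_,
      braidings_eq hω N.before h₁ h₂ N.endPath_liesIn N.transports hs2⟩
    · rw [← v5 A, mul_assoc _ (V : Op ω) V, v3, mul_one]
    · simp only [N.op_eq_chainOp]
      exact tendsto_wot v4
    · filter_upwards [hs2] with n hn
      rw [N.op_eq_chainOp, γ₁.aut_chainOp, hn]
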